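/- Let $B$ be a smooth $n$-dimensional manifold (Hausdorff, second countable) with a fixed structure of a cell complex (CW complex); write $B^m$ for its $m$-skeleton. Let $P\subset T^*B$ be a closed lattice of rank $k$: each $P_x=P\cap T^*_xB$ is the $\mathbb Z$-span of $k$ linearly independent covectors, which can locally be chosen to vary smoothly with $x$, and every local smooth section of $P$ is a closed $1$-form. An affine fibration with underlying fibration $T^*B/P$ is a smooth fibration $\pi\colon E\to B$, with free and transitive actions of the groups $T^*_xB/P_x$ on the fibres $\pi^{-1}(x)$, that is locally over $B$ fibrewise and equivariantly diffeomorphic to $T^*B/P$. Its fibres $F_x$ satisfy $\pi_1(F_x)\cong\pi_1(T^*_xB/P_x)= P_x$, so the obstruction cochain of a section $s$ of $E$ over $B^1$ (which assigns to each $2$-cell the element of $\pi_1$ of the fibre given by the restriction of $s$ to the boundary of the cell, in a trivialization of $E$ over the cell) is a cellular cochain in $\mathcal C^2(B,P)$ with coefficients in the local system $P$. Its class in the cellular cohomology $H^2(B,P)$ does not depend on $s$ and is called the primary obstruction class of $E$. Then for every class $\gamma\in H^2(B,P)$ there exists an affine fibration $\pi\colon E\to B$ with underlying fibration $T^*B/P$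 whose primary obstruction class is $\gamma$. -/

import Mathlib

open Set Bundle Topology
open scoped Manifold ContDiff

noncomputable section

namespace LatticeFibration

universe u

/-! ### The cotangent bundle -/

/-- The model space `ℝⁿ` of an `n`-dimensional manifold. -/
abbrev Eucl (n : ℕ) : Type := EuclideanSpace ℝ (Fin n)

/-- The dual space `(ℝⁿ)*`, the model fibre of the cotangent bundle. -/
abbrev EuclDual (n : ℕ) : Type := Eucl n →L[ℝ] ℝ

/-- The cotangent space `T*_x B`. -/
abbrev Cot {n : ℕ} {B : Type u} [TopologicalSpace B] [ChartedSpace (Eucl n) B]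
    [IsManifold 𝓘(ℝ, Eucl n) ∞ B] (x : B) : Type :=
  TangentSpace 𝓘(ℝ, Eucl n) x →L[ℝ] ℝ

/-- The total space of the cotangent bundle `T*B`, with Mathlib's topology and smooth structure
(those of the bundle of homomorphisms from the tangent bundle to the trivial line bundle). -/
abbrev CotBundle (n : ℕ) (B : Type u) [TopologicalSpace B] [ChartedSpace (Eucl n) B]
    [IsManifold 𝓘(ℝ, Eucl n) ∞ B] : Type u :=
  TotalSpace (EuclDual n) (fun x : B => Cot (n := n) x)

/-- The point `(x, α)` of `T*B`. -/
abbrev cotMk {n : ℕ} {B : Type u} [TopologicalSpace B] [ChartedSpace (Eucl n) B]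
    [IsManifold 𝓘(ℝ, Eucl n) ∞ B] (x : B) (α : Cot (n := n) x) : CotBundle n B :=
  TotalSpace.mk' (EuclDual n) x α

section

variable {n : ℕ} {B : Type u} [TopologicalSpace B] [ChartedSpace (Eucl n) B]
  [IsManifold 𝓘(ℝ, Eucl n) ∞ B]

/-- The restriction to `U` of the `1`-form `α` is smooth. -/
def SmoothFormOn (α : ∀ x : B, Cot (n := n) x) (U : Set B) : Prop :=
  ContMDiffOn 𝓘(ℝ, Eucl n) (𝓘(ℝ, Eucl n).prod 𝓘(ℝ, EuclDual n)) ∞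
    (fun x => cotMk x (α x)) U

/-- The coefficients `y ↦ ∑ i, αᵢ(y) dyⁱ` of the `1`-form `α` in the chart at `x₀`
(the pullback of `α` by the inverse of the chart). -/
def localForm (α : ∀ x : B, Cot (n := n) x) (x₀ : B) (y : Eucl n) : EuclDual n :=
  (α ((extChartAt 𝓘(ℝ, Eucl n) x₀).symm y)).comp
    (mfderiv 𝓘(ℝ, Eucl n) 𝓘(ℝ, Eucl n) (extChartAt 𝓘(ℝ, Eucl n) x₀).symm y)

/-- `dα = 0` on `U`: at each point `x₀` of `U`, in the chart at `x₀`, the derivative of the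
coefficients of `α` is symmetric. -/
def ClosedFormOn (α : ∀ x : B, Cot (n := n) x) (U : Set B) : Prop :=
  ∀ x₀ ∈ U, ∀ v w : Eucl n,
    fderiv ℝ (localForm α x₀) (extChartAt 𝓘(ℝ, Eucl n) x₀ x₀) v w =
      fderiv ℝ (localForm α x₀) (extChartAt 𝓘(ℝ, Eucl n) x₀ x₀) w v

end

/-! ### Lattices -/

/-- A lattice of rank `k` in `T*B`: a subgroup `P_x ≅ ℤᵏ` of each cotangent space which is the
`ℤ`-span of `k` linearly independent covectors, these varying smoothly with `x` locally. -/
structure Lattice (n : ℕ) (B : Type u) [TopologicalSpace B] [ChartedSpace (Eucl n) B]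
    [IsManifold 𝓘(ℝ, Eucl n) ∞ B] (k : ℕ) where
  /-- The discrete subgroup `P_x` of `T*_x B`. -/
  fiber : ∀ x : B, AddSubgroup (Cot (n := n) x)
  exists_frame : ∀ x : B, ∃ U : Set B, IsOpen U ∧ x ∈ U ∧
    ∃ α : Fin k → ∀ y : B, Cot (n := n) y, (∀ i, SmoothFormOn (α i) U) ∧
      ∀ y ∈ U, LinearIndependent ℝ (fun i => α i y) ∧
        fiber y = AddSubgroup.closure (Set.range fun i => α i y)

variable {n : ℕ} {B : Type u} [TopologicalSpace B] [ChartedSpace (Eucl n) B]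
  [IsManifold 𝓘(ℝ, Eucl n) ∞ B] {k : ℕ}

/-- A lattice is closed if each of its local smooth sections is a closed `1`-form. -/
def Lattice.Closed (P : Lattice n B k) : Prop :=
  ∀ (U : Set B) (α : ∀ x : B, Cot (n := n) x), IsOpen U → SmoothFormOn α U →
    (∀ x ∈ U, α x ∈ P.fiber x) → ClosedFormOn α U

/-- The fibre `T*_x B / P_x` of the fibration `T*B / P`. -/
abbrev Lattice.QuotFiber (P : Lattice n B k) (x : B) : Type := Cot (n := n) x ⧸ P.fiber x

/-! ### Affine fibrations -/

/-- An affine fibration `π : E → B` with underlying fibration `T*B / P`: a smooth fibration with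
free and transitive actions of the groups `T*_x B / P_x` on the fibres `π⁻¹(x)` that is locally
isomorphic to `T*B / P`. -/
structure AffineFibration (P : Lattice n B k) where
  /-- The total space `E`, a smooth manifold of dimension `2n`. -/
  Total : Type u
  [top : TopologicalSpace Total]
  [charted : ChartedSpace (ModelProd (Eucl n) (EuclDual n)) Total]
  [manifold : IsManifold (𝓘(ℝ, Eucl n).prod 𝓘(ℝ, EuclDual n)) ∞ Total]
  [t2 : T2Space Total]
  [secondCountable : SecondCountableTopology Total]
  /-- The projection `π`. -/
  proj : Total → B
  contMDiff_proj : ContMDiff (𝓘(ℝ, Eucl n).prod 𝓘(ℝ, EuclDual n)) 𝓘(ℝ, Eucl n) ∞ proj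
  /-- The fibrewise action of `T*B / P`. -/
  [action : ∀ x : B, AddAction (P.QuotFiber x) {z : Total // proj z = x}]
  /-- The action on each fibre is free and transitive. -/
  regular : ∀ (x : B) (z w : {z : Total // proj z = x}), ∃! v : P.QuotFiber x, v +ᵥ z = w
  /-- Near each point there is a section `s` such that `(y, α) ↦ [α] + s(y)` is a local
  diffeomorphism from `T*U` to `π⁻¹(U)`. As the smooth structure on `T*U / P` is the one for
  which `T*U → T*U / P` is a local diffeomorphism, this means that `[α] ↦ [α] + s(y)` is an
  equivariant diffeomorphism from `T*U / P` onto `π⁻¹(U)`. (The values of `s` outside `U` are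
  irrelevant.) -/
  locally_trivial : ∀ x : B, ∃ U : Set B, IsOpen U ∧ x ∈ U ∧
    ∃ s : ∀ y : B, {z : Total // proj z = y},
      IsLocalDiffeomorphOn (𝓘(ℝ, Eucl n).prod 𝓘(ℝ, EuclDual n))
        (𝓘(ℝ, Eucl n).prod 𝓘(ℝ, EuclDual n)) ∞
        (fun a : CotBundle n B => (((a.2 : P.QuotFiber a.1) +ᵥ s a.1 :
          {z : Total // proj z = a.1}) : Total))
        {a : CotBundle n B | a.1 ∈ U}

attribute [instance] AffineFibration.top AffineFibration.charted AffineFibration.manifold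
  AffineFibration.t2 AffineFibration.secondCountable AffineFibration.action

/-- The fibre `π⁻¹(x)`. -/
abbrev AffineFibration.Fiber {P : Lattice n B k} (E : AffineFibration P) (x : B) : Type u :=
  {z : E.Total // E.proj z = x}

/-! ### Singular cubes and cochains with values in the local system `P` -/

/-- The cube `[-1, 1]ᵐ` (the closed unit ball of `Fin m → ℝ`). -/
abbrev Cube (m : ℕ) : Type := Fin m → Set.Icc (-1 : ℝ) 1

/-- The two ends of `[-1, 1]`. -/
def endpoint (ε : Bool) : Set.Icc (-1 : ℝ) 1 :=
  if ε then ⟨1, by norm_num⟩ else ⟨-1, by norm_num⟩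

/-- The inclusion of the face `tᵢ = 1` (`ε = true`) or `tᵢ = -1` (`ε = false`) of a cube. -/
def face {m : ℕ} (i : Fin (m + 1)) (ε : Bool) : C(Cube m, Cube (m + 1)) where
  toFun t := i.insertNth (endpoint ε) t
  continuous_toFun := by fun_prop

theorem continuous_add_cot {X : Type*} [TopologicalSpace X] {σ : X → B}
    {a b : ∀ t, Cot (n := n) (σ t)} (ha : Continuous fun t => cotMk (σ t) (a t))
    (hb : Continuous fun t => cotMk (σ t) (b t)) :
    Continuous fun t => cotMk (σ t) (a t + b t) := by
  rw [continuous_iff_continuousAt] at *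
  intro t₀
  have h1 := (FiberBundle.continuousAt_totalSpace (EuclDual n) _).1 (ha t₀)
  have h2 := (FiberBundle.continuousAt_totalSpace (EuclDual n) _).1 (hb t₀)
  refine (FiberBundle.continuousAt_totalSpace (EuclDual n) _).2 ⟨h1.1, ?_⟩
  refine (h1.2.add h2.2).congr ?_
  have hU := h1.1.preimage_mem_nhds ((trivializationAt (EuclDual n)
    (fun x : B => Cot (n := n) x) (σ t₀)).open_baseSet.mem_nhds
      (mem_baseSet_trivializationAt _ _ _))
  filter_upwards [hU] with t ht
  exact (((trivializationAt (EuclDual n) (fun x : B => Cot (n := n) x) (σ t₀)).linear ℝ ht).map_add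
    (a t) (b t)).symm

theorem continuous_neg_cot {X : Type*} [TopologicalSpace X] {σ : X → B}
    {a : ∀ t, Cot (n := n) (σ t)} (ha : Continuous fun t => cotMk (σ t) (a t)) :
    Continuous fun t => cotMk (σ t) (-a t) := by
  rw [continuous_iff_continuousAt] at *
  intro t₀
  have h1 := (FiberBundle.continuousAt_totalSpace (EuclDual n) _).1 (ha t₀)
  refine (FiberBundle.continuousAt_totalSpace (EuclDual n) _).2 ⟨h1.1, ?_⟩
  refine h1.2.neg.congr ?_
  have hU := h1.1.preimage_mem_nhds ((trivializationAt (EuclDual n)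
    (fun x : B => Cot (n := n) x) (σ t₀)).open_baseSet.mem_nhds
      (mem_baseSet_trivializationAt _ _ _))
  filter_upwards [hU] with t ht
  exact (((trivializationAt (EuclDual n) (fun x : B => Cot (n := n) x) (σ t₀)).linear ℝ ht).map_neg
    (a t)).symm

theorem continuous_zero_cot {X : Type*} [TopologicalSpace X] {σ : X → B} (hσ : Continuous σ) :
    Continuous fun t => cotMk (σ t) (0 : Cot (n := n) (σ t)) := by
  rw [continuous_iff_continuousAt]
  intro t₀
  refine (FiberBundle.continuousAt_totalSpace (EuclDual n) _).2 ⟨hσ.continuousAt, ?_⟩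
  refine (continuousAt_const (y := (0 : EuclDual n))).congr ?_
  have hU := hσ.continuousAt.preimage_mem_nhds ((trivializationAt (EuclDual n)
    (fun x : B => Cot (n := n) x) (σ t₀)).open_baseSet.mem_nhds
      (mem_baseSet_trivializationAt _ _ _))
  filter_upwards [hU] with t ht
  exact ((trivializationAt (EuclDual n) (fun x : B => Cot (n := n) x) (σ t₀)).linear ℝ
    ht).map_zero.symm

/-- The continuous sections along `σ` of `P → B`, as a subgroup of all sections of `T*B`. -/
def Lattice.alongSubgroup (P : Lattice n B k) {m : ℕ} (σ : C(Cube m, B)) :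
    AddSubgroup (∀ t, Cot (n := n) (σ t)) where
  carrier := {a | (∀ t, a t ∈ P.fiber (σ t)) ∧ Continuous fun t => cotMk (σ t) (a t)}
  add_mem' ha hb := ⟨fun t => add_mem (ha.1 t) (hb.1 t), continuous_add_cot ha.2 hb.2⟩
  zero_mem' := ⟨fun t => zero_mem _, continuous_zero_cot σ.continuous⟩
  neg_mem' {a} ha := ⟨fun t => neg_mem (ha.1 t), by
    exact continuous_neg_cot ha.2⟩

/-- The group `Γ(σ)` of continuous sections of the covering `P → B` along a singular cube `σ`.
As a cube is simply connected, evaluation at any point `t` identifies it with `P_{σ(t)}`: this is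
the value of the local system on `σ`. -/
def Lattice.along (P : Lattice n B k) {m : ℕ} (σ : C(Cube m, B)) : Type :=
  P.alongSubgroup σ

instance (P : Lattice n B k) {m : ℕ} (σ : C(Cube m, B)) : AddCommGroup (P.along σ) :=
  inferInstanceAs (AddCommGroup (P.alongSubgroup σ))

/-- The covector at `σ(t)` of a section of `P` along `σ`. -/
def Lattice.along.val {P : Lattice n B k} {m : ℕ} {σ : C(Cube m, B)} (a : P.along σ)
    (t : Cube m) : Cot (n := n) (σ t) :=
  Subtype.val (p := (· ∈ P.alongSubgroup σ)) a t

/-- Restriction of sections along `σ` to sections along `σ ∘ f`. -/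
def Lattice.restrict (P : Lattice n B k) {m l : ℕ} {σ : C(Cube m, B)} (f : C(Cube l, Cube m)) :
    P.along σ →+ P.along (σ.comp f) where
  toFun a := ⟨fun t => a.1 (f t), fun t => a.2.1 (f t), a.2.2.comp f.continuous⟩
  map_zero' := rfl
  map_add' _ _ := rfl

/-- Singular cubical `m`-cochains with values in the local system `P`. -/
abbrev Lattice.Cochain (P : Lattice n B k) (m : ℕ) : Type u :=
  ∀ σ : C(Cube m, B), P.along σ

/-- `w = (δu)(τ)`: the value of the cubical coboundary of `u` on the cube `τ` is
`∑ i, (-1)ⁱ (u(τ|_{tᵢ = 1}) - u(τ|_{tᵢ = -1}))`, where the values of `u` on the faces, which are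
sections along these faces, are extended (uniquely) to sections along the cube `τ`. -/
def Lattice.IsCoboundaryOn {P : Lattice n B k} {m : ℕ} (u : P.Cochain m) (τ : C(Cube (m + 1), B))
    (w : P.along τ) : Prop :=
  ∃ p : Fin (m + 1) → Bool → P.along τ,
    (∀ i ε, P.restrict (face i ε) (p i ε) = u (τ.comp (face i ε))) ∧
      w = ∑ i : Fin (m + 1), (-1 : ℤ) ^ (i : ℕ) • (p i true - p i false)

theorem Lattice.IsCoboundaryOn.add {P : Lattice n B k} {m : ℕ} {u v : P.Cochain m}
    {τ : C(Cube (m + 1), B)} {w z : P.along τ} (hu : IsCoboundaryOn u τ w)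
    (hv : IsCoboundaryOn v τ z) : IsCoboundaryOn (u + v) τ (w + z) := by
  obtain ⟨p, hp, rfl⟩ := hu
  obtain ⟨q, hq, rfl⟩ := hv
  refine ⟨fun i ε => p i ε + q i ε, fun i ε => by rw [map_add, hp, hq]; rfl, ?_⟩
  rw [← Finset.sum_add_distrib]
  refine Finset.sum_congr rfl fun i _ => ?_
  rw [← smul_add, add_sub_add_comm]

theorem Lattice.IsCoboundaryOn.neg {P : Lattice n B k} {m : ℕ} {u : P.Cochain m}
    {τ : C(Cube (m + 1), B)} {w : P.along τ} (hu : IsCoboundaryOn u τ w) :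
    IsCoboundaryOn (-u) τ (-w) := by
  obtain ⟨p, hp, rfl⟩ := hu
  refine ⟨fun i ε => -p i ε, fun i ε => by rw [map_neg, hp]; rfl, ?_⟩
  rw [← Finset.sum_neg_distrib]
  refine Finset.sum_congr rfl fun i _ => ?_
  rw [← smul_neg, neg_sub']

theorem Lattice.isCoboundaryOn_zero {P : Lattice n B k} {m : ℕ} (τ : C(Cube (m + 1), B)) :
    IsCoboundaryOn (0 : P.Cochain m) τ 0 :=
  ⟨0, fun i ε => by simp, by simp⟩

/-- A singular cube is degenerate if it does not depend on one of its coordinates. -/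
def IsDegenerate {m : ℕ} (σ : C(Cube m, B)) : Prop :=
  ∃ i, ∀ t t' : Cube m, (∀ j, j ≠ i → t j = t' j) → σ t = σ t'

/-- The relative cocycles `Zᵐ(X, A; P)` of a pair `A ⊆ X` of subspaces of `B` in normalized
singular cubical cohomology: they vanish on the cubes in `A` and on the degenerate cubes, and
their coboundary vanishes on the cubes in `X`. (The values on cubes that do not lie in `X` are
irrelevant.) -/
def Lattice.relCocycles (P : Lattice n B k) (X A : Set B) (m : ℕ) : AddSubgroup (P.Cochain m) where
  carrier := {u | (∀ σ : C(Cube m, B), Set.range σ ⊆ A → u σ = 0) ∧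
    (∀ σ : C(Cube m, B), Set.range σ ⊆ X → IsDegenerate σ → u σ = 0) ∧
    ∀ τ : C(Cube (m + 1), B), Set.range τ ⊆ X → IsCoboundaryOn u τ 0}
  add_mem' {u v} hu hv := by
    refine ⟨fun σ h => ?_, fun σ h h' => ?_, fun τ h => ?_⟩
    · rw [Pi.add_apply, hu.1 σ h, hv.1 σ h, add_zero]
    · rw [Pi.add_apply, hu.2.1 σ h h', hv.2.1 σ h h', add_zero]
    · simpa using (hu.2.2 τ h).add (hv.2.2 τ h)
  zero_mem' := ⟨fun _ _ => rfl, fun _ _ _ => rfl, fun τ _ => isCoboundaryOn_zero τ⟩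
  neg_mem' {u} hu := by
    refine ⟨fun σ h => ?_, fun σ h h' => ?_, fun τ h => ?_⟩
    · rw [Pi.neg_apply, hu.1 σ h, neg_zero]
    · rw [Pi.neg_apply, hu.2.1 σ h h', neg_zero]
    · simpa using (hu.2.2 τ h).neg

/-! ### Cellular cohomology with coefficients in `P` -/

section Cellular

variable [T2Space B] [CWComplex (univ : Set B)]

variable (B) in
/-- The `m`-cells of the cell complex `B`. -/
abbrev Cell (m : ℕ) : Type u := RelCWComplex.cell (univ : Set B) m

variable (B) in
/-- The `m`-skeleton `Bᵐ`. -/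
def skel (m : ℕ) : Set B := (RelCWComplex.skeletonLT (univ : Set B) ((m + 1 : ℕ) : ℕ∞) : Set B)

/-- The characteristic map `[-1, 1]ᵐ → B` of an `m`-cell, as a singular cube. -/
def charMap {m : ℕ} (e : Cell B m) : C(Cube m, B) where
  toFun t := RelCWComplex.map m e fun i => (t i : ℝ)
  continuous_toFun := by
    refine (RelCWComplex.continuousOn m e).comp_continuous (by fun_prop) fun t => ?_
    rw [mem_closedBall_zero_iff, pi_norm_le_iff_of_nonneg zero_le_one]
    exact fun i => abs_le.2 (t i).2

/-- Cellular `m`-cochains: to each `m`-cell `e` they assign an element of the group `P` over the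
cell, that is, of `Γ(χ_e)`. -/
abbrev Lattice.CellCochain (P : Lattice n B k) (m : ℕ) : Type u :=
  ∀ e : Cell B m, P.along (charMap e)

/-- The relative cocycle `u ∈ Z^{m+1}(B^{m+1}, Bᵐ; P)` represents the cellular cochain `c` under
the isomorphism `H^{m+1}(B^{m+1}, Bᵐ; P) ≅ C^{m+1}(B, P)`, which is evaluation on the
characteristic maps of the cells. -/
def Lattice.Represents {P : Lattice n B k} {m : ℕ} (u : P.Cochain (m + 1))
    (c : P.CellCochain (m + 1)) : Prop :=
  u ∈ P.relCocycles (skel B (m + 1)) (skel B m) (m + 1) ∧ ∀ e, u (charMap e) = c e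

/-- `δc = 0` for a cellular `(m+1)`-cochain `c`. The cellular coboundary is the connecting
homomorphism `H^{m+1}(B^{m+1}, Bᵐ; P) → H^{m+2}(B^{m+2}, B^{m+1}; P)`: the value of `δc` on an
`(m+2)`-cell is the value of `δu` on its characteristic map, where `u` is a relative cocycle
that represents `c` (it exists, and the value does not depend on its choice). -/
def Lattice.IsCellCocycle {P : Lattice n B k} {m : ℕ} (c : P.CellCochain (m + 1)) : Prop :=
  ∀ u : P.Cochain (m + 1), Represents u c →
    ∀ e : Cell B (m + 2), IsCoboundaryOn u (charMap e) 0

/-- The group of cellular `2`-coboundaries: the cochains `δb`, where `b` is the cellular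
`1`-cochain represented by a relative cocycle `u ∈ Z¹(B¹, B⁰; P)`. -/
def Lattice.cellCoboundaries (P : Lattice n B k) : AddSubgroup (P.CellCochain 2) where
  carrier := {c | ∃ (b : P.CellCochain 1) (u : P.Cochain 1), Represents u b ∧
    ∀ e : Cell B 2, IsCoboundaryOn u (charMap e) (c e)}
  add_mem' := by
    rintro c d ⟨b, u, hu, hc⟩ ⟨b', v, hv, hd⟩
    exact ⟨b + b', u + v, ⟨add_mem hu.1 hv.1, fun e => by
      rw [Pi.add_apply, hu.2, hv.2]; rfl⟩, fun e => (hc e).add (hd e)⟩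
  zero_mem' := ⟨0, 0, ⟨zero_mem _, fun _ => rfl⟩, fun e => isCoboundaryOn_zero _⟩
  neg_mem' := by
    rintro c ⟨b, u, hu, hc⟩
    exact ⟨-b, -u, ⟨neg_mem hu.1, fun e => by rw [Pi.neg_apply, hu.2]; rfl⟩, fun e => (hc e).neg⟩

/-- The cellular cohomology `H²(B, P)`, consisting of the classes modulo coboundaries of the
cellular `2`-cocycles. -/
def Lattice.H2 (P : Lattice n B k) : Set (P.CellCochain 2 ⧸ P.cellCoboundaries) :=
  {γ | ∃ c : P.CellCochain 2, IsCellCocycle c ∧ QuotientAddGroup.mk c = γ}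

/-! ### Primary obstruction classes -/

/-- The boundary of the square `[-1, 1]²`, traversed counterclockwise from `(-1, -1)` for
`θ ∈ [0, 8]`. -/
def boundaryLoop (θ : ℝ) : Cube 2 :=
  ![Set.projIcc (-1) 1 (by norm_num) (2 - |θ - 3|),
    Set.projIcc (-1) 1 (by norm_num) (2 - |θ - 5|)]

/-- `s` is a (continuous) section of `E` over the `1`-skeleton. (The values of `s` outside the
`1`-skeleton are irrelevant.) -/
def AffineFibration.IsSectionOverOneSkeleton {P : Lattice n B k} (E : AffineFibration P)
    (s : B → E.Total) : Prop :=
  ContinuousOn s (skel B 1) ∧ ∀ x ∈ skel B 1, E.proj (s x) = x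

/-- `c` is the obstruction cochain of the section `s` over the `1`-skeleton. Over a `2`-cell `e`
with characteristic map `χ` choose a section `t` of the (trivial) fibration `χ*E`; it identifies
`χ*E` with `χ*(T*B / P)` and `s ∘ χ` on the boundary of the square with a loop of sections
`[a(θ)]` of `χ*(T*B / P)`. Here `a` is a continuous lift to `T*B`, and the class of the loop in
`π₁` of the fibre, which is `π₁(T*_x B / P_x) = P_x`, is the difference `a(8) - a(0)` of the
endpoints of the lift. -/
def AffineFibration.IsObstructionCochain {P : Lattice n B k} (E : AffineFibration P)
    (s : B → E.Total) (c : P.CellCochain 2) : Prop :=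
  ∀ e : Cell B 2, ∃ t : ∀ x : Cube 2, E.Fiber (charMap e x),
    Continuous (fun x => (t x : E.Total)) ∧
    ∃ a : ∀ θ : ℝ, Cot (n := n) (charMap e (boundaryLoop θ)),
      ContinuousOn (fun θ => cotMk (charMap e (boundaryLoop θ)) (a θ)) (Set.Icc 0 8) ∧
      (∀ θ ∈ Set.Icc (0 : ℝ) 8, s (charMap e (boundaryLoop θ)) =
        (((a θ : P.QuotFiber (charMap e (boundaryLoop θ))) +ᵥ t (boundaryLoop θ) :
          E.Fiber (charMap e (boundaryLoop θ))) : E.Total)) ∧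
      cotMk (charMap e (boundaryLoop 8)) (a 8) =
        cotMk (charMap e (boundaryLoop 0)) (a 0 + (c e).val (boundaryLoop 0))

/-- `γ` is the primary obstruction class of `E`, the obstruction to the existence of a section
over the `2`-skeleton: there is a section over the `1`-skeleton with an obstruction cochain, and
the class of the obstruction cochain of every such section is `γ`. -/
def AffineFibration.IsPrimaryObstructionClass {P : Lattice n B k} (E : AffineFibration P)
    (γ : P.CellCochain 2 ⧸ P.cellCoboundaries) : Prop :=
  (∃ s c, E.IsSectionOverOneSkeleton s ∧ E.IsObstructionCochain s c) ∧
    ∀ s c, E.IsSectionOverOneSkeleton s → E.IsObstructionCochain s c →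
      QuotientAddGroup.mk c = γ

end Cellular

end LatticeFibration

end

/-! Torsors under `T*B / P` are classified by `H²(B, P)`: in the sequence `0 → P → T*B → T*B / P →
0` the sheaf of sections of `T*B` is fine. The proof makes this explicit. From a cellular cocycle
`c` it builds, over the cell complex, a continuous torsor under the bundle of tori `P ⊗ ℝ/ℤ` whose
obstruction cochain is `c`; the torsor is then mapped to `T*B / P` and smoothed.

Torsors are handled without total spaces. As a set each fibre is identified with the group, and the
topology is recorded by functions `G i` that are declared to be continuous sections over the open
stars `cellStar i` of the cells; a section is then a function `s` for which every `s - G i` is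
continuous (`IsTwist`, `IsSecOn`, `IsSecAlong`). Along a cube the local system `P` is constant, so
integral functionals reduce everything to circle torsors, and these are trivial over cubes
(`IsTwist.exists_section_cube`).

A torsor over the `N`-skeleton extends to the `(N+1)`-skeleton as soon as it has a section over the
boundary of each `(N+1)`-cell (`ValidUpTo.extend`). The construction starts with the trivial torsor
over the `1`-skeleton and, on the boundary of a `2`-cell `e`, with the loop `-c e ⊗ angle`. For
`3`-cells the obstruction is `δu`, where `u` is the singular cochain of windings around squares in
the `2`-skeleton; `u` is a relative cocycle that represents `c`, so `δu` vanishes on the `3`-cells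
because `c` is a cocycle (`EdgeSections.mem_relCocycles`, `EdgeSections.exists_section_bdry`). In
higher dimensions nothing obstructs, since circle torsors over spheres of dimension at least `3` are
trivial (`IsTwist.exists_section_bdry_of_le`).

For the smoothing (`exists_smooth_transition`) the local sections are corrected by means of a
partition of unity. The new transition forms are combinations, with smooth coefficients, of
continuous sections of `P`, and those are smooth because `P` is discrete in the fibres. Gluing gives
`SmoothTwist.affineFibration`, whose zero section over the `1`-skeleton has obstruction cochain `c`.

It remains to compare two sections `s`, `s'` over the `1`-skeleton of one affine fibration. Fix,
point by point and without continuity, a covector `d` that represents `s' - s`; along a path there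
is also a continuous lift `q` of this difference. The change of `d - q` from one end of the path to
the other is a `1`-cochain with values in `P`, and its coboundary on a `2`-cell is the difference of
the obstruction cochains (`IsDifferenceCochain.isCoboundaryOn`). -/

noncomputable section

namespace LatticeFibration

universe u

set_option linter.unusedSectionVars false

section

variable {n : ℕ} {B : Type u} [TopologicalSpace B] [ChartedSpace (Eucl n) B]
  [IsManifold 𝓘(ℝ, Eucl n) ∞ B] {k : ℕ}

/-! ### Continuity of covector fields along maps -/

section Along

variable {Y : Type*} [TopologicalSpace Y] {f : Y → B} {S : Set Y} {y₀ : Y}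

/-- The local trivialization of `T*B` around `x₀`. -/
abbrev cotTriv (x₀ : B) : Trivialization (EuclDual n)
    (π (EuclDual n) (fun x : B => Cot (n := n) x)) :=
  trivializationAt (EuclDual n) (fun x : B => Cot (n := n) x) x₀

theorem continuousWithinAt_cot_iff {a : ∀ y, Cot (n := n) (f y)} :
    ContinuousWithinAt (fun y => cotMk (f y) (a y)) S y₀ ↔
      ContinuousWithinAt f S y₀ ∧
        ContinuousWithinAt (fun y => (cotTriv (f y₀) (cotMk (f y) (a y))).2) S y₀ :=
  FiberBundle.continuousWithinAt_totalSpace (EuclDual n) _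

theorem eventually_mem_cotTriv_baseSet (hf : ContinuousWithinAt f S y₀) :
    ∀ᶠ y in 𝓝[S] y₀, f y ∈ (cotTriv (n := n) (f y₀)).baseSet :=
  hf.preimage_mem_nhdsWithin ((cotTriv (n := n) (f y₀)).open_baseSet.mem_nhds
    (mem_baseSet_trivializationAt _ _ _))

theorem continuousWithinAt_cot_add {a b : ∀ y, Cot (n := n) (f y)}
    (ha : ContinuousWithinAt (fun y => cotMk (f y) (a y)) S y₀)
    (hb : ContinuousWithinAt (fun y => cotMk (f y) (b y)) S y₀) :
    ContinuousWithinAt (fun y => cotMk (f y) (a y + b y)) S y₀ := by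
  have h1 := continuousWithinAt_cot_iff.1 ha
  have h2 := continuousWithinAt_cot_iff.1 hb
  refine continuousWithinAt_cot_iff.2 ⟨h1.1, ?_⟩
  have h0 := mem_baseSet_trivializationAt (EuclDual n) (fun x : B => Cot (n := n) x) (f y₀)
  refine (h1.2.add h2.2).congr_of_eventuallyEq ?_ (((cotTriv (n := n) (f y₀)).linear ℝ h0).map_add _ _)
  filter_upwards [eventually_mem_cotTriv_baseSet (n := n) h1.1] with y hy
  exact ((cotTriv (n := n) (f y₀)).linear ℝ hy).map_add (a y) (b y)

theorem continuousWithinAt_cot_smul {c : Y → ℝ} {a : ∀ y, Cot (n := n) (f y)}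
    (hc : ContinuousWithinAt c S y₀)
    (ha : ContinuousWithinAt (fun y => cotMk (f y) (a y)) S y₀) :
    ContinuousWithinAt (fun y => cotMk (f y) (c y • a y)) S y₀ := by
  have h1 := continuousWithinAt_cot_iff.1 ha
  refine continuousWithinAt_cot_iff.2 ⟨h1.1, ?_⟩
  have h0 := mem_baseSet_trivializationAt (EuclDual n) (fun x : B => Cot (n := n) x) (f y₀)
  refine (hc.smul h1.2).congr_of_eventuallyEq ?_ (((cotTriv (n := n) (f y₀)).linear ℝ h0).map_smul _ _)
  filter_upwards [eventually_mem_cotTriv_baseSet (n := n) h1.1] with y hy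
  exact ((cotTriv (n := n) (f y₀)).linear ℝ hy).map_smul (c y) (a y)

theorem continuousWithinAt_cot_neg {a : ∀ y, Cot (n := n) (f y)}
    (ha : ContinuousWithinAt (fun y => cotMk (f y) (a y)) S y₀) :
    ContinuousWithinAt (fun y => cotMk (f y) (-a y)) S y₀ := by
  have h : ∀ y, -a y = (-1 : ℝ) • a y := fun y => (neg_one_smul ℝ (a y)).symm
  simp only [h]
  exact continuousWithinAt_cot_smul (c := fun _ => (-1 : ℝ)) continuousWithinAt_const ha

theorem continuousWithinAt_cot_sub {a b : ∀ y, Cot (n := n) (f y)}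
    (ha : ContinuousWithinAt (fun y => cotMk (f y) (a y)) S y₀)
    (hb : ContinuousWithinAt (fun y => cotMk (f y) (b y)) S y₀) :
    ContinuousWithinAt (fun y => cotMk (f y) (a y - b y)) S y₀ := by
  simpa only [sub_eq_add_neg] using continuousWithinAt_cot_add ha (continuousWithinAt_cot_neg hb)

theorem continuousWithinAt_cot_zero (hf : ContinuousWithinAt f S y₀) :
    ContinuousWithinAt (fun y => cotMk (f y) (0 : Cot (n := n) (f y))) S y₀ := by
  refine continuousWithinAt_cot_iff.2 ⟨hf, ?_⟩
  have h0 := mem_baseSet_trivializationAt (EuclDual n) (fun x : B => Cot (n := n) x) (f y₀)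
  refine (continuousWithinAt_const (b := (0 : EuclDual n))).congr_of_eventuallyEq ?_
    ((cotTriv (n := n) (f y₀)).linear ℝ h0).map_zero
  filter_upwards [eventually_mem_cotTriv_baseSet (n := n) hf] with y hy
  exact ((cotTriv (n := n) (f y₀)).linear ℝ hy).map_zero

theorem continuousWithinAt_cot_sum {ι : Type*} (s : Finset ι) {a : ι → ∀ y, Cot (n := n) (f y)}
    (hf : ContinuousWithinAt f S y₀)
    (ha : ∀ i ∈ s, ContinuousWithinAt (fun y => cotMk (f y) (a i y)) S y₀) :
    ContinuousWithinAt (fun y => cotMk (f y) (∑ i ∈ s, a i y)) S y₀ := by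
  classical
  induction s using Finset.induction_on with
  | empty => simpa using continuousWithinAt_cot_zero hf
  | insert i s hi ih =>
    simp only [Finset.sum_insert hi]
    exact continuousWithinAt_cot_add (ha i (by simp)) (ih fun j hj => ha j (by simp [hj]))

theorem continuousWithinAt_cot_base {a : ∀ y, Cot (n := n) (f y)}
    (ha : ContinuousWithinAt (fun y => cotMk (f y) (a y)) S y₀) : ContinuousWithinAt f S y₀ :=
  (continuousWithinAt_cot_iff.1 ha).1

end Along

/-! ### Frames of a lattice -/

/-- A smooth frame of the lattice `P` over an open set, with a continuous family of linear maps
that compute the coordinates with respect to the frame. -/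
structure Lattice.Frame (P : Lattice n B k) where
  /-- the domain of the frame -/
  dom : Set B
  isOpen_dom : IsOpen dom
  /-- the members of the frame -/
  vec : Fin k → ∀ y : B, Cot (n := n) y
  smooth : ∀ i, SmoothFormOn (vec i) dom
  /-- the coordinates with respect to the frame, extended to the cotangent space -/
  coord : ∀ y : B, Cot (n := n) y →ₗ[ℝ] (Fin k → ℝ)
  continuousOn_coord : ContinuousOn (fun a : CotBundle n B => coord a.1 a.2) {a | a.1 ∈ dom}
  coord_vec : ∀ y ∈ dom, ∀ i, coord y (vec i y) = Pi.single i 1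
  mem_iff : ∀ y ∈ dom, ∀ p, p ∈ P.fiber y ↔ ∃ c : Fin k → ℤ, p = ∑ i, c i • vec i y

theorem mem_closure_range_iff {A : Type*} [AddCommGroup A] {ι : Type*} [Fintype ι] (v : ι → A)
    (p : A) : p ∈ AddSubgroup.closure (Set.range v) ↔ ∃ c : ι → ℤ, p = ∑ i, c i • v i := by
  rw [← Submodule.span_int_eq_addSubgroupClosure, Submodule.mem_toAddSubgroup,
    Submodule.mem_span_range_iff_exists_fun]
  exact exists_congr fun c => eq_comm

/-- A left inverse `l` of the frame at `x₀`, read in a trivialization, is no longer a left inverse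
at a nearby point `b`, but applied to the frame there it gives a matrix `M b` that is continuous in
`b` and equal to `1` at `x₀`. Where `det (M b) ≠ 0`, the map `(M b)⁻¹ ∘ l` computes coordinates. -/
theorem Lattice.exists_frame_at (P : Lattice n B k) (x₀ : B) :
    ∃ F : P.Frame, x₀ ∈ F.dom := by
  obtain ⟨U, hU, hx₀, α, hα, hP⟩ := P.exists_frame x₀
  set e := cotTriv (n := n) x₀ with he
  have h0 : x₀ ∈ e.baseSet := mem_baseSet_trivializationAt _ _ _
  -- the coordinate expressions of the frame
  set A : Fin k → B → EuclDual n := fun j b => e.linearMapAt ℝ b (α j b) with hA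
  have hAc : ∀ j, ContinuousOn (A j) (U ∩ e.baseSet) := by
    intro j b hb
    have h1 : ContinuousOn (fun b => e (cotMk b (α j b))) (U ∩ e.baseSet) := by
      refine e.continuousOn.comp ((hα j).continuousOn.mono inter_subset_left) fun b hb => ?_
      rw [e.mem_source]; exact hb.2
    refine (continuous_snd.comp_continuousOn h1).congr (fun b hb => ?_) b hb
    simp [hA, e.coe_linearMapAt_of_mem hb.2]
  have hli : LinearIndependent ℝ fun j => A j x₀ := by
    have := (hP x₀ hx₀).1.map' ((e.linearEquivAt ℝ x₀ h0 : Cot (n := n) x₀ →ₗ[ℝ] EuclDual n))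
      (LinearEquiv.ker _)
    have h1 : (fun j => A j x₀) = (e.linearEquivAt ℝ x₀ h0) ∘ fun i => α i x₀ := by
      ext1 j
      simp [hA, e.coe_linearMapAt_of_mem h0]
    rw [h1]
    exact this
  obtain ⟨l, hl⟩ := (Fintype.linearCombination ℝ fun j => A j x₀).exists_leftInverse_of_injective
    (LinearMap.ker_eq_bot.2 (linearIndependent_iff_injective_fintypeLinearCombination.1 hli))
  have hlA : ∀ j, l (A j x₀) = Pi.single j 1 := fun j => by
    have := LinearMap.congr_fun hl (Pi.single j 1)
    simpa using this
  have hlc : Continuous l := l.continuous_of_finiteDimensional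
  set M : B → Matrix (Fin k) (Fin k) ℝ := fun b => Matrix.of fun i j => l (A j b) i with hM
  have hMc : ContinuousOn M (U ∩ e.baseSet) := by
    refine continuousOn_pi.2 fun i => continuousOn_pi.2 fun j => ?_
    exact (continuous_apply i).comp_continuousOn (hlc.comp_continuousOn (hAc j))
  have hM0 : M x₀ = 1 := by
    ext i j
    simp [hM, hlA, Matrix.one_apply, Pi.single_apply]
  have hdet : ContinuousOn (fun b => (M b).det) (U ∩ e.baseSet) :=
    continuous_id.matrix_det.comp_continuousOn hMc
  have hopen : IsOpen (U ∩ e.baseSet) := hU.inter e.open_baseSet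
  refine ⟨{ dom := (U ∩ e.baseSet) ∩ (fun b => (M b).det) ⁻¹' {0}ᶜ
            isOpen_dom := hdet.isOpen_inter_preimage hopen isOpen_compl_singleton
            vec := α
            smooth := fun i => (hα i).mono fun x hx => hx.1.1
            coord := fun b => ((M b)⁻¹.mulVecLin ∘ₗ l) ∘ₗ e.linearMapAt ℝ b
            continuousOn_coord := ?_
            coord_vec := ?_
            mem_iff := ?_ }, ⟨hx₀, h0⟩, by simp [hM0]⟩
  · have h1 : ContinuousOn (fun a : CotBundle n B => e.linearMapAt ℝ a.1 a.2)
        {a | a.1 ∈ e.baseSet} := by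
      refine ((continuous_snd.comp_continuousOn e.continuousOn).mono fun a ha => ?_).congr
        fun a ha => ?_
      · rw [e.mem_source]; exact ha
      · have ha' : a.1 ∈ e.baseSet := ha
        simp [e.coe_linearMapAt_of_mem ha']
    have h2 : ContinuousOn (fun a : CotBundle n B => (M a.1)⁻¹)
        {a | a.1 ∈ (U ∩ e.baseSet) ∩ (fun b => (M b).det) ⁻¹' {0}ᶜ} := by
      simp only [Matrix.inv_def, Ring.inverse_eq_inv']
      have hp : ContinuousOn (fun a : CotBundle n B => M a.1)
          {a | a.1 ∈ (U ∩ e.baseSet) ∩ (fun b => (M b).det) ⁻¹' {0}ᶜ} :=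
        hMc.comp (FiberBundle.continuous_proj _ _).continuousOn fun a ha => ha.1
      refine ContinuousOn.smul ((continuous_id.matrix_det.comp_continuousOn hp).inv₀
        fun a ha => ha.2) (continuous_id.matrix_adjugate.comp_continuousOn hp)
    have h3 : Continuous fun q : Matrix (Fin k) (Fin k) ℝ × (Fin k → ℝ) => q.1.mulVec q.2 :=
      continuous_fst.matrix_mulVec continuous_snd
    exact h3.comp_continuousOn (h2.prodMk (hlc.comp_continuousOn (h1.mono fun a ha => ha.1.2)))
  · rintro y ⟨hy, hy'⟩ i
    have h1 : l (A i y) = (M y).mulVec (Pi.single i 1) := by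
      ext j
      simp [hM]
    have h2 : IsUnit (M y).det := isUnit_iff_ne_zero.2 hy'
    simp only [LinearMap.comp_apply, Matrix.mulVecLin_apply]
    change (M y)⁻¹.mulVec (l (A i y)) = _
    rw [h1, Matrix.mulVec_mulVec, Matrix.nonsing_inv_mul _ h2, Matrix.one_mulVec]
  · intro y hy p
    rw [(hP y hy.1.1).2]
    exact mem_closure_range_iff _ _

end

section

variable {n : ℕ} {B : Type u} [TopologicalSpace B] [ChartedSpace (Eucl n) B]
  [IsManifold 𝓘(ℝ, Eucl n) ∞ B] {k : ℕ}

/-! ### Rigidity of continuous sections of a lattice -/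

namespace Lattice.Frame

variable {P : Lattice n B k} (F : P.Frame)

theorem coord_sum {y : B} (hy : y ∈ F.dom) (c : Fin k → ℝ) :
    F.coord y (∑ i, c i • F.vec i y) = c := by
  ext j
  simp [map_sum, F.coord_vec y hy, Pi.single_apply]

theorem coord_zsum {y : B} (hy : y ∈ F.dom) (c : Fin k → ℤ) :
    F.coord y (∑ i, c i • F.vec i y) = fun i => (c i : ℝ) := by
  have h : ∑ i, c i • F.vec i y = ∑ i, (c i : ℝ) • F.vec i y :=
    Finset.sum_congr rfl fun i _ => (Int.cast_smul_eq_zsmul ℝ _ _).symm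
  rw [h, F.coord_sum hy]

theorem continuousWithinAt_coord {Y : Type*} [TopologicalSpace Y] {f : Y → B} {S : Set Y} {y₀ : Y}
    {a : ∀ y, Cot (n := n) (f y)} (hy₀ : f y₀ ∈ F.dom)
    (ha : ContinuousWithinAt (fun y => cotMk (f y) (a y)) S y₀) :
    ContinuousWithinAt (fun y => F.coord (f y) (a y)) S y₀ := by
  have h : ContinuousAt (fun a : CotBundle n B => F.coord a.1 a.2) (cotMk (f y₀) (a y₀)) :=
    F.continuousOn_coord.continuousAt
      ((F.isOpen_dom.preimage (FiberBundle.continuous_proj _ _)).mem_nhds hy₀)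
  exact ContinuousAt.comp_continuousWithinAt (f := fun y => cotMk (f y) (a y)) h ha

theorem continuousWithinAt_vec {Y : Type*} [TopologicalSpace Y] {f : Y → B} {S : Set Y} {y₀ : Y}
    (hy₀ : f y₀ ∈ F.dom) (hf : ContinuousWithinAt f S y₀) (i : Fin k) :
    ContinuousWithinAt (fun y => cotMk (f y) (F.vec i (f y))) S y₀ :=
  ((F.smooth i).continuousOn.continuousAt (F.isOpen_dom.mem_nhds hy₀)).comp_continuousWithinAt hf

theorem eventually_mem_dom {Y : Type*} [TopologicalSpace Y] {f : Y → B} {S : Set Y} {y₀ : Y}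
    (hy₀ : f y₀ ∈ F.dom) (hf : ContinuousWithinAt f S y₀) : ∀ᶠ y in 𝓝[S] y₀, f y ∈ F.dom :=
  hf.preimage_mem_nhdsWithin (F.isOpen_dom.mem_nhds hy₀)

/-- A continuous section of `P` has locally constant integral coordinates. -/
theorem eventually_eq_sum {Y : Type*} [TopologicalSpace Y] {f : Y → B} {S : Set Y} {y₀ : Y}
    {a : ∀ y, Cot (n := n) (f y)} (hy₀ : f y₀ ∈ F.dom) (hS : y₀ ∈ S)
    (ha : ContinuousWithinAt (fun y => cotMk (f y) (a y)) S y₀)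
    (haP : ∀ᶠ y in 𝓝[S] y₀, a y ∈ P.fiber (f y)) :
    ∃ c : Fin k → ℤ, ∀ᶠ y in 𝓝[S] y₀, f y ∈ F.dom ∧ a y = ∑ i, c i • F.vec i (f y) := by
  obtain ⟨c, hc⟩ := (F.mem_iff _ hy₀ _).1 (haP.self_of_nhdsWithin hS)
  refine ⟨c, ?_⟩
  have h1 := F.continuousWithinAt_coord hy₀ ha
  -- Integral vectors at sup distance less than `1` are equal, so this ball forces the coordinates
  -- to stay constant.
  have h2 := h1.tendsto (Metric.ball_mem_nhds _ one_pos)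
  filter_upwards [h2, haP, F.eventually_mem_dom hy₀ (continuousWithinAt_cot_base ha)]
    with y hy hyP hyF
  refine ⟨hyF, ?_⟩
  obtain ⟨d, hd⟩ := (F.mem_iff _ hyF _).1 hyP
  rw [hd]
  have hcd : d = c := by
    have hy' : dist (F.coord (f y) (a y)) (F.coord (f y₀) (a y₀)) < 1 := hy
    rw [hd, hc, F.coord_zsum hyF, F.coord_zsum hy₀] at hy'
    ext i
    have h3 := (dist_pi_lt_iff one_pos).1 hy' i
    rw [Int.dist_cast_real, Int.dist_eq] at h3
    have h4 : |d i - c i| < 1 := by exact_mod_cast h3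
    have := Int.abs_lt_one_iff.1 h4
    linarith
  rw [hcd]

end Lattice.Frame

/-- The integral coordinates of a continuous section of `P` in a frame are locally constant, so both
vanishing and non-vanishing are open conditions. This is the discreteness of `P` in the form used
for connectedness arguments. -/
theorem Lattice.eventually_eq_zero_iff (P : Lattice n B k) {Y : Type*} [TopologicalSpace Y]
    {f : Y → B} {S : Set Y} {y₀ : Y} {a : ∀ y, Cot (n := n) (f y)} (hS : y₀ ∈ S)
    (ha : ContinuousWithinAt (fun y => cotMk (f y) (a y)) S y₀)
    (haP : ∀ᶠ y in 𝓝[S] y₀, a y ∈ P.fiber (f y)) :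
    ∀ᶠ y in 𝓝[S] y₀, (a y = 0 ↔ a y₀ = 0) := by
  obtain ⟨F, hF⟩ := P.exists_frame_at (f y₀)
  obtain ⟨c, hc⟩ := F.eventually_eq_sum hF hS ha haP
  have h0 := hc.self_of_nhdsWithin hS
  have key : ∀ y, f y ∈ F.dom → a y = ∑ i, c i • F.vec i (f y) → (a y = 0 ↔ c = 0) := by
    intro y hy h
    constructor
    · intro h'
      have := F.coord_zsum hy c
      rw [← h, h', map_zero] at this
      ext i
      have := congrFun this i
      simp only [Pi.zero_apply] at this
      exact_mod_cast this.symm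
    · rintro rfl
      simpa using h
  filter_upwards [hc] with y hy
  rw [key y hy.1 hy.2, key y₀ h0.1 h0.2]

/-- Sections of cosets of `P` along a map that agree at one point of a connected set agree. -/
theorem Lattice.eq_of_eq_at (P : Lattice n B k) {Y : Type*} [TopologicalSpace Y]
    {f : Y → B} {S : Set Y} (hS : IsPreconnected S) {a b : ∀ y, Cot (n := n) (f y)}
    (ha : ContinuousOn (fun y => cotMk (f y) (a y)) S)
    (hb : ContinuousOn (fun y => cotMk (f y) (b y)) S)
    (hab : ∀ y ∈ S, a y - b y ∈ P.fiber (f y)) {y₀ y₁ : Y} (h₀ : y₀ ∈ S) (h₁ : y₁ ∈ S)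
    (h : a y₀ = b y₀) : a y₁ = b y₁ := by
  have := hS.induction₂ (fun x y => (a x = b x ↔ a y = b y)) (fun x hx => ?_)
    (fun x y z _ _ _ h1 h2 => h1.trans h2) (fun x y _ _ h => h.symm) h₀ h₁
  · exact this.1 h
  · have := P.eventually_eq_zero_iff (f := f) hx (continuousWithinAt_cot_sub (ha x hx) (hb x hx))
      (eventually_mem_nhdsWithin.mono hab)
    filter_upwards [this] with y hy
    rw [sub_eq_zero, sub_eq_zero] at hy
    exact hy.symm

/-! ### Induction on boxes -/

/-- A closed box in a cube. -/
def box {m : ℕ} (a b : Fin m → ℝ) : Set (Cube m) := {t | ∀ i, (t i : ℝ) ∈ Icc (a i) (b i)}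

/-- The conditions on the corners of a nonempty box in the cube. -/
def IsBox {m : ℕ} (a b : Fin m → ℝ) : Prop := ∀ i, -1 ≤ a i ∧ a i ≤ b i ∧ b i ≤ 1

theorem isClosed_box {m : ℕ} (a b : Fin m → ℝ) : IsClosed (box a b) := by
  have : box a b = ⋂ i, {t : Cube m | (t i : ℝ) ∈ Icc (a i) (b i)} := by
    ext t; simp [box]
  rw [this]
  exact isClosed_iInter fun i => isClosed_Icc.preimage (by fun_prop)

/-- The coordinatewise retraction of `ℝᵐ` onto a box. -/
def boxProj {m : ℕ} (a b : Fin m → ℝ) (t : Fin m → ℝ) : Cube m :=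
  fun i => Set.projIcc (-1) 1 (by norm_num) (max (a i) (min (b i) (t i)))

theorem continuous_boxProj {m : ℕ} (a b : Fin m → ℝ) : Continuous (boxProj a b) := by
  unfold boxProj
  refine continuous_pi fun i => continuous_projIcc.comp ?_
  fun_prop

theorem coe_boxProj {m : ℕ} {a b : Fin m → ℝ} (h : IsBox a b) (t : Fin m → ℝ) (i : Fin m) :
    (boxProj a b t i : ℝ) = max (a i) (min (b i) (t i)) := by
  obtain ⟨h1, h2, h3⟩ := h i
  rw [boxProj, Set.projIcc_of_mem]
  exact ⟨le_max_of_le_left h1, max_le (h2.trans h3) ((min_le_left _ _).trans h3)⟩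

theorem boxProj_mem {m : ℕ} {a b : Fin m → ℝ} (h : IsBox a b) (t : Fin m → ℝ) :
    boxProj a b t ∈ box a b := fun i => by
  rw [coe_boxProj h]
  exact ⟨le_max_left _ _, max_le (h i).2.1 (min_le_left _ _)⟩

theorem boxProj_of_mem {m : ℕ} {a b : Fin m → ℝ} (h : IsBox a b) {t : Cube m} (ht : t ∈ box a b) :
    boxProj a b (fun i => t i) = t := by
  ext i
  rw [coe_boxProj h, min_eq_right (ht i).2, max_eq_right (ht i).1]

theorem isPreconnected_box {m : ℕ} {a b : Fin m → ℝ} (h : IsBox a b) :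
    IsPreconnected (box a b) := by
  have : box a b = boxProj a b '' univ := by
    ext t
    constructor
    · exact fun ht => ⟨_, mem_univ _, boxProj_of_mem h ht⟩
    · rintro ⟨s, -, rfl⟩
      exact boxProj_mem h s
  rw [this]
  exact isPreconnected_univ.image _ (continuous_boxProj a b).continuousOn

theorem box_neg_one_one {m : ℕ} : box (fun _ : Fin m => (-1 : ℝ)) (fun _ => 1) = univ :=
  eq_univ_of_forall fun t i => (t i).2

theorem isBox_neg_one_one {m : ℕ} : IsBox (fun _ : Fin m => (-1 : ℝ)) (fun _ => 1) :=
  fun _ => by norm_num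

section Halving

variable {m : ℕ} {a b : Fin m → ℝ} {i : Fin m} {c : ℝ}

theorem IsBox.update_right (h : IsBox a b) (h1 : a i ≤ c) (h2 : c ≤ b i) :
    IsBox a (Function.update b i c) := fun j => by
  have := h j
  rcases eq_or_ne j i with rfl | hj
  · simp; exact ⟨this.1, h1, h2.trans this.2.2⟩
  · simpa [hj] using this

theorem IsBox.update_left (h : IsBox a b) (h1 : a i ≤ c) (h2 : c ≤ b i) :
    IsBox (Function.update a i c) b := fun j => by
  have := h j
  rcases eq_or_ne j i with rfl | hj
  · simp; exact ⟨this.1.trans h1, h2, this.2.2⟩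
  · simpa [hj] using this

theorem mem_box_update_right (h2 : c ≤ b i) {t : Cube m} :
    t ∈ box a (Function.update b i c) ↔ t ∈ box a b ∧ (t i : ℝ) ≤ c := by
  constructor
  · intro h
    refine ⟨fun j => ?_, by simpa using (h i).2⟩
    have := h j
    rcases eq_or_ne j i with rfl | hj
    · exact ⟨this.1, by simp at this; exact this.2.trans h2⟩
    · simpa [hj] using this
  · rintro ⟨h, h'⟩ j
    have := h j
    rcases eq_or_ne j i with rfl | hj
    · simp; exact ⟨this.1, h'⟩
    · simpa [hj] using this

theorem mem_box_update_left (h1 : a i ≤ c) {t : Cube m} :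
    t ∈ box (Function.update a i c) b ↔ t ∈ box a b ∧ c ≤ (t i : ℝ) := by
  constructor
  · intro h
    refine ⟨fun j => ?_, by simpa using (h i).1⟩
    have := h j
    rcases eq_or_ne j i with rfl | hj
    · exact ⟨by simp at this; exact h1.trans this.1, this.2⟩
    · simpa [hj] using this
  · rintro ⟨h, h'⟩ j
    have := h j
    rcases eq_or_ne j i with rfl | hj
    · simp; exact ⟨h', this.2⟩
    · simpa [hj] using this

end Halving

/-- Repeated halving in one direction at a time cuts the cube into small boxes; `glue` reassembles
them across the cutting hyperplanes. -/
theorem box_induction_of_small {m : ℕ} {p : (Fin m → ℝ) → (Fin m → ℝ) → Prop} {δ : ℝ} (hδ : 0 < δ)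
    (small : ∀ a b, IsBox a b → (∀ i, b i - a i ≤ δ) → p a b)
    (glue : ∀ a b i c, IsBox a b → a i ≤ c → c ≤ b i → p a (Function.update b i c) →
      p (Function.update a i c) b → p a b) : p (fun _ => -1) (fun _ => 1) := by
  -- `J` is the set of directions in which the box may still be long; `N` below counts the halvings
  -- that are needed in the direction `i₀`.
  have key : ∀ J : Finset (Fin m), ∀ a b, IsBox a b → (∀ i ∉ J, b i - a i ≤ δ) → p a b := by
    intro J
    induction J using Finset.induction_on with
    | empty => exact fun a b h h' => small a b h fun i => h' i (by simp)
    | insert i₀ J hi₀ ih =>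
      have step : ∀ N : ℕ, ∀ a b, IsBox a b → (∀ i ∉ insert i₀ J, b i - a i ≤ δ) →
          b i₀ - a i₀ ≤ 2 ^ N * δ → p a b := by
        intro N
        induction N with
        | zero =>
          intro a b h h' h''
          refine ih a b h fun i hi => ?_
          rcases eq_or_ne i i₀ with rfl | hne
          · simpa using h''
          · exact h' i (by simp [hne, hi])
        | succ N ihN =>
          intro a b h h' h''
          have hab := (h i₀).2.1
          have e1 : a i₀ ≤ (a i₀ + b i₀) / 2 := by linarith
          have e2 : (a i₀ + b i₀) / 2 ≤ b i₀ := by linarith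
          rw [pow_succ] at h''
          refine glue a b i₀ ((a i₀ + b i₀) / 2) h e1 e2 ?_ ?_
          · refine ihN _ _ (h.update_right e1 e2) (fun i hi => ?_) ?_
            · have : i ≠ i₀ := fun h => hi (by simp [h])
              simpa [this] using h' i hi
            · simp; linarith
          · refine ihN _ _ (h.update_left e1 e2) (fun i hi => ?_) ?_
            · have : i ≠ i₀ := fun h => hi (by simp [h])
              simpa [this] using h' i hi
            · simp; linarith
      intro a b h h'
      obtain ⟨N, hN⟩ := pow_unbounded_of_one_lt (2 / δ) (one_lt_two (α := ℝ))
      refine step N a b h h' ?_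
      have := h i₀
      have h3 : 2 < 2 ^ N * δ := (div_lt_iff₀ hδ).1 hN
      linarith
  exact key Finset.univ _ _ isBox_neg_one_one (by simp)

theorem box_induction {m : ℕ} {p : (Fin m → ℝ) → (Fin m → ℝ) → Prop}
    (loc : ∀ t : Cube m, ∃ N ∈ 𝓝 t, ∀ a b, IsBox a b → box a b ⊆ N → p a b)
    (glue : ∀ a b i c, IsBox a b → a i ≤ c → c ≤ b i → p a (Function.update b i c) →
      p (Function.update a i c) b → p a b) : p (fun _ => -1) (fun _ => 1) := by
  choose N hN hp using loc
  obtain ⟨δ, hδ, h⟩ := lebesgue_number_lemma_of_metric (s := (univ : Set (Cube m))) isCompact_univ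
    (c := fun t => interior (N t)) (fun t => isOpen_interior)
    (fun t _ => mem_iUnion.2 ⟨t, mem_interior_iff_mem_nhds.2 (hN t)⟩)
  -- With sides of length at most `δ / 2`, a box lies strictly within distance `δ` of any of its
  -- points, hence in one member of the cover.
  refine box_induction_of_small (half_pos hδ) (fun a b hab hs => ?_) glue
  obtain ⟨t, ht⟩ := h (boxProj a b a) (mem_univ _)
  refine hp t a b hab fun s hs' => interior_subset (ht ?_)
  rw [Metric.mem_ball, dist_pi_lt_iff hδ]
  intro i
  have h1 := boxProj_mem hab a i
  have h2 := hs' i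
  have h3 := hs i
  rw [Subtype.dist_eq, Real.dist_eq, abs_lt]
  constructor <;> linarith [h1.1, h1.2, h2.1, h2.2]

/-! ### Sections of cosets of `P` over a cube -/

/-- The sets `C t` are cosets of the fibres of `P` and form a covering of the cube, so this is
unique lifting over a simply connected space, carried out by subdivision. It gives both the parallel
transport of `P` along cubes and the lifts of differences of sections. -/
theorem Lattice.exists_continuous_section_of_coset (P : Lattice n B k) {m : ℕ} (σ : C(Cube m, B))
    (C : ∀ t, Set (Cot (n := n) (σ t)))
    (hC : ∀ t₀, ∃ N ∈ 𝓝 t₀, ∃ a : ∀ t, Cot (n := n) (σ t),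
      ContinuousOn (fun t => cotMk (σ t) (a t)) N ∧
      ∀ t ∈ N, ∀ α, α ∈ C t ↔ α - a t ∈ P.fiber (σ t))
    (t₀ : Cube m) {p : Cot (n := n) (σ t₀)} (hp : p ∈ C t₀) :
    ∃ a : ∀ t, Cot (n := n) (σ t), Continuous (fun t => cotMk (σ t) (a t)) ∧
      (∀ t, a t ∈ C t) ∧ a t₀ = p := by
  have hdiff : ∀ t, ∀ α ∈ C t, ∀ β ∈ C t, α - β ∈ P.fiber (σ t) := by
    intro t α hα β hβ
    obtain ⟨N, hN, a, -, h⟩ := hC t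
    have := sub_mem ((h t (mem_of_mem_nhds hN) α).1 hα) ((h t (mem_of_mem_nhds hN) β).1 hβ)
    simpa using this
  have key := box_induction (p := fun a b => ∀ t₀ ∈ box a b, ∀ p ∈ C t₀,
    ∃ s : ∀ t, Cot (n := n) (σ t), ContinuousOn (fun t => cotMk (σ t) (s t)) (box a b) ∧
      (∀ t ∈ box a b, s t ∈ C t) ∧ s t₀ = p) ?_ ?_
  · simp only [box_neg_one_one] at key
    obtain ⟨s, h1, h2, h3⟩ := key t₀ (mem_univ _) p hp
    exact ⟨s, continuousOn_univ.1 h1, fun t => h2 t (mem_univ _), h3⟩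
  · intro t
    obtain ⟨N, hN, a, ha, h⟩ := hC t
    obtain ⟨F, hF⟩ := P.exists_frame_at (σ t)
    refine ⟨N ∩ σ ⁻¹' F.dom, Filter.inter_mem hN
      (σ.continuous.continuousAt.preimage_mem_nhds (F.isOpen_dom.mem_nhds hF)), ?_⟩
    intro c d _ hcd t₁ ht₁ q hq
    obtain ⟨z, hz⟩ := (F.mem_iff _ (hcd ht₁).2 _).1 ((h t₁ (hcd ht₁).1 q).1 hq)
    refine ⟨fun t => a t + ∑ i, z i • F.vec i (σ t), fun t ht => ?_, fun t ht => ?_, ?_⟩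
    · simp only [← Int.cast_smul_eq_zsmul ℝ]
      refine continuousWithinAt_cot_add ((ha t (hcd ht).1).mono fun x hx => (hcd hx).1) ?_
      refine continuousWithinAt_cot_sum _ σ.continuous.continuousWithinAt fun i _ => ?_
      exact continuousWithinAt_cot_smul continuousWithinAt_const
        (F.continuousWithinAt_vec (hcd ht).2 σ.continuous.continuousWithinAt i)
    · rw [h t (hcd ht).1, add_sub_cancel_left]
      exact (F.mem_iff _ (hcd ht).2 _).2 ⟨z, rfl⟩
    · simp only [← hz]; abel
  · intro a b i c hab hac hcb h1 h2 t₁ ht₁ q hq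
    have hF : IsBox (Function.update a i c) (Function.update b i c) :=
      (hab.update_left hac hcb).update_right (by simp) hcb
    have hFmem : ∀ t, t ∈ box (Function.update a i c) (Function.update b i c) ↔
        t ∈ box a (Function.update b i c) ∧ t ∈ box (Function.update a i c) b := fun t => by
      rw [mem_box_update_right hcb, mem_box_update_left hac, mem_box_update_right hcb]
      tauto
    -- Any point of the common face will do: the face is connected, so sections over the two halves
    -- that agree at `f₀` agree on the whole face.
    set f₀ := boxProj (Function.update a i c) (Function.update b i c) 0
    have hf₀ : f₀ ∈ box (Function.update a i c) (Function.update b i c) := boxProj_mem hF 0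
    have hf₁ := (hFmem f₀).1 hf₀
    -- two compatible sections give a section
    have glue : ∀ s₁ s₂ : ∀ t, Cot (n := n) (σ t),
        ContinuousOn (fun t => cotMk (σ t) (s₁ t)) (box a (Function.update b i c)) →
        (∀ t ∈ box a (Function.update b i c), s₁ t ∈ C t) →
        ContinuousOn (fun t => cotMk (σ t) (s₂ t)) (box (Function.update a i c) b) →
        (∀ t ∈ box (Function.update a i c) b, s₂ t ∈ C t) → s₁ f₀ = s₂ f₀ →
        ∃ s : ∀ t, Cot (n := n) (σ t), ContinuousOn (fun t => cotMk (σ t) (s t)) (box a b) ∧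
          (∀ t ∈ box a b, s t ∈ C t) ∧ (∀ t ∈ box a (Function.update b i c), s t = s₁ t) ∧
          (∀ t ∈ box (Function.update a i c) b, s t = s₂ t) := by
      intro s₁ s₂ c₁ m₁ c₂ m₂ h₀
      classical
      have e1 : ∀ t ∈ box a (Function.update b i c),
          (if t ∈ box a (Function.update b i c) then s₁ t else s₂ t) = s₁ t := fun t ht => by
        simp [ht]
      have e2 : ∀ t ∈ box (Function.update a i c) b,
          (if t ∈ box a (Function.update b i c) then s₁ t else s₂ t) = s₂ t := fun t ht => by
        split_ifs with h
        · refine P.eq_of_eq_at (isPreconnected_box hF)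
            (c₁.mono fun t ht => ((hFmem t).1 ht).1) (c₂.mono fun t ht => ((hFmem t).1 ht).2)
            (fun t ht => hdiff t _ (m₁ t ((hFmem t).1 ht).1) _ (m₂ t ((hFmem t).1 ht).2)) hf₀
            ((hFmem t).2 ⟨h, ht⟩) h₀
        · rfl
      have hU : box a b = box a (Function.update b i c) ∪ box (Function.update a i c) b := by
        ext t
        rw [mem_union, mem_box_update_right hcb, mem_box_update_left hac, ← and_or_left]
        simp [le_total]
      refine ⟨fun t => if t ∈ box a (Function.update b i c) then s₁ t else s₂ t, ?_, ?_, e1, e2⟩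
      · rw [hU]
        refine ContinuousOn.union_of_isClosed (c₁.congr fun t ht => ?_) (c₂.congr fun t ht => ?_)
          (isClosed_box _ _) (isClosed_box _ _)
        · simp only [e1 t ht]
        · simp only [e2 t ht]
      · intro t ht
        rw [hU] at ht
        rcases ht with ht | ht
        · simpa only [e1 t ht] using m₁ t ht
        · simpa only [e2 t ht] using m₂ t ht
    rcases le_total (t₁ i : ℝ) c with hle | hle
    · have ht : t₁ ∈ box a (Function.update b i c) := (mem_box_update_right hcb).2 ⟨ht₁, hle⟩
      obtain ⟨s₁, c₁, m₁, v₁⟩ := h1 t₁ ht q hq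
      obtain ⟨s₂, c₂, m₂, v₂⟩ := h2 f₀ hf₁.2 _ (m₁ _ hf₁.1)
      obtain ⟨s, hs, hs', hs₁, -⟩ := glue s₁ s₂ c₁ m₁ c₂ m₂ v₂.symm
      exact ⟨s, hs, hs', (hs₁ _ ht).trans v₁⟩
    · have ht : t₁ ∈ box (Function.update a i c) b := (mem_box_update_left hac).2 ⟨ht₁, hle⟩
      obtain ⟨s₂, c₂, m₂, v₂⟩ := h2 t₁ ht q hq
      obtain ⟨s₁, c₁, m₁, v₁⟩ := h1 f₀ hf₁.1 _ (m₂ _ hf₁.2)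
      obtain ⟨s, hs, hs', -, hs₂⟩ := glue s₁ s₂ c₁ m₁ c₂ m₂ v₁
      exact ⟨s, hs, hs', (hs₂ _ ht).trans v₂⟩

end

section

/-! ### Torsors under the circle -/

/-- A vector space is simply connected, so maps lift through the covering `ℝ → ℝ/ℤ`. -/
theorem exists_circle_lift {W : Type*} [NormedAddCommGroup W] [NormedSpace ℝ W]
    {f : W → UnitAddCircle} (hf : Continuous f) :
    ∃ L : W → ℝ, Continuous L ∧ ∀ w, (L w : UnitAddCircle) = f w := by
  obtain ⟨e₀, he₀⟩ := QuotientAddGroup.mk_surjective (f 0)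
  obtain ⟨F, ⟨-, hF⟩, -⟩ := (AddCircle.isCoveringMap_coe (1 : ℝ)).existsUnique_continuousMap_lifts
    ⟨f, hf⟩ 0 e₀ he₀
  exact ⟨F, F.continuous, fun w => congrFun hF w⟩

theorem exists_circle_lift_box {m : ℕ} {a b : Fin m → ℝ} (h : IsBox a b)
    {f : Cube m → UnitAddCircle} (hf : ContinuousOn f (box a b)) :
    ∃ L : Cube m → ℝ, Continuous L ∧ ∀ t ∈ box a b, (L t : UnitAddCircle) = f t := by
  have h1 : Continuous fun x => f (boxProj a b x) :=
    hf.comp_continuous (continuous_boxProj a b) (boxProj_mem h)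
  obtain ⟨L, hL, hLf⟩ := exists_circle_lift h1
  refine ⟨fun t => L fun i => t i, hL.comp (by fun_prop), fun t ht => ?_⟩
  simp only [hLf, boxProj_of_mem h ht]

theorem exists_circle_lift_cube {m : ℕ} {f : Cube m → UnitAddCircle} (hf : Continuous f) :
    ∃ L : Cube m → ℝ, Continuous L ∧ ∀ t, (L t : UnitAddCircle) = f t := by
  obtain ⟨L, hL, h⟩ := exists_circle_lift_box isBox_neg_one_one (f := f) hf.continuousOn
  exact ⟨L, hL, fun t => h t (by rw [box_neg_one_one]; trivial)⟩

section Torsor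

variable {Y Z ι : Type*} [TopologicalSpace Y] [TopologicalSpace Z]

/-- A circle torsor over `S`, given by functions `g i` that are regarded as sections over the open
sets `U i`, so that the differences `g i - g j` are continuous. -/
structure IsTwist (U : ι → Set Y) (g : ι → Y → UnitAddCircle) (S : Set Y) : Prop where
  isOpen : ∀ i, IsOpen (U i)
  cover : S ⊆ ⋃ i, U i
  cont : ∀ i j, ContinuousOn (fun y => g i y - g j y) (S ∩ (U i ∩ U j))

/-- `s` is a section over `S` of the circle torsor given by `U` and `g`. -/
def IsSecOn (U : ι → Set Y) (g : ι → Y → UnitAddCircle) (S : Set Y) (s : Y → UnitAddCircle) :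
    Prop :=
  ∀ i, ContinuousOn (fun y => s y - g i y) (S ∩ U i)

variable {U : ι → Set Y} {g : ι → Y → UnitAddCircle} {S S' : Set Y} {s s' : Y → UnitAddCircle}

theorem IsTwist.mono (h : IsTwist U g S) (hS : S' ⊆ S) : IsTwist U g S' :=
  ⟨h.isOpen, hS.trans h.cover, fun i j => (h.cont i j).mono (inter_subset_inter_left _ hS)⟩

theorem IsSecOn.mono (h : IsSecOn U g S s) (hS : S' ⊆ S) : IsSecOn U g S' s :=
  fun i => (h i).mono (inter_subset_inter_left _ hS)

theorem IsTwist.comp (h : IsTwist U g S) {f : Z → Y} (hf : Continuous f) :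
    IsTwist (fun i => f ⁻¹' U i) (fun i z => g i (f z)) (f ⁻¹' S) where
  isOpen i := (h.isOpen i).preimage hf
  cover z hz := by simpa using h.cover hz
  cont i j := (h.cont i j).comp hf.continuousOn fun _ hz => hz

theorem IsSecOn.comp (h : IsSecOn U g S s) {f : Z → Y} (hf : Continuous f) {R : Set Z}
    (hR : MapsTo f R S) :
    IsSecOn (fun i => f ⁻¹' U i) (fun i z => g i (f z)) R (fun z => s (f z)) :=
  fun i => (h i).comp hf.continuousOn fun _ hz => ⟨hR hz.1, hz.2⟩

theorem IsSecOn.congr (h : IsSecOn U g S s) (hs : ∀ y ∈ S, s' y = s y) : IsSecOn U g S s' :=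
  fun i => (h i).congr fun y hy => by simp only [hs y hy.1]

theorem IsTwist.isSecOn (h : IsTwist U g S) (i : ι) : IsSecOn U g (S ∩ U i) (g i) :=
  fun j => (h.cont i j).mono fun _ hy => ⟨hy.1.1, hy.1.2, hy.2⟩

/-- The functions `g i` cancel, so two sections of one torsor differ by an ordinary continuous
function to the circle. -/
theorem IsSecOn.continuousOn_sub (hU : ∀ i, IsOpen (U i)) (hc : S ⊆ ⋃ i, U i)
    (h : IsSecOn U g S s) (h' : IsSecOn U g S s') : ContinuousOn (fun y => s y - s' y) S := by
  intro y hy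
  obtain ⟨i, hi⟩ := mem_iUnion.1 (hc hy)
  have : ContinuousWithinAt (fun y => s y - s' y) (S ∩ U i) y :=
    (((h i) y ⟨hy, hi⟩).sub ((h' i) y ⟨hy, hi⟩)).congr
      (fun z _ => (sub_sub_sub_cancel_right _ _ _).symm) (sub_sub_sub_cancel_right _ _ _).symm
  exact (continuousWithinAt_inter ((hU i).mem_nhds hi)).1 this

theorem IsSecOn.add_continuousOn (h : IsSecOn U g S s) {d : Y → UnitAddCircle}
    (hd : ContinuousOn d S) : IsSecOn U g S (fun y => s y + d y) := fun i => by
  refine ((h i).add (hd.mono inter_subset_left)).congr fun y _ => ?_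
  change s y + d y - g i y = s y - g i y + d y
  abel

theorem IsSecOn.union (h : IsSecOn U g S s) (h' : IsSecOn U g S' s) (hS : IsClosed S)
    (hS' : IsClosed S') : IsSecOn U g (S ∪ S') s := by
  rintro i y ⟨-, hi⟩
  rw [union_inter_distrib_right]
  have key : ∀ R : Set Y, IsClosed R → IsSecOn U g R s →
      ContinuousWithinAt (fun y => s y - g i y) (R ∩ U i) y := by
    intro R hR hs
    by_cases hy : y ∈ R
    · exact hs i y ⟨hy, hi⟩
    · refine continuousWithinAt_of_notMem_closure fun hy' => hy ?_
      exact hR.closure_subset (closure_mono inter_subset_left hy')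
  exact (key S hS h).union (key S' hS' h')

end Torsor

theorem continuous_circle_coe {Y : Type*} [TopologicalSpace Y] {L : Y → ℝ} (hL : Continuous L) :
    Continuous fun y => (L y : UnitAddCircle) := (AddCircle.continuous_mk' (1 : ℝ)).comp hL

/-- Circle torsors over cubes are trivial. -/
theorem IsTwist.exists_section_cube {ι : Type*} {m : ℕ} {U : ι → Set (Cube m)}
    {g : ι → Cube m → UnitAddCircle} (h : IsTwist U g univ) : ∃ s, IsSecOn U g univ s := by
  have key := box_induction (p := fun a b => ∃ s, IsSecOn U g (box a b) s) ?_ ?_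
  · simpa only [box_neg_one_one] using key
  · intro t
    obtain ⟨i, hi⟩ := mem_iUnion.1 (h.cover (mem_univ t))
    exact ⟨U i, (h.isOpen i).mem_nhds hi, fun a b _ hab =>
      ⟨g i, (h.isSecOn i).mono fun x hx => ⟨mem_univ x, hab hx⟩⟩⟩
  · rintro a b i c hab hac hcb ⟨s₁, h₁⟩ ⟨s₂, h₂⟩
    have hF : IsBox (Function.update a i c) (Function.update b i c) :=
      (hab.update_left hac hcb).update_right (by simp) hcb
    have hFmem : ∀ t, t ∈ box (Function.update a i c) (Function.update b i c) ↔
        t ∈ box a (Function.update b i c) ∧ t ∈ box (Function.update a i c) b := fun t => by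
      rw [mem_box_update_right hcb, mem_box_update_left hac, mem_box_update_right hcb]
      tauto
    have hd : ContinuousOn (fun t => s₁ t - s₂ t)
        (box (Function.update a i c) (Function.update b i c)) :=
      (h₁.mono fun t ht => ((hFmem t).1 ht).1).continuousOn_sub h.isOpen
        (fun t _ => h.cover (mem_univ t)) (h₂.mono fun t ht => ((hFmem t).1 ht).2)
    -- The lift `L` is continuous on the whole cube and not only on the common face. Hence `s₂` can
    -- be corrected by it over all of its box.
    obtain ⟨L, hL, hLd⟩ := exists_circle_lift_box hF hd
    have h₃ := h₂.add_continuousOn (continuous_circle_coe hL).continuousOn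
    classical
    have hU : box a b = box a (Function.update b i c) ∪ box (Function.update a i c) b := by
      ext t
      rw [mem_union, mem_box_update_right hcb, mem_box_update_left hac, ← and_or_left]
      simp [le_total]
    refine ⟨fun t => if t ∈ box a (Function.update b i c) then s₁ t else s₂ t + (L t), ?_⟩
    rw [hU]
    refine (h₁.congr fun t ht => by simp [ht]).union (h₃.congr fun t ht => ?_) (isClosed_box _ _)
      (isClosed_box _ _)
    split_ifs with ht'
    · rw [hLd t ((hFmem t).2 ⟨ht', ht⟩)]; abel
    · rfl

/-! ### The boundary of a cube -/

/-- The boundary of the cube. -/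
def bdry (m : ℕ) : Set (Cube m) := {t | ∃ i ε, t i = endpoint ε}

/-- The union of all faces of the cube but the last one. -/
def openBox (m : ℕ) : Set (Cube (m + 1)) :=
  {t | (∃ (i : Fin m) (ε : Bool), t i.castSucc = endpoint ε) ∨ t (Fin.last m) = endpoint false}

/-- The last face of the cube. -/
def lastFace (m : ℕ) : Set (Cube (m + 1)) := {t | t (Fin.last m) = endpoint true}

theorem isClosed_lastFace (m : ℕ) : IsClosed (lastFace m) :=
  isClosed_singleton.preimage (continuous_apply (Fin.last m))

theorem isClosed_bdry (m : ℕ) : IsClosed (bdry m) := by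
  have : bdry m = ⋃ i, ⋃ ε, {t | t i = endpoint ε} := by ext; simp [bdry]
  rw [this]
  exact isClosed_iUnion_of_finite fun i => isClosed_iUnion_of_finite fun ε =>
    isClosed_singleton.preimage (continuous_apply i)

theorem isClosed_openBox (m : ℕ) : IsClosed (openBox m) := by
  have : openBox m = (⋃ i : Fin m, ⋃ ε, {t : Cube (m + 1) | t i.castSucc = endpoint ε}) ∪
      {t | t (Fin.last m) = endpoint false} := by ext; simp [openBox]
  rw [this]
  refine IsClosed.union ?_ (isClosed_singleton.preimage (continuous_apply _))
  exact isClosed_iUnion_of_finite fun i => isClosed_iUnion_of_finite fun ε =>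
    isClosed_singleton.preimage (continuous_apply _)

@[simp] theorem coe_endpoint_true : (endpoint true : ℝ) = 1 := rfl

@[simp] theorem coe_endpoint_false : (endpoint false : ℝ) = -1 := rfl

theorem openBox_subset_bdry (m : ℕ) : openBox m ⊆ bdry (m + 1) := by
  rintro t (⟨i, ε, h⟩ | h)
  exacts [⟨_, ε, h⟩, ⟨_, _, h⟩]

theorem face_last_mem_openBox {m : ℕ} {x : Cube m} (hx : x ∈ bdry m) (ε : Bool) :
    face (Fin.last m) ε x ∈ openBox m := by
  obtain ⟨i, ε', h⟩ := hx
  exact Or.inl ⟨i, ε', by simpa [face, Fin.insertNth_last'] using h⟩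

theorem face_mem_bdry {m : ℕ} (i : Fin (m + 1)) (ε : Bool) (x : Cube m) :
    face i ε x ∈ bdry (m + 1) := ⟨i, ε, by simp [face]⟩

/-- The projection of the cube onto the last face. -/
def dropLast {m : ℕ} (t : Cube (m + 1)) : Cube m := fun i => t i.castSucc

theorem continuous_dropLast {m : ℕ} : Continuous (dropLast (m := m)) := by
  unfold dropLast; fun_prop

theorem face_dropLast {m : ℕ} {ε : Bool} {t : Cube (m + 1)} (ht : t (Fin.last m) = endpoint ε) :
    face (Fin.last m) ε (dropLast t) = t := by
  ext i
  refine Fin.lastCases ?_ (fun j => ?_) i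
  · simp [face, ht]
  · simp [face, dropLast, Fin.insertNth_last']

theorem mem_bdry_succ {m : ℕ} {t : Cube (m + 1)} :
    t ∈ bdry (m + 1) ↔ t ∈ openBox m ∨ t (Fin.last m) = endpoint true := by
  constructor
  · rintro ⟨i, ε, h⟩
    induction i using Fin.lastCases with
    | last =>
      cases ε
      · exact Or.inl (Or.inr h)
      · exact Or.inr h
    | cast j => exact Or.inl (Or.inl ⟨j, ε, h⟩)
  · rintro (h | h)
    exacts [openBox_subset_bdry m h, ⟨_, _, h⟩]

theorem eq_endpoint_iff {x : Icc (-1 : ℝ) 1} : (∃ ε, x = endpoint ε) ↔ |(x : ℝ)| = 1 := by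
  constructor
  · rintro ⟨ε, rfl⟩
    cases ε <;> simp
  · intro h
    rcases (abs_eq zero_le_one).1 h with h | h
    · exact ⟨true, Subtype.ext h⟩
    · exact ⟨false, Subtype.ext h⟩

theorem Cube.norm_le {m : ℕ} (t : Cube m) : ‖(fun i => (t i : ℝ))‖ ≤ 1 := by
  rw [pi_norm_le_iff_of_nonneg zero_le_one]
  exact fun i => abs_le.2 (t i).2

theorem mem_bdry_iff_norm {m : ℕ} {t : Cube m} : t ∈ bdry m ↔ ‖(fun i => (t i : ℝ))‖ = 1 := by
  constructor
  · rintro ⟨i, ε, h⟩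
    refine le_antisymm (Cube.norm_le t) ((eq_endpoint_iff.1 ⟨ε, h⟩).ge.trans ?_)
    exact norm_le_pi_norm (fun i => (t i : ℝ)) i
  · intro h
    by_contra hc
    have : ‖(fun i => (t i : ℝ))‖ < 1 := by
      rw [pi_norm_lt_iff one_pos]
      intro i
      refine lt_of_le_of_ne (abs_le.2 (t i).2) fun h' => hc ?_
      obtain ⟨ε, hε⟩ := eq_endpoint_iff.2 h'
      exact ⟨i, ε, hε⟩
    exact this.ne h

/-- The scaling factor of the projection onto `openBox m` from the point `(0, …, 0, 3)`. -/
def boxScale {m : ℕ} (t : Cube (m + 1)) : ℝ :=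
  max ‖(fun i => (dropLast t i : ℝ))‖ ((3 - t (Fin.last m)) / 4)

/-- The projection onto `openBox m` from the point `(0, …, 0, 3)`. -/
def boxRetract {m : ℕ} (t : Cube (m + 1)) : Cube (m + 1) :=
  Fin.snoc (α := fun _ => Icc (-1 : ℝ) 1)
    (fun i => Set.projIcc (-1) 1 (by norm_num) (dropLast t i / boxScale t))
    (Set.projIcc (-1) 1 (by norm_num) (3 - (3 - t (Fin.last m)) / boxScale t))

theorem boxScale_pos {m : ℕ} (t : Cube (m + 1)) : 0 < boxScale t := by
  have := (t (Fin.last m)).2.2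
  exact lt_max_of_lt_right (by linarith)

theorem continuous_boxRetract {m : ℕ} : Continuous (boxRetract (m := m)) := by
  have h1 : Continuous (boxScale (m := m)) := by
    unfold boxScale
    refine Continuous.max ?_ (by fun_prop)
    refine Continuous.norm (continuous_pi fun i => ?_)
    exact continuous_subtype_val.comp ((continuous_apply i).comp continuous_dropLast)
  have h2 : ∀ t : Cube (m + 1), boxScale t ≠ 0 := fun t => (boxScale_pos t).ne'
  refine continuous_pi fun i => ?_
  induction i using Fin.lastCases with
  | last =>
    simp only [boxRetract, Fin.snoc_last]
    exact continuous_projIcc.comp (continuous_const.sub (Continuous.div (by fun_prop) h1 h2))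
  | cast j =>
    simp only [boxRetract, Fin.snoc_castSucc]
    refine continuous_projIcc.comp (Continuous.div ?_ h1 h2)
    exact continuous_subtype_val.comp ((continuous_apply j).comp continuous_dropLast)

/-- Seen from the point at height `3`, the bottom face lies `4` below, so the bottom is reached for
the scale `(3 - t) / 4` and a side for the scale given by the norm of the other coordinates.
Division by the larger scale stops at whichever is met first. -/
theorem boxRetract_mem {m : ℕ} (t : Cube (m + 1)) : boxRetract t ∈ openBox m := by
  have hN := boxScale_pos t
  rcases max_choice ‖(fun i => (dropLast t i : ℝ))‖ ((3 - t (Fin.last m)) / 4) with h | h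
  · change boxScale t = _ at h
    left
    by_contra! hc
    have : ‖(fun i => (dropLast t i : ℝ))‖ < boxScale t := by
      rw [pi_norm_lt_iff hN]
      intro i
      have h1 : ‖(dropLast t i : ℝ)‖ ≤ boxScale t :=
        h ▸ norm_le_pi_norm (fun i => (dropLast t i : ℝ)) i
      refine lt_of_le_of_ne h1 fun h' => ?_
      have h2 : |(dropLast t i : ℝ) / boxScale t| = 1 := by
        rw [abs_div, abs_of_pos hN, ← Real.norm_eq_abs, h', div_self hN.ne']
      obtain ⟨ε, hε⟩ := (eq_endpoint_iff
        (x := ⟨(dropLast t i : ℝ) / boxScale t, abs_le.1 h2.le⟩)).2 h2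
      refine hc i ε ?_
      rw [boxRetract, Fin.snoc_castSucc, Set.projIcc_of_mem _ (abs_le.1 h2.le), hε]
    exact this.ne h.symm
  · change boxScale t = _ at h
    right
    have h1 : (3 : ℝ) - (3 - t (Fin.last m)) / boxScale t = -1 := by
      have h0 : (3 - (t (Fin.last m) : ℝ)) ≠ 0 := by
        have := (t (Fin.last m)).2.2
        linarith
      rw [h]; field_simp; norm_num
    rw [boxRetract, Fin.snoc_last, h1, Set.projIcc_left]
    rfl

theorem boxRetract_of_mem {m : ℕ} {t : Cube (m + 1)} (ht : t ∈ openBox m) : boxRetract t = t := by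
  have h1 := Cube.norm_le (dropLast t)
  have h2 := (t (Fin.last m)).2
  have hN : boxScale t = 1 := by
    refine le_antisymm (max_le h1 (by linarith [h2.1])) ?_
    rcases ht with ⟨i, ε, h⟩ | h
    · refine le_max_of_le_left ?_
      exact ((mem_bdry_iff_norm (t := dropLast t)).1 ⟨i, ε, h⟩).ge
    · refine le_max_of_le_right ?_
      rw [h]; norm_num
  ext i
  induction i using Fin.lastCases with
  | last =>
    simp only [boxRetract, Fin.snoc_last, hN, div_one, sub_sub_cancel, Set.projIcc_val]
  | cast j =>
    simp only [boxRetract, Fin.snoc_castSucc, hN, div_one, Set.projIcc_val]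
    rfl

/-- The boundary is the unit sphere of the sup norm, and spheres are connected in dimension at least
two. -/
theorem isPreconnected_bdry {m : ℕ} (hm : 2 ≤ m) : IsPreconnected (bdry m) := by
  have h : bdry m = (fun (x : Fin m → ℝ) i => Set.projIcc (-1 : ℝ) 1 (by norm_num) (x i)) ''
      Metric.sphere 0 1 := by
    ext t
    constructor
    · intro ht
      refine ⟨fun i => t i, by simpa using mem_bdry_iff_norm.1 ht, ?_⟩
      ext i; simp
    · rintro ⟨x, hx, rfl⟩
      have hx : ‖x‖ = 1 := by simpa using hx
      rw [mem_bdry_iff_norm]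
      refine Eq.trans (congrArg norm ?_) hx
      ext i
      dsimp only; rw [Set.projIcc_of_mem]
      have := norm_le_pi_norm x i
      rw [hx] at this
      exact abs_le.1 this
  rw [h]
  refine (isPreconnected_sphere ?_ _ _).image _ (Continuous.continuousOn ?_)
  · rw [rank_fun']
    simp only [Fintype.card_fin]
    exact_mod_cast hm
  · exact continuous_pi fun i => continuous_projIcc.comp (continuous_apply i)

/-! ### Torsors over the boundary of a cube -/

/-- This is Tietze's extension theorem. -/
theorem exists_continuous_extension {m : ℕ} {S : Set (Cube m)} (hS : IsClosed S) {f : Cube m → ℝ}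
    (hf : ContinuousOn f S) : ∃ e : Cube m → ℝ, Continuous e ∧ ∀ x ∈ S, e x = f x := by
  obtain ⟨e, he⟩ := ContinuousMap.exists_restrict_eq hS ⟨S.domRestrict f, hf.domRestrict⟩
  exact ⟨e, e.continuous, fun x hx => congrArg (fun φ => φ ⟨x, hx⟩) he⟩

/-- A circle torsor over the boundary of a cube is trivial if a certain function on the boundary
of the last face lifts to the reals. -/
theorem IsTwist.exists_section_bdry {ι : Type*} {m : ℕ} {U : ι → Set (Cube (m + 1))}
    {g : ι → Cube (m + 1) → UnitAddCircle} (h : IsTwist U g (bdry (m + 1)))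
    (hd : ∀ t s', IsSecOn U g (openBox m) t →
      IsSecOn (fun i => face (Fin.last m) true ⁻¹' U i)
        (fun i x => g i (face (Fin.last m) true x)) univ s' →
      ∃ e : Cube m → ℝ, Continuous e ∧
        ∀ x ∈ bdry m, (e x : UnitAddCircle) = t (face (Fin.last m) true x) - s' x) :
    ∃ s, IsSecOn U g (bdry (m + 1)) s := by
  -- `openBox m` is a retract of the cube, and the torsor pulled back along the retraction is a
  -- torsor over a cube, hence trivial.
  obtain ⟨t, ht⟩ : ∃ t, IsSecOn U g (openBox m) t := by
    have h1 := (h.comp continuous_boxRetract).mono (S' := univ)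
      fun t _ => openBox_subset_bdry m (boxRetract_mem t)
    obtain ⟨s, hs⟩ := h1.exists_section_cube
    refine ⟨s, fun i => ((hs i).mono ?_).congr ?_⟩
    · rintro x ⟨hx, hi⟩
      exact ⟨trivial, by simpa [boxRetract_of_mem hx] using hi⟩
    · rintro x ⟨hx, hi⟩
      simp only [boxRetract_of_mem hx]
  obtain ⟨s', hs'⟩ := ((h.comp (face (Fin.last m) true).continuous).mono (S' := univ)
      fun x _ => face_mem_bdry _ _ x).exists_section_cube
  obtain ⟨e, he, hed⟩ := hd t s' ht hs'
  have h2 := hs'.add_continuousOn (continuous_circle_coe he).continuousOn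
  classical
  refine ⟨fun y => if y ∈ openBox m then t y else s' (dropLast y) + e (dropLast y), ?_⟩
  have hU : bdry (m + 1) = openBox m ∪ lastFace m := by
    ext y; exact mem_bdry_succ
  rw [hU]
  refine (ht.congr fun y hy => if_pos hy).union ?_ (isClosed_openBox m) (isClosed_lastFace m)
  intro i
  refine ((h2 i).comp continuous_dropLast.continuousOn fun y hy => ?_).congr fun y hy => ?_
  · refine ⟨trivial, ?_⟩
    rw [mem_preimage, face_dropLast hy.1]
    exact hy.2
  · simp only [Function.comp, face_dropLast hy.1]
    congr 1
    split_ifs with hy'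
    · have hy2 : dropLast y ∈ bdry m := by
        rcases hy' with ⟨i, ε, h⟩ | h
        · exact ⟨i, ε, h⟩
        · exfalso
          have h1 : y (Fin.last m) = endpoint true := hy.1
          rw [h] at h1
          have := congrArg Subtype.val h1
          norm_num at this
      rw [hed _ hy2, face_dropLast hy.1]; abel
    · rfl

theorem circle_coe_eq_coe_iff {x y : ℝ} :
    (x : UnitAddCircle) = y ↔ ∃ z : ℤ, x - y = z := by
  rw [← sub_eq_zero, ← AddCircle.coe_sub, AddCircle.coe_eq_zero_iff]
  simp [eq_comm]

theorem eq_of_isPreconnected_of_int {Y : Type*} [TopologicalSpace Y] {S : Set Y}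
    (hS : IsPreconnected S) {f : Y → ℝ} (hf : ContinuousOn f S) (hz : ∀ y ∈ S, ∃ z : ℤ, f y = z)
    {x y : Y} (hx : x ∈ S) (hy : y ∈ S) : f x = f y := by
  refine hS.induction₂ (fun x y => f x = f y) (fun x hx => ?_)
    (fun x y z _ _ _ h1 h2 => h1.trans h2) (fun x y _ _ h => h.symm) hx hy
  filter_upwards [(hf x hx).tendsto (Metric.ball_mem_nhds _ one_pos), self_mem_nhdsWithin]
    with y hy hyS
  obtain ⟨a, ha⟩ := hz x hx
  obtain ⟨b, hb⟩ := hz y hyS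
  have hy : dist (f y) (f x) < 1 := hy
  rw [ha, hb, Int.dist_cast_real, Int.dist_eq] at hy
  have h4 : |b - a| < 1 := by exact_mod_cast hy
  have := Int.abs_lt_one_iff.1 h4
  rw [ha, hb, show a = b by linarith]

/-- A function from the boundary of a cube to the circle lifts to the reals if lifts over the two
parts of the boundary differ by a constant. -/
theorem exists_circle_lift_bdry {m : ℕ} {d : Cube (m + 1) → UnitAddCircle}
    (hd : ContinuousOn d (bdry (m + 1)))
    (H : ∀ (L₁ : Cube (m + 1) → ℝ) (L₂ : Cube m → ℝ), ContinuousOn L₁ (openBox m) →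
      (∀ y ∈ openBox m, (L₁ y : UnitAddCircle) = d y) → Continuous L₂ →
      (∀ x, (L₂ x : UnitAddCircle) = d (face (Fin.last m) true x)) →
      ∀ x ∈ bdry m, ∀ y ∈ bdry m,
        L₁ (face (Fin.last m) true x) - L₂ x = L₁ (face (Fin.last m) true y) - L₂ y) :
    ∃ e : Cube (m + 1) → ℝ, Continuous e ∧ ∀ x ∈ bdry (m + 1), (e x : UnitAddCircle) = d x := by
  obtain ⟨L₁, hL₁, hLd₁⟩ := exists_circle_lift_cube (f := fun y => d (boxRetract y))
    (hd.comp_continuous continuous_boxRetract fun t => openBox_subset_bdry m (boxRetract_mem t))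
  have hLd₁' : ∀ y ∈ openBox m, (L₁ y : UnitAddCircle) = d y := fun y hy => by
    rw [hLd₁, boxRetract_of_mem hy]
  obtain ⟨L₂, hL₂, hLd₂⟩ := exists_circle_lift_cube
    (f := fun x => d (face (Fin.last m) true x))
    (hd.comp_continuous (face _ _).continuous (face_mem_bdry _ _))
  have hH := H L₁ L₂ hL₁.continuousOn hLd₁' hL₂ hLd₂
  -- On the common boundary of the two parts the lifts differ by a constant, which is an integer
  -- since both cover `d`. Shifting `L₂` by it makes them match. If `bdry m` is empty, nothing has
  -- to match.
  obtain ⟨N, hN⟩ : ∃ N : ℤ, ∀ x ∈ bdry m, L₁ (face (Fin.last m) true x) = L₂ x + N := by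
    by_cases hne : (bdry m).Nonempty
    · obtain ⟨x₀, hx₀⟩ := hne
      obtain ⟨N, hN⟩ := circle_coe_eq_coe_iff.1 ((hLd₁' _ (face_last_mem_openBox hx₀ true)).trans
        (hLd₂ x₀).symm)
      exact ⟨N, fun x hx => by linarith [hH x hx x₀ hx₀]⟩
    · exact ⟨0, fun x hx => (hne ⟨x, hx⟩).elim⟩
  classical
  set f : Cube (m + 1) → ℝ := fun y => if y ∈ openBox m then L₁ y else L₂ (dropLast y) + N with hf
  have hU : bdry (m + 1) = openBox m ∪ lastFace m := by
    ext y; exact mem_bdry_succ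
  have hf2 : ∀ y, y (Fin.last m) = endpoint true → f y = L₂ (dropLast y) + N := by
    intro y hy
    simp only [hf]
    split_ifs with hy'
    · have hy2 : dropLast y ∈ bdry m := by
        rcases hy' with ⟨i, ε, h⟩ | h
        · exact ⟨i, ε, h⟩
        · exfalso
          rw [h] at hy
          have := congrArg Subtype.val hy
          norm_num at this
      rw [← hN _ hy2, face_dropLast hy]
    · rfl
  have hfc : ContinuousOn f (bdry (m + 1)) := by
    rw [hU]
    refine ContinuousOn.union_of_isClosed (hL₁.continuousOn.congr fun y hy => if_pos hy)
      (((hL₂.comp continuous_dropLast).add continuous_const).continuousOn.congr hf2)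
      (isClosed_openBox m) (isClosed_lastFace m)
  obtain ⟨e, he, hef⟩ := exists_continuous_extension (isClosed_bdry _) hfc
  refine ⟨e, he, fun x hx => ?_⟩
  rw [hef x hx]
  rcases mem_bdry_succ.1 hx with hx | hx
  · simp [hf, hx, hLd₁' x hx]
  · rw [hf2 x hx, AddCircle.coe_add, hLd₂, face_dropLast hx]
    have : ((N : ℝ) : UnitAddCircle) = 0 := (AddCircle.coe_eq_zero_iff 1).2 ⟨N, by simp⟩
    rw [this, add_zero]

/-- Circle torsors over the boundary of a cube of dimension at least `4` are trivial. -/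
theorem IsTwist.exists_section_bdry_of_le {ι : Type*} {m : ℕ} (hm : 4 ≤ m) {U : ι → Set (Cube m)}
    {g : ι → Cube m → UnitAddCircle} (h : IsTwist U g (bdry m)) :
    ∃ s, IsSecOn U g (bdry m) s := by
  obtain ⟨m, rfl⟩ : ∃ l, m = l + 1 + 1 := ⟨m - 2, by omega⟩
  refine h.exists_section_bdry fun t s' ht hs' => ?_
  refine exists_circle_lift_bdry (d := fun x => t (face (Fin.last _) true x) - s' x) ?_ ?_
  · refine IsSecOn.continuousOn_sub
      (U := fun i => face (Fin.last _) true ⁻¹' U i)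
      (g := fun i x => g i (face (Fin.last _) true x))
      (fun i => (h.isOpen i).preimage (face _ _).continuous)
      (fun x hx => by simpa using h.cover (face_mem_bdry _ _ x)) ?_ (hs'.mono (subset_univ _))
    exact ht.comp (face _ _).continuous fun x hx => face_last_mem_openBox hx _
  · intro L₁ L₂ hL₁ h₁ hL₂ h₂ x hx y hy
    -- The cube now has dimension `m + 2`, and the two parts of the boundary of its last face meet
    -- in a copy of `bdry m`. This is connected because `2 ≤ m`, which is where dimension at least
    -- `4` enters.
    refine eq_of_isPreconnected_of_int (isPreconnected_bdry (m := m) (by omega))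
      (f := fun x => L₁ (face (Fin.last m) true x) - L₂ x) ?_ (fun z hz => ?_) hx hy
    · exact (hL₁.comp (face _ _).continuous.continuousOn fun x hx =>
        face_last_mem_openBox hx _).sub hL₂.continuousOn
    · rw [← circle_coe_eq_coe_iff, h₁ _ (face_last_mem_openBox hz _), h₂]

end

section

variable {n : ℕ} {B : Type u} [TopologicalSpace B] [ChartedSpace (Eucl n) B]
  [IsManifold 𝓘(ℝ, Eucl n) ∞ B] {k : ℕ}

/-! ### Integral duals -/

section Dual

variable {Γ Γ' : Type*} [AddCommGroup Γ] [AddCommGroup Γ']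

/-- The group `Γ ⊗ ℝ/ℤ`, for a free abelian group `Γ` of finite rank. -/
abbrev CircleMod (Γ : Type*) [AddCommGroup Γ] : Type _ := (Γ →+ ℤ) →+ UnitAddCircle

/-- The coordinates with respect to a basis as homomorphisms of groups. -/
def coordHom (b : Module.Basis (Fin k) ℤ Γ) (j : Fin k) : Γ →+ ℤ := (b.coord j).toAddMonoidHom

@[simp] theorem coordHom_apply_basis (b : Module.Basis (Fin k) ℤ Γ) (i j : Fin k) :
    coordHom b j (b i) = if i = j then 1 else 0 := by
  simp [coordHom, Finsupp.single_apply]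

theorem eq_sum_coordHom (b : Module.Basis (Fin k) ℤ Γ) (x : Γ) :
    x = ∑ j, coordHom b j x • b j := (b.sum_repr x).symm

theorem intDual_ext (b : Module.Basis (Fin k) ℤ Γ) {ξ η : Γ →+ ℤ} (h : ∀ j, ξ (b j) = η (b j)) :
    ξ = η := by
  ext x
  rw [eq_sum_coordHom b x]
  simp [map_sum, h]

theorem intDual_eq_sum (b : Module.Basis (Fin k) ℤ Γ) (ξ : Γ →+ ℤ) :
    ξ = ∑ j, ξ (b j) • coordHom b j :=
  intDual_ext b fun j => by simp [AddMonoidHom.finsetSum_apply]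

theorem eq_of_forall_intDual (b : Module.Basis (Fin k) ℤ Γ) {x y : Γ}
    (h : ∀ ξ : Γ →+ ℤ, ξ x = ξ y) : x = y := by
  rw [eq_sum_coordHom b x, eq_sum_coordHom b y]
  simp [h]

/-- Free abelian groups of finite rank are reflexive. Elements of `P` are constructed below from
their pairings with all integral functionals. -/
theorem exists_forall_intDual_eq (b : Module.Basis (Fin k) ℤ Γ) (D : (Γ →+ ℤ) →+ ℤ) :
    ∃ x : Γ, ∀ ξ : Γ →+ ℤ, ξ x = D ξ := by
  refine ⟨∑ j, D (coordHom b j) • b j, fun ξ => ?_⟩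
  conv_rhs => rw [intDual_eq_sum b ξ]
  simp [map_sum, mul_comm]

/-- The element of `Γ ⊗ ℝ/ℤ` with given coordinates. -/
def circleModMk (b : Module.Basis (Fin k) ℤ Γ) (s : Fin k → UnitAddCircle) : CircleMod Γ where
  toFun ξ := ∑ j, ξ (b j) • s j
  map_zero' := by simp
  map_add' ξ η := by simp [add_smul, Finset.sum_add_distrib]

theorem circleModMk_apply (b : Module.Basis (Fin k) ℤ Γ) (s : Fin k → UnitAddCircle)
    (ξ : Γ →+ ℤ) : circleModMk b s ξ = ∑ j, ξ (b j) • s j := rfl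

theorem circleMod_apply_eq_sum (b : Module.Basis (Fin k) ℤ Γ) (a : CircleMod Γ) (ξ : Γ →+ ℤ) :
    a ξ = ∑ j, ξ (b j) • a (coordHom b j) := by
  conv_lhs => rw [intDual_eq_sum b ξ]
  simp [map_sum]

end Dual

/-! ### The local system over cubes -/

theorem isPreconnected_univ_cube {m : ℕ} : IsPreconnected (univ : Set (Cube m)) := by
  rw [← box_neg_one_one]
  exact isPreconnected_box isBox_neg_one_one

namespace Lattice

variable (P : Lattice n B k)

theorem along_ext {P : Lattice n B k} {m : ℕ} {σ : C(Cube m, B)} {a b : P.along σ}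
    (h : ∀ t, a.val t = b.val t) : a = b := Subtype.ext (funext h)

theorem along_val_mem {P : Lattice n B k} {m : ℕ} {σ : C(Cube m, B)} (a : P.along σ)
    (t : Cube m) : a.val t ∈ P.fiber (σ t) := a.2.1 t

theorem along_continuous {P : Lattice n B k} {m : ℕ} {σ : C(Cube m, B)} (a : P.along σ) :
    Continuous fun t => cotMk (σ t) (a.val t) := a.2.2

/-- Evaluation at a point of the cube identifies the sections of `P` along a cube with the fibre
of `P`. -/
def ev {m : ℕ} (σ : C(Cube m, B)) (t : Cube m) : P.along σ ≃+ P.fiber (σ t) :=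
  AddEquiv.ofBijective
    ({ toFun := fun a => ⟨a.val t, along_val_mem a t⟩
       map_zero' := rfl
       map_add' := fun _ _ => rfl } : P.along σ →+ P.fiber (σ t)) <| by
    constructor
    · intro a b hab
      refine along_ext fun s => P.eq_of_eq_at isPreconnected_univ_cube
        (along_continuous a).continuousOn (along_continuous b).continuousOn
        (fun s _ => sub_mem (along_val_mem a s) (along_val_mem b s)) (mem_univ t) (mem_univ s) ?_
      exact congrArg Subtype.val hab
    · rintro ⟨p, hp⟩
      obtain ⟨a, ha, haP, hat⟩ := P.exists_continuous_section_of_coset σ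
        (fun t => (P.fiber (σ t) : Set (Cot (n := n) (σ t))))
        (fun t₀ => ⟨univ, Filter.univ_mem, fun t => 0,
          (continuous_zero_cot σ.continuous).continuousOn, fun t _ α => by simp⟩) t hp
      exact ⟨⟨a, haP, ha⟩, Subtype.ext hat⟩

@[simp] theorem coe_ev {m : ℕ} (σ : C(Cube m, B)) (t : Cube m) (a : P.along σ) :
    (P.ev σ t a : Cot (n := n) (σ t)) = a.val t := rfl

theorem ev_comp_restrict {m l : ℕ} (σ : C(Cube m, B)) (f : C(Cube l, Cube m)) (x : Cube l)
    (a : P.along σ) : P.ev (σ.comp f) x (P.restrict f a) = P.ev σ (f x) a := rfl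

/-- Restriction of sections along cubes is an isomorphism. -/
def restrictEquiv {m l : ℕ} (σ : C(Cube m, B)) (f : C(Cube l, Cube m)) :
    P.along σ ≃+ P.along (σ.comp f) :=
  AddEquiv.ofBijective (P.restrict f) <| by
    have h : ⇑(P.restrict (σ := σ) f) =
        (P.ev (σ.comp f) (fun _ => endpoint true)).symm ∘ P.ev σ (f fun _ => endpoint true) := by
      ext1 a
      exact ((P.ev (σ.comp f) _).symm_apply_apply _).symm
    rw [h]
    exact (AddEquiv.bijective _).comp (AddEquiv.bijective _)

@[simp] theorem restrictEquiv_apply {m l : ℕ} (σ : C(Cube m, B)) (f : C(Cube l, Cube m))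
    (a : P.along σ) : P.restrictEquiv σ f a = P.restrict f a := rfl

namespace Frame

variable {P} (F : P.Frame)

theorem vec_mem {y : B} (hy : y ∈ F.dom) (i : Fin k) : F.vec i y ∈ P.fiber y := by
  classical
  exact (F.mem_iff y hy _).2 ⟨Pi.single i 1, by simp [Pi.single_apply]⟩

/-- The basis of the fibre of `P` given by a frame. -/
def basis {y : B} (hy : y ∈ F.dom) : Module.Basis (Fin k) ℤ (P.fiber y) :=
  .mk (v := fun i => ⟨F.vec i y, F.vec_mem hy i⟩)
    (by
      rw [Fintype.linearIndependent_iff]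
      intro c hc i
      have h1 : ∑ i, c i • F.vec i y = 0 := by
        have := congrArg Subtype.val hc
        simpa using this
      have h2 := F.coord_zsum hy c
      rw [h1, map_zero] at h2
      have := congrFun h2 i
      simp only [Pi.zero_apply] at this
      exact_mod_cast this.symm)
    (by
      rintro ⟨p, hp⟩ -
      obtain ⟨c, rfl⟩ := (F.mem_iff y hy p).1 hp
      refine (Submodule.mem_span_range_iff_exists_fun ℤ).2 ⟨c, Subtype.ext ?_⟩
      simp)

@[simp] theorem coe_basis {y : B} (hy : y ∈ F.dom) (i : Fin k) :
    (F.basis hy i : Cot (n := n) y) = F.vec i y := by simp [basis]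

open Classical in
/-- The integral coordinates with respect to a frame. -/
def zcoord (y : B) (j : Fin k) : P.fiber y →+ ℤ :=
  if h : y ∈ F.dom then coordHom (F.basis h) j else 0

theorem zcoord_of_mem {y : B} (hy : y ∈ F.dom) (j : Fin k) :
    F.zcoord y j = coordHom (F.basis hy) j := by simp [zcoord, hy]

/-- Near a point, a frame extends to a basis of the sections along a cube. -/
theorem exists_basis_along {m : ℕ} (σ : C(Cube m, B)) {t₀ : Cube m} (h₀ : σ t₀ ∈ F.dom) :
    ∃ γ : Module.Basis (Fin k) ℤ (P.along σ), ∀ᶠ t in 𝓝 t₀, ∃ h : σ t ∈ F.dom,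
      ∀ i, P.ev σ t (γ i) = F.basis h i := by
  refine ⟨(F.basis h₀).map (P.ev σ t₀).symm.toIntLinearEquiv, ?_⟩
  have h1 : ∀ᶠ t in 𝓝 t₀, σ t ∈ F.dom :=
    σ.continuous.continuousAt.preimage_mem_nhds (F.isOpen_dom.mem_nhds h₀)
  have h2 : ∀ i, ∀ᶠ t in 𝓝 t₀,
      ((P.ev σ t₀).symm (F.basis h₀ i)).val t = F.vec i (σ t) := by
    intro i
    have hc : ContinuousWithinAt (fun t => cotMk (σ t)
        (((P.ev σ t₀).symm (F.basis h₀ i)).val t - F.vec i (σ t))) univ t₀ :=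
      continuousWithinAt_cot_sub (along_continuous _).continuousWithinAt
        (F.continuousWithinAt_vec h₀ σ.continuous.continuousWithinAt i)
    have h3 := P.eventually_eq_zero_iff (f := σ) (mem_univ t₀) hc (by
      rw [nhdsWithin_univ]
      filter_upwards [h1] with t ht
      exact sub_mem (along_val_mem _ _) (F.vec_mem ht i))
    rw [nhdsWithin_univ] at h3
    filter_upwards [h3] with t ht
    refine sub_eq_zero.1 (ht.2 ?_)
    rw [← coe_ev, AddEquiv.apply_symm_apply, coe_basis, sub_self]
  filter_upwards [h1, Filter.eventually_all.2 h2] with t ht ht'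
  refine ⟨ht, fun i => Subtype.ext ?_⟩
  rw [coe_basis, ← ht' i]
  rfl

end Frame

theorem nonempty_basis_fiber (x : B) : Nonempty (Module.Basis (Fin k) ℤ (P.fiber x)) :=
  let ⟨F, hF⟩ := P.exists_frame_at x
  ⟨F.basis hF⟩

/-- A basis of the group of sections of `P` along a cube. -/
def basisAlong {m : ℕ} (σ : C(Cube m, B)) : Module.Basis (Fin k) ℤ (P.along σ) :=
  (P.nonempty_basis_fiber _).some.map (P.ev σ fun _ => endpoint true).symm.toIntLinearEquiv

/-! ### Sections of `P ⊗ ℝ/ℤ` -/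

/-- The restriction of a section of `P ⊗ ℝ/ℤ` to a cube. -/
def pull {m : ℕ} (σ : C(Cube m, B)) (g : ∀ b, CircleMod (P.fiber b)) (t : Cube m) :
    CircleMod (P.along σ) :=
  (g (σ t)).comp (AddMonoidHom.compHom' (P.ev σ t).symm.toAddMonoidHom)

theorem pull_apply {m : ℕ} (σ : C(Cube m, B)) (g : ∀ b, CircleMod (P.fiber b)) (t : Cube m)
    (ξ : P.along σ →+ ℤ) :
    P.pull σ g t ξ = g (σ t) (ξ.comp (P.ev σ t).symm.toAddMonoidHom) := rfl

/-- The value of a section of `P ⊗ ℝ/ℤ` along a cube. -/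
def push {m : ℕ} (σ : C(Cube m, B)) (t : Cube m) (a : CircleMod (P.along σ)) :
    CircleMod (P.fiber (σ t)) :=
  a.comp (AddMonoidHom.compHom' (P.ev σ t).toAddMonoidHom)

theorem push_apply {m : ℕ} (σ : C(Cube m, B)) (t : Cube m) (a : CircleMod (P.along σ))
    (ξ : P.fiber (σ t) →+ ℤ) : P.push σ t a ξ = a (ξ.comp (P.ev σ t).toAddMonoidHom) := rfl

theorem pull_of_eq_push {m : ℕ} (σ : C(Cube m, B)) {g : ∀ b, CircleMod (P.fiber b)} {t : Cube m}
    {a : CircleMod (P.along σ)} (h : g (σ t) = P.push σ t a) : P.pull σ g t = a := by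
  ext ξ
  rw [pull_apply, h, push_apply]
  congr 1
  ext x
  simp

theorem pull_comp {m l : ℕ} (σ : C(Cube m, B)) (f : C(Cube l, Cube m))
    (g : ∀ b, CircleMod (P.fiber b)) (x : Cube l) (ξ : P.along (σ.comp f) →+ ℤ) :
    P.pull (σ.comp f) g x ξ = P.pull σ g (f x) (ξ.comp (P.restrictEquiv σ f).toAddMonoidHom) := by
  rw [pull_apply, pull_apply]
  change g (σ (f x)) _ = g (σ (f x)) _
  congr 1
  ext p
  obtain ⟨a, rfl⟩ := (P.ev σ (f x)).surjective p
  change ξ ((P.ev (σ.comp f) x).symm (P.ev σ (f x) a)) =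
    ξ (P.restrict f ((P.ev σ (f x)).symm (P.ev σ (f x) a)))
  rw [AddEquiv.symm_apply_apply, ← ev_comp_restrict, AddEquiv.symm_apply_apply]

theorem pull_sub {m : ℕ} (σ : C(Cube m, B)) (g g' : ∀ b, CircleMod (P.fiber b)) (t : Cube m) :
    P.pull σ (fun b => g b - g' b) t = P.pull σ g t - P.pull σ g' t := rfl

variable {P}

/-- Continuity of a section of `P ⊗ ℝ/ℤ` over a subset of `B`. -/
def ContCircle (f : ∀ b, CircleMod (P.fiber b)) (O : Set B) : Prop :=
  ∀ (F : P.Frame) (j : Fin k), ContinuousOn (fun b => f b (F.zcoord b j)) (F.dom ∩ O)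

theorem ContCircle.mono {f : ∀ b, CircleMod (P.fiber b)} {O O' : Set B} (h : ContCircle f O)
    (hO : O' ⊆ O) : ContCircle f O' :=
  fun F j => (h F j).mono (inter_subset_inter_right _ hO)

/-- Near `t₀` the frame is the restriction of a basis of `P.along σ`, so a fixed functional `ξ` has
constant integral coefficients in it. They do not depend on `f`, which lets continuity pass between
frames on `B` and functionals along cubes. -/
theorem Frame.eventually_pull_eq (F : P.Frame) {m : ℕ} (σ : C(Cube m, B)) {t₀ : Cube m}
    (h₀ : σ t₀ ∈ F.dom) (ξ : P.along σ →+ ℤ) :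
    ∃ c : Fin k → ℤ, ∀ᶠ t in 𝓝 t₀, σ t ∈ F.dom ∧ ∀ f : ∀ b, CircleMod (P.fiber b),
      P.pull σ f t ξ = ∑ j, c j • f (σ t) (F.zcoord (σ t) j) := by
  obtain ⟨γ, hγ⟩ := F.exists_basis_along σ h₀
  refine ⟨fun j => ξ (γ j), ?_⟩
  filter_upwards [hγ] with t ⟨ht, hγ⟩
  refine ⟨ht, fun f => ?_⟩
  rw [pull_apply, circleMod_apply_eq_sum (F.basis ht)]
  refine Finset.sum_congr rfl fun j _ => ?_
  rw [F.zcoord_of_mem ht, ← hγ j]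
  simp

theorem Frame.eventually_eq_pull (F : P.Frame) {m : ℕ} (σ : C(Cube m, B)) {t₀ : Cube m}
    (h₀ : σ t₀ ∈ F.dom) (j : Fin k) :
    ∃ ξ : P.along σ →+ ℤ, ∀ᶠ t in 𝓝 t₀, σ t ∈ F.dom ∧ ∀ f : ∀ b, CircleMod (P.fiber b),
      f (σ t) (F.zcoord (σ t) j) = P.pull σ f t ξ := by
  obtain ⟨γ, hγ⟩ := F.exists_basis_along σ h₀
  refine ⟨coordHom γ j, ?_⟩
  filter_upwards [hγ] with t ⟨ht, hγ⟩
  refine ⟨ht, fun f => ?_⟩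
  rw [pull_apply]
  congr 1
  refine intDual_ext (F.basis ht) fun i => ?_
  rw [F.zcoord_of_mem ht, coordHom_apply_basis, ← hγ i]
  simp

theorem ContCircle.continuousOn_pull {f : ∀ b, CircleMod (P.fiber b)} {O : Set B}
    (h : ContCircle f O) {m : ℕ} (σ : C(Cube m, B)) {S : Set (Cube m)} (hS : MapsTo σ S O)
    (ξ : P.along σ →+ ℤ) : ContinuousOn (fun t => P.pull σ f t ξ) S := by
  intro t₀ ht₀
  obtain ⟨F, hF⟩ := P.exists_frame_at (σ t₀)
  obtain ⟨c, hc⟩ := F.eventually_pull_eq σ hF ξ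
  have h1 : ContinuousWithinAt (fun t => ∑ j, c j • f (σ t) (F.zcoord (σ t) j)) S t₀ := by
    refine tendsto_finsetSum _ fun j _ => ?_
    refine ((continuous_zsmul (c j)).continuousAt).comp_continuousWithinAt
      (f := fun t => f (σ t) (F.zcoord (σ t) j)) ?_
    have h2 : ContinuousWithinAt (fun t => f (σ t) (F.zcoord (σ t) j)) (S ∩ σ ⁻¹' F.dom) t₀ :=
      ((h F j) (σ t₀) ⟨hF, hS ht₀⟩).comp (f := σ) σ.continuous.continuousWithinAt
        fun t ht => ⟨ht.2, hS ht.1⟩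
    exact (continuousWithinAt_inter
      ((F.isOpen_dom.preimage σ.continuous).mem_nhds hF)).1 h2
  refine h1.congr_of_eventuallyEq ?_ (hc.self_of_nhds.2 f)
  exact (hc.filter_mono nhdsWithin_le_nhds).mono fun t ht => ht.2 f

end Lattice

end

section

/-! ### Cell complexes -/

section CW

variable {B : Type u} [TopologicalSpace B] [T2Space B] [CWComplex (univ : Set B)]

theorem mem_compl_bdry_iff {m : ℕ} {y : Cube m} :
    y ∉ bdry m ↔ (fun i => (y i : ℝ)) ∈ Metric.ball (0 : Fin m → ℝ) 1 := by
  rw [mem_bdry_iff_norm, mem_ball_zero_iff]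
  exact ⟨fun h => lt_of_le_of_ne (Cube.norm_le y) h, fun h => h.ne⟩

theorem charMap_mem_openCell {m : ℕ} (e : Cell B m) {y : Cube m} (hy : y ∉ bdry m) :
    charMap e y ∈ RelCWComplex.openCell m e := ⟨_, mem_compl_bdry_iff.1 hy, rfl⟩

theorem exists_charMap_eq_of_mem_closedCell {m : ℕ} {e : Cell B m} {b : B}
    (hb : b ∈ RelCWComplex.closedCell m e) : ∃ y, charMap e y = b := by
  obtain ⟨x, hx, rfl⟩ := hb
  rw [mem_closedBall_zero_iff, pi_norm_le_iff_of_nonneg zero_le_one] at hx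
  exact ⟨fun i => ⟨x i, abs_le.1 (hx i)⟩, rfl⟩

theorem exists_charMap_eq_of_mem_openCell {m : ℕ} {e : Cell B m} {b : B}
    (hb : b ∈ RelCWComplex.openCell m e) : ∃ y, y ∉ bdry m ∧ charMap e y = b := by
  obtain ⟨x, hx, rfl⟩ := hb
  have hx' := Metric.ball_subset_closedBall hx
  rw [mem_closedBall_zero_iff, pi_norm_le_iff_of_nonneg zero_le_one] at hx'
  exact ⟨fun i => ⟨x i, abs_le.1 (hx' i)⟩, mem_compl_bdry_iff.2 hx, rfl⟩

theorem range_charMap {m : ℕ} (e : Cell B m) : range (charMap e) = RelCWComplex.closedCell m e := by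
  ext b
  constructor
  · rintro ⟨y, rfl⟩
    exact ⟨_, by simpa using Cube.norm_le y, rfl⟩
  · exact exists_charMap_eq_of_mem_closedCell

theorem charMap_injOn {m : ℕ} (e : Cell B m) {y y' : Cube m} (hy : y ∉ bdry m) (hy' : y' ∉ bdry m)
    (h : charMap e y = charMap e y') : y = y' := by
  have := (RelCWComplex.map m e).injOn (by rw [RelCWComplex.source_eq]; exact mem_compl_bdry_iff.1 hy)
    (by rw [RelCWComplex.source_eq]; exact mem_compl_bdry_iff.1 hy') h
  ext i
  exact congrFun this i

/-- The cells of all dimensions. -/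
abbrev CellIdx (B : Type u) [TopologicalSpace B] [T2Space B] [CWComplex (univ : Set B)] : Type u :=
  Σ m, Cell B m

theorem eq_of_mem_openCell {i j : CellIdx B} {b : B} (hi : b ∈ RelCWComplex.openCell i.1 i.2)
    (hj : b ∈ RelCWComplex.openCell j.1 j.2) : i = j :=
  RelCWComplex.eq_of_not_disjoint_openCell (not_disjoint_iff.2 ⟨b, hi, hj⟩)

theorem exists_mem_openCell (b : B) : ∃ i : CellIdx B, b ∈ RelCWComplex.openCell i.1 i.2 := by
  have : b ∈ ⋃ (n : ℕ) (j : Cell B n), RelCWComplex.openCell n j := by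
    rw [CWComplex.iUnion_openCell_eq_complex]; trivial
  obtain ⟨m, e, h⟩ := by simpa using this
  exact ⟨⟨m, e⟩, h⟩

theorem mem_skel_iff {N : ℕ} {b : B} :
    b ∈ skel B N ↔ ∃ i : CellIdx B, i.1 ≤ N ∧ b ∈ RelCWComplex.openCell i.1 i.2 := by
  rw [skel, SetLike.mem_coe, CWComplex.mem_skeletonLT_iff]
  constructor
  · rintro ⟨m, hm, j, hj⟩
    exact ⟨⟨m, j⟩, by simpa [Nat.lt_succ_iff] using (Nat.cast_lt (α := ℕ∞)).1 hm, hj⟩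
  · rintro ⟨⟨m, j⟩, hm, hj⟩
    exact ⟨m, by exact_mod_cast Nat.lt_succ_of_le hm, j, hj⟩

theorem mem_skel_iff_of_mem_openCell {N : ℕ} {b : B} {i : CellIdx B}
    (hi : b ∈ RelCWComplex.openCell i.1 i.2) : b ∈ skel B N ↔ i.1 ≤ N := by
  rw [mem_skel_iff]
  constructor
  · rintro ⟨j, hj, h⟩
    rwa [eq_of_mem_openCell hi h]
  · exact fun h => ⟨i, h, hi⟩

theorem charMap_mem_skel_iff {N m : ℕ} (e : Cell B m) {y : Cube m} (hy : y ∉ bdry m) :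
    charMap e y ∈ skel B N ↔ m ≤ N :=
  mem_skel_iff_of_mem_openCell (i := ⟨m, e⟩) (charMap_mem_openCell e hy)

theorem skel_mono {M N : ℕ} (h : M ≤ N) : skel B M ⊆ skel B N := fun b hb => by
  obtain ⟨i, hi, hb⟩ := mem_skel_iff.1 hb
  exact mem_skel_iff.2 ⟨i, hi.trans h, hb⟩

theorem charMap_mem_skel {m : ℕ} (e : Cell B m) (y : Cube m) : charMap e y ∈ skel B m := by
  have h := RelCWComplex.closedCell_subset_skeletonLT (C := (univ : Set B)) m e
  rw [← range_charMap] at h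
  simpa [skel] using h (mem_range_self y)

theorem charMap_mem_skel_of_le {m N : ℕ} (h : m ≤ N) (e : Cell B m) (y : Cube m) :
    charMap e y ∈ skel B N := skel_mono h (charMap_mem_skel e y)

theorem charMap_mem_skel_of_mem_bdry {m : ℕ} (e : Cell B (m + 1)) {y : Cube (m + 1)}
    (hy : y ∈ bdry (m + 1)) : charMap e y ∈ skel B m := by
  have h := RelCWComplex.cellFrontier_subset_skeletonLT (C := (univ : Set B)) (m + 1) e
  refine h ⟨_, ?_, rfl⟩
  simpa using mem_bdry_iff_norm.1 hy

/-- A cell complex has the weak topology, and the intersection of `A` with a closed cell is the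
image of a compact set if the preimage in the cube is closed. Cells whose interior misses `A` need
not be checked. -/
theorem isClosed_of_forall_charMap {A : Set B}
    (h : ∀ (m : ℕ) (e : Cell B m), Disjoint A (RelCWComplex.openCell m e) ∨
      IsClosed (charMap e ⁻¹' A)) : IsClosed A := by
  refine CWComplex.isClosed_of_disjoint_openCell_or_isClosed_inter_closedCell
    (C := univ) (subset_univ _) fun m _ e => (h m e).imp id fun h => ?_
  rw [inter_comm, ← range_charMap, inter_comm, ← image_preimage_eq_inter_range]
  exact (h.isCompact.image (charMap e).continuous).isClosed

/-- A subset of a skeleton whose preimages in the cells are open is relatively open. -/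
theorem exists_isOpen_inter_skel {W : Set B} {N : ℕ}
    (h : ∀ m ≤ N, ∀ e : Cell B m, IsOpen (charMap e ⁻¹' W)) :
    ∃ V, IsOpen V ∧ V ∩ skel B N = W ∩ skel B N := by
  refine ⟨(skel B N \ W)ᶜ, ?_, by ext; simp; tauto⟩
  rw [isOpen_compl_iff]
  refine isClosed_of_forall_charMap fun m e => ?_
  by_cases hm : m ≤ N
  · right
    have : charMap e ⁻¹' (skel B N \ W) = (charMap e ⁻¹' W)ᶜ := by
      ext y
      simp [charMap_mem_skel_of_le hm]
    rw [this]
    exact (h m hm e).isClosed_compl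
  · left
    refine disjoint_left.2 fun b hb hb' => hm ?_
    exact (mem_skel_iff_of_mem_openCell (i := ⟨m, e⟩) hb').1 hb.1

theorem isOpen_of_forall_charMap {W : Set B}
    (h : ∀ (m : ℕ) (e : Cell B m), IsOpen (charMap e ⁻¹' W)) : IsOpen W := by
  rw [← isClosed_compl_iff]
  exact isClosed_of_forall_charMap fun m e => Or.inr (h m e).isClosed_compl

theorem continuousOn_skel_of_forall_charMap {Z : Type*} [TopologicalSpace Z] {F : B → Z}
    {O : Set B} (hO : IsOpen O) {N : ℕ}
    (h : ∀ m ≤ N, ∀ e : Cell B m, ContinuousOn (fun y => F (charMap e y)) (charMap e ⁻¹' O)) :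
    ContinuousOn F (O ∩ skel B N) := by
  rw [continuousOn_iff']
  intro t ht
  obtain ⟨V, hV, hVN⟩ := exists_isOpen_inter_skel (W := O ∩ F ⁻¹' t) (N := N) fun m hm e =>
    (h m hm e).isOpen_inter_preimage (hO.preimage (charMap e).continuous) ht
  refine ⟨V, hV, ?_⟩
  ext b
  have := Set.ext_iff.1 hVN b
  simp only [mem_inter_iff, mem_preimage] at this ⊢
  tauto

theorem continuousOn_of_forall_charMap {Z : Type*} [TopologicalSpace Z] {F : B → Z}
    {O : Set B} (hO : IsOpen O)
    (h : ∀ (m : ℕ) (e : Cell B m), ContinuousOn (fun y => F (charMap e y)) (charMap e ⁻¹' O)) :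
    ContinuousOn F O := by
  rw [continuousOn_iff']
  intro t ht
  refine ⟨O ∩ F ⁻¹' t, isOpen_of_forall_charMap fun m e =>
    (h m e).isOpen_inter_preimage (hO.preimage (charMap e).continuous) ht, ?_⟩
  ext; simp; tauto

/-! ### Radial projection in the cells -/

/-- The radial projection of the cube to its boundary; the centre is fixed. -/
def rad {m : ℕ} (y : Cube m) : Cube m :=
  fun i => Set.projIcc (-1) 1 (by norm_num) ((y i : ℝ) / ‖(fun i => (y i : ℝ))‖)

/-- The cube without its centre. -/
def punctured (m : ℕ) : Set (Cube m) := {y | ‖(fun i => (y i : ℝ))‖ ≠ 0}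

theorem continuous_cubeNorm {m : ℕ} : Continuous fun y : Cube m => ‖(fun i => (y i : ℝ))‖ := by
  refine Continuous.norm (continuous_pi fun i => ?_)
  exact continuous_subtype_val.comp (continuous_apply i)

theorem isOpen_punctured (m : ℕ) : IsOpen (punctured m) :=
  isOpen_compl_singleton.preimage continuous_cubeNorm

theorem continuousOn_rad {m : ℕ} : ContinuousOn (rad (m := m)) (punctured m) := by
  unfold rad
  refine continuousOn_pi.2 fun i => continuous_projIcc.comp_continuousOn ?_
  exact ContinuousOn.div (by fun_prop) continuous_cubeNorm.continuousOn fun y hy => hy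

theorem bdry_subset_punctured (m : ℕ) : bdry m ⊆ punctured m := fun y hy => by
  change ‖(fun i => (y i : ℝ))‖ ≠ 0
  rw [mem_bdry_iff_norm.1 hy]
  exact one_ne_zero

theorem rad_of_mem_bdry {m : ℕ} {y : Cube m} (hy : y ∈ bdry m) : rad y = y := by
  have := mem_bdry_iff_norm.1 hy
  ext i
  simp [rad, this]

theorem rad_mem_bdry {m : ℕ} {y : Cube m} (hy : y ∈ punctured m) : rad y ∈ bdry m := by
  have h0 : 0 < ‖(fun i => (y i : ℝ))‖ := lt_of_le_of_ne (norm_nonneg _) (Ne.symm hy)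
  have h1 : (fun i => (rad y i : ℝ)) = ‖(fun i => (y i : ℝ))‖⁻¹ • fun i => (y i : ℝ) := by
    ext i
    rw [rad, Set.projIcc_of_mem]
    · simp [div_eq_inv_mul]
    · rw [mem_Icc, ← abs_le, abs_div, abs_of_pos h0, div_le_one h0]
      exact norm_le_pi_norm (fun i => (y i : ℝ)) i
  rw [mem_bdry_iff_norm, h1, norm_smul, norm_inv, norm_norm, inv_mul_cancel₀ h0.ne']

theorem rad_of_notMem_punctured {m : ℕ} {y : Cube m} (hy : y ∉ punctured m) : rad y = y := by
  have h0 : ‖(fun i => (y i : ℝ))‖ = 0 := by simpa [punctured] using hy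
  have h1 := norm_eq_zero.1 h0
  ext i
  have h2 : (y i : ℝ) = 0 := congrFun h1 i
  rw [rad, h0, div_zero, Set.projIcc_of_mem _ (by norm_num), h2]

/-- The radial projection in the open cells. -/
def radialStep (b : B) : B :=
  charMap (exists_mem_openCell b).choose.2
    (rad (exists_charMap_eq_of_mem_openCell (exists_mem_openCell b).choose_spec).choose)

theorem radialStep_charMap {m : ℕ} (e : Cell B m) {y : Cube m} (hy : y ∉ bdry m) :
    radialStep (charMap e y) = charMap e (rad y) := by
  have key : ∀ (i : CellIdx B) (y' : Cube i.1), y' ∉ bdry i.1 → charMap i.2 y' = charMap e y →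
      charMap i.2 (rad y') = charMap e (rad y) := by
    intro i y' hy' h
    have hi : i = ⟨m, e⟩ := eq_of_mem_openCell (b := charMap e y)
      (h ▸ charMap_mem_openCell i.2 hy') (charMap_mem_openCell e hy)
    subst hi
    rw [charMap_injOn e hy' hy h]
  have h := (exists_charMap_eq_of_mem_openCell
    (exists_mem_openCell (charMap e y)).choose_spec).choose_spec
  exact key _ _ h.1 h.2

/-- The points that reach the open cell `i` under iterated radial projection: a neighbourhood of
the open cell. -/
def cellStar (i : CellIdx B) : Set B :=
  {b | ∃ j : ℕ, radialStep^[j] b ∈ RelCWComplex.openCell i.1 i.2}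

theorem mem_cellStar_self {i : CellIdx B} {b : B} (h : b ∈ RelCWComplex.openCell i.1 i.2) :
    b ∈ cellStar i := ⟨0, h⟩

theorem iUnion_cellStar : ⋃ i : CellIdx B, cellStar i = univ :=
  eq_univ_of_forall fun b =>
    let ⟨i, hi⟩ := exists_mem_openCell b
    mem_iUnion.2 ⟨i, mem_cellStar_self hi⟩

theorem mem_cellStar_iff {i : CellIdx B} {b : B} :
    b ∈ cellStar i ↔ b ∈ RelCWComplex.openCell i.1 i.2 ∨ radialStep b ∈ cellStar i := by
  constructor
  · rintro ⟨j, hj⟩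
    cases j with
    | zero => exact Or.inl hj
    | succ j => exact Or.inr ⟨j, by simpa using hj⟩
  · rintro (h | ⟨j, hj⟩)
    · exact ⟨0, h⟩
    · exact ⟨j + 1, by simpa using hj⟩

theorem radialStep_mem_skel {b : B} {N : ℕ} (hb : b ∈ skel B N) : radialStep b ∈ skel B N := by
  obtain ⟨⟨m, e⟩, hm, hb⟩ := mem_skel_iff.1 hb
  obtain ⟨y, hy, rfl⟩ := exists_charMap_eq_of_mem_openCell hb
  rw [radialStep_charMap e hy]
  exact charMap_mem_skel_of_le hm e _

theorem disjoint_cellStar_skel {i : CellIdx B} {N : ℕ} (h : N < i.1) {b : B}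
    (hb : b ∈ skel B N) : b ∉ cellStar i := by
  rintro ⟨j, hj⟩
  have : radialStep^[j] b ∈ skel B N := by
    clear hj
    induction j with
    | zero => exact hb
    | succ j ih => rw [Function.iterate_succ_apply']; exact radialStep_mem_skel ih
  exact absurd ((mem_skel_iff_of_mem_openCell hj).1 this) (by omega)

theorem charMap_mem_cellStar_iff {m : ℕ} (e : Cell B m) {y : Cube m} (hy : y ∉ bdry m)
    (i : CellIdx B) : charMap e y ∈ cellStar i ↔
      i = ⟨m, e⟩ ∨ (y ∈ punctured m ∧ charMap e (rad y) ∈ cellStar i) := by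
  have h1 : charMap e y ∈ RelCWComplex.openCell i.1 i.2 ↔ i = ⟨m, e⟩ := by
    constructor
    · exact fun h => eq_of_mem_openCell (b := charMap e y) h (charMap_mem_openCell e hy)
    · rintro rfl; exact charMap_mem_openCell e hy
  by_cases hp : y ∈ punctured m
  · rw [mem_cellStar_iff, h1, radialStep_charMap e hy]
    simp [hp]
  -- The centre of a cell is fixed by the radial projection, so its orbit never leaves its own open
  -- cell.
  · have h2 : ∀ j, radialStep^[j] (charMap e y) = charMap e y := by
      intro j
      induction j with
      | zero => rfl
      | succ j ih =>
        rw [Function.iterate_succ_apply', ih, radialStep_charMap e hy, rad_of_notMem_punctured hp]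
    simp only [hp, false_and, or_false, ← h1]
    exact ⟨fun ⟨j, hj⟩ => by rwa [h2] at hj, mem_cellStar_self⟩

theorem not_mem_cellStar_self_of_mem_bdry {m : ℕ} (e : Cell B m) {y : Cube m} (hy : y ∈ bdry m) :
    charMap e y ∉ cellStar ⟨m, e⟩ := by
  cases m with
  | zero => obtain ⟨i, -⟩ := hy; exact i.elim0
  | succ m => exact disjoint_cellStar_skel (Nat.lt_succ_self m) (charMap_mem_skel_of_mem_bdry e hy)

theorem mapsTo_rad_cellStar {m : ℕ} (e : Cell B m) {i : CellIdx B} (hi : i ≠ ⟨m, e⟩) {y : Cube m}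
    (hy : charMap e y ∈ cellStar i) :
    y ∈ punctured m ∧ rad y ∈ bdry m ∧ charMap e (rad y) ∈ cellStar i := by
  by_cases hb : y ∈ bdry m
  · rw [rad_of_mem_bdry hb]
    exact ⟨bdry_subset_punctured m hb, hb, hy⟩
  · rcases (charMap_mem_cellStar_iff e hb i).1 hy with h | h
    · exact absurd h hi
    · exact ⟨h.1, rad_mem_bdry h.1, h.2⟩

/-- By induction on the dimension, the star agrees on the boundary of a cell with an open set `V`.
Inside the cell it consists of the points off the centre that project radially into `V`, together
with the open cell itself if that is the cell `i`. -/
theorem isOpen_cellStar (i : CellIdx B) : IsOpen (cellStar i) := by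
  refine isOpen_of_forall_charMap fun m => ?_
  induction m using Nat.strong_induction_on with
  | _ m ih =>
    intro e
    obtain ⟨V, hV, hVU⟩ : ∃ V, IsOpen V ∧ ∀ y ∈ bdry m,
        (charMap e y ∈ V ↔ charMap e y ∈ cellStar i) := by
      cases m with
      | zero => exact ⟨univ, isOpen_univ, fun y ⟨i, _⟩ => i.elim0⟩
      | succ m =>
        obtain ⟨V, hV, hVU⟩ := exists_isOpen_inter_skel (W := cellStar i) (N := m)
          fun l hl e => ih l (Nat.lt_succ_of_le hl) e
        refine ⟨V, hV, fun y hy => ?_⟩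
        have h1 := charMap_mem_skel_of_mem_bdry e hy
        have h2 := Set.ext_iff.1 hVU (charMap e y)
        simpa [h1] using h2
    have hr : IsOpen (punctured m ∩ (fun y => charMap e (rad y)) ⁻¹' V) :=
      ((charMap e).continuous.comp_continuousOn continuousOn_rad).isOpen_inter_preimage
        (isOpen_punctured m) hV
    have hO : IsOpen {y : Cube m | y ∉ bdry m ∧ i = ⟨m, e⟩} :=
      (isClosed_bdry m).isOpen_compl.and isOpen_const
    convert hO.union hr using 1
    ext y
    by_cases hy : y ∈ bdry m
    · simp [hy, bdry_subset_punctured m hy, rad_of_mem_bdry hy, hVU y hy]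
    · rw [mem_preimage, charMap_mem_cellStar_iff e hy]
      simp only [mem_union, mem_inter_iff, mem_preimage]
      refine or_congr ⟨fun h => ⟨hy, h⟩, fun h => h.2⟩ (and_congr_right fun hp => ?_)
      exact (hVU _ (rad_mem_bdry hp)).symm

end CW

end

section

/-! ### Torsors over a cell complex -/

section TwistData

variable {n : ℕ} {B : Type u} [TopologicalSpace B] [ChartedSpace (Eucl n) B]
  [IsManifold 𝓘(ℝ, Eucl n) ∞ B] {k : ℕ} [T2Space B] [CWComplex (univ : Set B)]
  {P : Lattice n B k}

variable (P) in
/-- Functions `G i`, for the cells `i`, that are regarded as sections of a torsor under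
`P ⊗ ℝ/ℤ` over the open sets `cellStar i`. -/
abbrev Lattice.TwistData : Type u := CellIdx B → ∀ b, CircleMod (P.fiber b)

/-- `s` is a section along the singular cube `σ`, over the subset `S` of the cube, of the torsor
given by `G`. -/
def IsSecAlong (G : P.TwistData) {m : ℕ} (σ : C(Cube m, B)) (S : Set (Cube m))
    (s : Cube m → CircleMod (P.along σ)) : Prop :=
  ∀ ξ : P.along σ →+ ℤ, IsSecOn (fun i => σ ⁻¹' cellStar i) (fun i t => P.pull σ (G i) t ξ) S
    (fun t => s t ξ)

/-- `G` defines a torsor over the `N`-skeleton: there are sections along all cells. -/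
def ValidUpTo (G : P.TwistData) (N : ℕ) : Prop :=
  ∀ m ≤ N, ∀ e : Cell B m, ∃ t, IsSecAlong G (charMap e) univ t

variable {G G' : P.TwistData} {N : ℕ}

theorem pull_congr {m : ℕ} {σ : C(Cube m, B)} {g g' : ∀ b, CircleMod (P.fiber b)} {t : Cube m}
    (h : g (σ t) = g' (σ t)) : P.pull σ g t = P.pull σ g' t := by
  unfold Lattice.pull; rw [h]

theorem IsSecAlong.congr_data {m : ℕ} {σ : C(Cube m, B)} {S : Set (Cube m)}
    {s : Cube m → CircleMod (P.along σ)} (h : IsSecAlong G σ S s)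
    (hG : ∀ t ∈ S, ∀ i, G' i (σ t) = G i (σ t)) : IsSecAlong G' σ S s := fun ξ i =>
  (h ξ i).congr fun t ht => by simp only [pull_congr (hG t ht.1 i)]

theorem ValidUpTo.congr_data (h : ValidUpTo G N) (hG : ∀ b ∈ skel B N, ∀ i, G' i b = G i b) :
    ValidUpTo G' N := fun m hm e =>
  let ⟨t, ht⟩ := h m hm e
  ⟨t, ht.congr_data fun y _ => hG _ (charMap_mem_skel_of_le hm e y)⟩

theorem ValidUpTo.mono {M : ℕ} (h : ValidUpTo G N) (hM : M ≤ N) : ValidUpTo G M :=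
  fun m hm e => h m (hm.trans hM) e

theorem iUnion_preimage_cellStar {m : ℕ} (σ : C(Cube m, B)) (S : Set (Cube m)) :
    S ⊆ ⋃ i : CellIdx B, σ ⁻¹' cellStar i := by
  rw [← preimage_iUnion, iUnion_cellStar]
  exact fun _ _ => trivial

theorem isOpen_preimage_cellStar {m : ℕ} (σ : C(Cube m, B)) (i : CellIdx B) :
    IsOpen (σ ⁻¹' cellStar i) := (isOpen_cellStar i).preimage σ.continuous

/-- The restriction of a section along a cube. -/
def restrictSec {m l : ℕ} (σ : C(Cube m, B)) (f : C(Cube l, Cube m))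
    (s : Cube m → CircleMod (P.along σ)) (x : Cube l) : CircleMod (P.along (σ.comp f)) :=
  (s (f x)).comp (AddMonoidHom.compHom' (P.restrictEquiv σ f).toAddMonoidHom)

theorem restrictSec_apply {m l : ℕ} (σ : C(Cube m, B)) (f : C(Cube l, Cube m))
    (s : Cube m → CircleMod (P.along σ)) (x : Cube l) (ξ : P.along (σ.comp f) →+ ℤ) :
    restrictSec σ f s x ξ = s (f x) (ξ.comp (P.restrictEquiv σ f).toAddMonoidHom) := rfl

theorem IsSecAlong.restrictSec {m l : ℕ} {σ : C(Cube m, B)} {S : Set (Cube m)}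
    {s : Cube m → CircleMod (P.along σ)} (h : IsSecAlong G σ S s) (f : C(Cube l, Cube m))
    {R : Set (Cube l)} (hR : MapsTo f R S) :
    IsSecAlong G (σ.comp f) R (restrictSec σ f s) := by
  intro ξ
  have := (h (ξ.comp (P.restrictEquiv σ f).toAddMonoidHom)).comp f.continuous hR
  simp only [← Lattice.pull_comp] at this
  exact this

/-- Every functional is an integral combination of the coordinates of a basis, so a section with
values in `P ⊗ ℝ/ℤ` can be assembled from `k` sections of circle torsors. -/
theorem isSecAlong_circleModMk {m : ℕ} {σ : C(Cube m, B)} {S : Set (Cube m)}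
    (b : Module.Basis (Fin k) ℤ (P.along σ)) {s : Fin k → Cube m → UnitAddCircle}
    (h : ∀ j, IsSecOn (fun i => σ ⁻¹' cellStar i) (fun i t => P.pull σ (G i) t (coordHom b j)) S
      (s j)) : IsSecAlong G σ S (fun t => circleModMk b fun j => s j t) := by
  intro ξ i
  have h1 : ∀ t, circleModMk b (fun j => s j t) ξ - P.pull σ (G i) t ξ =
      ∑ j, ξ (b j) • (s j t - P.pull σ (G i) t (coordHom b j)) := fun t => by
    rw [circleMod_apply_eq_sum b (P.pull σ (G i) t), circleModMk_apply, ← Finset.sum_sub_distrib]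
    simp only [smul_sub]
  simp only [h1]
  exact continuousOn_finsetSum _ fun j _ => (continuous_zsmul _).comp_continuousOn (h j i)

/-- Continuity on a skeleton may be tested on the cells. Along a cell with section `t`, the
difference `G i - G j` is `(t - G j) - (t - G i)`, and both terms are continuous where the two stars
meet. -/
theorem ValidUpTo.contCircle (h : ValidUpTo G N) (i j : CellIdx B) :
    Lattice.ContCircle (fun b => G i b - G j b) (cellStar i ∩ cellStar j ∩ skel B N) := by
  intro F l
  rw [← inter_assoc]
  refine continuousOn_skel_of_forall_charMap
    (F.isOpen_dom.inter ((isOpen_cellStar i).inter (isOpen_cellStar j))) fun m hm e y hy => ?_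
  obtain ⟨t, ht⟩ := h m hm e
  obtain ⟨ξ, hξ⟩ := F.eventually_eq_pull (charMap e) hy.1 l
  have h1 := ((ht ξ j).mono (t := charMap e ⁻¹' (F.dom ∩ (cellStar i ∩ cellStar j)))
    fun z hz => ⟨trivial, hz.2.2⟩) y hy
  have h2 := ((ht ξ i).mono (t := charMap e ⁻¹' (F.dom ∩ (cellStar i ∩ cellStar j)))
    fun z hz => ⟨trivial, hz.2.1⟩) y hy
  refine (h1.sub h2).congr_of_eventuallyEq ?_ ?_
  · filter_upwards [hξ.filter_mono nhdsWithin_le_nhds] with z hz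
    rw [hz.2 fun b => G i b - G j b, Lattice.pull_sub]
    simp
  · rw [hξ.self_of_nhds.2 fun b => G i b - G j b, Lattice.pull_sub]
    simp

theorem ValidUpTo.isTwist (h : ValidUpTo G N) {m : ℕ} (σ : C(Cube m, B)) {S : Set (Cube m)}
    (hS : MapsTo σ S (skel B N)) (ξ : P.along σ →+ ℤ) :
    IsTwist (fun i => σ ⁻¹' cellStar i) (fun i t => P.pull σ (G i) t ξ) S where
  isOpen := isOpen_preimage_cellStar σ
  cover := iUnion_preimage_cellStar σ S
  cont i j := (h.contCircle i j).continuousOn_pull σ (fun _ ht => ⟨ht.2, hS ht.1⟩) ξ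

/-- Validity only speaks of the cells, but it makes the transition functions continuous on the
skeleton. The data thus pull back to a torsor over any singular cube in the skeleton, and that
torsor is trivial. -/
theorem ValidUpTo.exists_section (h : ValidUpTo G N) {m : ℕ} (σ : C(Cube m, B))
    (hσ : range σ ⊆ skel B N) : ∃ t, IsSecAlong G σ univ t := by
  have h1 := fun ξ => (h.isTwist σ (S := univ) (fun x _ => hσ (mem_range_self x))
    ξ).exists_section_cube
  choose s hs using h1
  exact ⟨_, isSecAlong_circleModMk (P.basisAlong σ) fun j => hs (coordHom (P.basisAlong σ) j)⟩

theorem ValidUpTo.exists_section_bdry (h : ValidUpTo G N) (hN : 3 ≤ N) (e : Cell B (N + 1)) :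
    ∃ t, IsSecAlong G (charMap e) (bdry (N + 1)) t := by
  have h1 := fun ξ => (h.isTwist (charMap e)
    (fun x hx => charMap_mem_skel_of_mem_bdry e hx) ξ).exists_section_bdry_of_le (by omega)
  choose s hs using h1
  exact ⟨_, isSecAlong_circleModMk (P.basisAlong (charMap e))
    fun j => hs (coordHom (P.basisAlong (charMap e)) j)⟩

open Classical in
/-- Sections over the boundaries of the `(N+1)`-cells extend a torsor to the `(N+1)`-skeleton. -/
theorem ValidUpTo.extend (h : ValidUpTo G N)
    {s : ∀ e : Cell B (N + 1), Cube (N + 1) → CircleMod (P.along (charMap e))}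
    (hs : ∀ e, IsSecAlong G (charMap e) (bdry (N + 1)) (s e)) :
    ∃ G' : P.TwistData, ValidUpTo G' (N + 1) ∧ (∀ b ∈ skel B N, ∀ i, G' i b = G i b) ∧
      ∀ e, IsSecAlong G' (charMap e) univ
        fun y => if y ∈ bdry (N + 1) then s e y else 0 := by
  -- Inside a new cell the fibres are identified with the group so that the section continuing `s e`
  -- becomes zero. The data of the other cells are therefore carried inwards along the rays, with
  -- the value of `s e` subtracted, and the datum of the new cell is zero.
  set val : ∀ (e : Cell B (N + 1)) (_ : Cube (N + 1)), CellIdx B → CircleMod (P.along (charMap e)) :=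
    fun e y i => if i = ⟨N + 1, e⟩ then 0 else
      P.pull (charMap e) (G i) (rad y) - s e (rad y) with hval
  -- Over an open cell the data are given in terms of the point `y` of the cube. Since `charMap e y
  -- = b` is only a propositional equality of base points, the values are compared by `HEq`.
  have h1 : ∀ b, ∃ v : CellIdx B → CircleMod (P.fiber b), (b ∈ skel B N → ∀ i, v i = G i b) ∧
      ∀ (e : Cell B (N + 1)) (y : Cube (N + 1)), y ∉ bdry (N + 1) → charMap e y = b →
        ∀ i, HEq (v i) (P.push (charMap e) y (val e y i)) := by
    intro b
    by_cases hb : b ∈ skel B N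
    · refine ⟨fun i => G i b, fun _ _ => rfl, ?_⟩
      rintro e y hy rfl
      have := (charMap_mem_skel_iff e hy).1 hb
      omega
    · by_cases he : ∃ (e : Cell B (N + 1)) (y : Cube (N + 1)), y ∉ bdry (N + 1) ∧ charMap e y = b
      · obtain ⟨e, y, hy, rfl⟩ := he
        refine ⟨fun i => P.push (charMap e) y (val e y i), fun h => (hb h).elim, ?_⟩
        intro e' y' hy' hee i
        have h2 : (⟨N + 1, e'⟩ : CellIdx B) = ⟨N + 1, e⟩ := eq_of_mem_openCell (b := charMap e y)
          (hee ▸ charMap_mem_openCell e' hy') (charMap_mem_openCell e hy)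
        obtain rfl : e' = e := by simpa using h2
        rw [charMap_injOn e' hy' hy hee]
      · exact ⟨fun _ => 0, fun h => (hb h).elim, fun e y hy h' => (he ⟨e, y, hy, h'⟩).elim⟩
  choose V hV₁ hV₂ using h1
  set G' : P.TwistData := fun i b => V b i with hG'
  have hpull : ∀ e (y : Cube (N + 1)), y ∉ bdry (N + 1) → ∀ i,
      P.pull (charMap e) (G' i) y = val e y i := fun e y hy i =>
    P.pull_of_eq_push _ (eq_of_heq (hV₂ _ e y hy rfl i))
  have hpull' : ∀ e (y : Cube (N + 1)), y ∈ bdry (N + 1) → ∀ i,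
      P.pull (charMap e) (G' i) y = P.pull (charMap e) (G i) y := fun e y hy i =>
    pull_congr (hV₁ _ (charMap_mem_skel_of_mem_bdry e hy) i)
  -- The function jumps from `s e` to `0` at the boundary, but each `G' i` with `i` another cell
  -- jumps by the same amount, and the star of the cell itself does not meet the boundary.
  have hsec : ∀ e, IsSecAlong G' (charMap e) univ
      fun y => if y ∈ bdry (N + 1) then s e y else 0 := by
    intro e ξ i
    by_cases hi : i = ⟨N + 1, e⟩
    · refine (continuousOn_const (c := (0 : UnitAddCircle))).congr fun y hy => ?_
      have hyb : y ∉ bdry (N + 1) := fun hb => by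
        refine not_mem_cellStar_self_of_mem_bdry e hb ?_
        rw [← hi]
        exact hy.2
      have hv : P.pull (charMap e) (G' i) y = 0 := (hpull e y hyb i).trans (if_pos hi)
      simp [hyb, hv]
    · have h3 : ContinuousOn (fun y => s e (rad y) ξ - P.pull (charMap e) (G i) (rad y) ξ)
          (univ ∩ charMap e ⁻¹' cellStar i) := by
        refine (hs e ξ i).comp (continuousOn_rad.mono fun y hy => ?_) fun y hy => ?_
        · exact (mapsTo_rad_cellStar e hi hy.2).1
        · exact (mapsTo_rad_cellStar e hi hy.2).2
      refine h3.congr fun y hy => ?_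
      by_cases hyb : y ∈ bdry (N + 1)
      · simp [hyb, hpull' e y hyb i, rad_of_mem_bdry hyb]
      · have hv := (hpull e y hyb i).trans (if_neg hi)
        simp [hyb, hv]
  have hagree : ∀ b ∈ skel B N, ∀ i, G' i b = G i b := fun b hb i => hV₁ b hb i
  refine ⟨G', fun m hm e => ?_, hagree, hsec⟩
  rcases Nat.lt_or_ge N m with hNm | hNm
  · obtain rfl : m = N + 1 := by omega
    exact ⟨_, hsec e⟩
  · exact h.congr_data hagree m hNm e

/-- Torsors over the `3`-skeleton extend. -/
theorem ValidUpTo.exists_extension (h : ValidUpTo G 3) :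
    ∃ G' : P.TwistData, (∀ N, ValidUpTo G' N) ∧ ∀ b ∈ skel B 3, ∀ i, G' i b = G i b := by
  have step : ∀ (N : ℕ) (H : {H : P.TwistData // ValidUpTo H (N + 3)}),
      ∃ H' : {H : P.TwistData // ValidUpTo H (N + 1 + 3)},
        ∀ b ∈ skel B (N + 3), ∀ i, H'.1 i b = H.1 i b := by
    rintro N ⟨H, hH⟩
    choose s hs using fun e => hH.exists_section_bdry (by omega) e
    obtain ⟨H', hH', hb, -⟩ := hH.extend hs
    exact ⟨⟨H', by rwa [show N + 1 + 3 = N + 3 + 1 by omega]⟩, hb⟩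
  choose next hnext using step
  -- Each extension leaves the data on the earlier skeleton unchanged, so at every point the
  -- sequence is eventually constant and its limit is valid on all skeleta.
  let seq : ∀ N, {H : P.TwistData // ValidUpTo H (N + 3)} := fun N => Nat.rec ⟨G, h⟩ next N
  have hseq : ∀ N M, N ≤ M → ∀ b ∈ skel B (N + 3), ∀ i, (seq M).1 i b = (seq N).1 i b := by
    intro N M hNM b hb i
    induction M, hNM using Nat.le_induction with
    | base => rfl
    | succ M hM ih =>
      rw [← ih]
      exact hnext M (seq M) b (skel_mono (by omega) hb) i
  have hdim : ∀ b : B, ∃ N, b ∈ skel B (N + 3) := fun b => by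
    obtain ⟨i, hi⟩ := exists_mem_openCell b
    exact ⟨i.1, (mem_skel_iff_of_mem_openCell hi).2 (by omega)⟩
  choose dim hd using hdim
  have hG' : ∀ N, ∀ b ∈ skel B (N + 3), ∀ i, (seq (dim b)).1 i b = (seq N).1 i b := by
    intro N b hb i
    rcases le_total N (dim b) with hle | hle
    · exact hseq N (dim b) hle b hb i
    · exact (hseq (dim b) N hle b (hd b) i).symm
  refine ⟨fun i b => (seq (dim b)).1 i b, fun N => ?_, fun b hb i => hG' 0 b hb i⟩
  exact ((seq N).2.congr_data (hG' N)).mono (by omega)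

end TwistData

end

section

/-! ### Edges and squares -/

/-- The end points of the edge `[-1, 1]`. -/
def pt (ε : Bool) : Cube 1 := fun _ => endpoint ε

/-- The vertices of the square. -/
def vtx (ε ε' : Bool) : Cube 2 := ![endpoint ε, endpoint ε']

theorem face_zero_pt (ε ε' : Bool) : face 0 ε (pt ε') = vtx ε ε' := by
  funext i; fin_cases i <;> rfl

theorem face_one_pt (ε ε' : Bool) : face 1 ε (pt ε') = vtx ε' ε := by
  funext i; fin_cases i <;> rfl

theorem face_zero_apply (ε : Bool) (x : Cube 1) : face 0 ε x = ![endpoint ε, x 0] := by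
  funext i; fin_cases i <;> rfl

theorem face_one_apply (ε : Bool) (x : Cube 1) : face 1 ε x = ![x 0, endpoint ε] := by
  funext i; fin_cases i <;> rfl

theorem face_zero_comp_face_zero (ε ε' : Bool) :
    (face (m := 2) 0 ε).comp (face 0 ε') = (face 1 ε').comp (face 0 ε) := by
  ext x i; fin_cases i <;> rfl

theorem face_zero_comp_face_one (ε ε' : Bool) :
    (face (m := 2) 0 ε).comp (face 1 ε') = (face 2 ε').comp (face 0 ε) := by
  ext x i; fin_cases i <;> rfl

theorem face_one_comp_face_one (ε ε' : Bool) :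
    (face (m := 2) 1 ε).comp (face 1 ε') = (face 2 ε').comp (face 1 ε) := by
  ext x i; fin_cases i <;> rfl

theorem exists_eq_pt {x : Cube 1} (hx : x ∈ bdry 1) : ∃ ε, x = pt ε := by
  obtain ⟨i, ε, h⟩ := hx
  refine ⟨ε, funext fun j => ?_⟩
  rw [Subsingleton.elim j i, h]; rfl

/-- The signed sum over the four edges of a square. -/
def squareSum {A : Type*} [AddCommGroup A] (φ : Fin 2 → Bool → A) : A :=
  (φ 0 true - φ 0 false) - (φ 1 true - φ 1 false)

/-- The sum of the signed sums over the faces of a cube vanishes. -/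
theorem squareSum_faces {A : Type*} [AddCommGroup A] (φ : C(Cube 1, Cube 3) → A) :
    (squareSum (fun j ε => φ ((face 0 true).comp (face j ε))) -
      squareSum (fun j ε => φ ((face 0 false).comp (face j ε)))) -
    (squareSum (fun j ε => φ ((face 1 true).comp (face j ε))) -
      squareSum (fun j ε => φ ((face 1 false).comp (face j ε)))) +
    (squareSum (fun j ε => φ ((face 2 true).comp (face j ε))) -
      squareSum (fun j ε => φ ((face 2 false).comp (face j ε)))) = 0 := by
  -- After the identification of iterated faces, the 24 terms are the twelve edges of the cube, each
  -- occurring twice with opposite signs.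
  simp only [squareSum, face_zero_comp_face_zero, face_zero_comp_face_one, face_one_comp_face_one]
  abel

open Classical in
/-- The increment of a lift to `ℝ` of a path in the circle. -/
def inc (f : Cube 1 → UnitAddCircle) : ℝ :=
  if h : ∃ L : Cube 1 → ℝ, Continuous L ∧ ∀ x, (L x : UnitAddCircle) = f x then
    h.choose (pt true) - h.choose (pt false) else 0

theorem inc_eq {f : Cube 1 → UnitAddCircle} {L : Cube 1 → ℝ} (hL : Continuous L)
    (h : ∀ x, (L x : UnitAddCircle) = f x) : inc f = L (pt true) - L (pt false) := by
  have hex : ∃ L : Cube 1 → ℝ, Continuous L ∧ ∀ x, (L x : UnitAddCircle) = f x := ⟨L, hL, h⟩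
  rw [inc, dif_pos hex]
  have h1 := hex.choose_spec
  have h2 := eq_of_isPreconnected_of_int (isPreconnected_univ_cube (m := 1))
    (h1.1.sub hL).continuousOn (fun y _ => circle_coe_eq_coe_iff.1 ((h1.2 y).trans (h y).symm))
    (mem_univ (pt true)) (mem_univ (pt false))
  simp only [Pi.sub_apply] at h2
  linarith

theorem coe_inc {f : Cube 1 → UnitAddCircle} (hf : Continuous f) :
    (inc f : UnitAddCircle) = f (pt true) - f (pt false) := by
  obtain ⟨L, hL, h⟩ := exists_circle_lift_cube hf
  rw [inc_eq hL h, AddCircle.coe_sub, h, h]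

theorem inc_add {f g : Cube 1 → UnitAddCircle} (hf : Continuous f) (hg : Continuous g) :
    inc (fun x => f x + g x) = inc f + inc g := by
  obtain ⟨L, hL, h⟩ := exists_circle_lift_cube hf
  obtain ⟨M, hM, h'⟩ := exists_circle_lift_cube hg
  rw [inc_eq hL h, inc_eq hM h', inc_eq (hL.add hM) fun x => by
    rw [← h, ← h']; exact AddCircle.coe_add ..]
  simp only [Pi.add_apply]
  ring

theorem inc_sub {f g : Cube 1 → UnitAddCircle} (hf : Continuous f) (hg : Continuous g) :
    inc (fun x => f x - g x) = inc f - inc g := by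
  rw [eq_sub_iff_add_eq]
  refine (inc_add (f := fun x => f x - g x) (hf.sub hg) hg).symm.trans ?_
  simp

theorem inc_of_forall_eq {f : Cube 1 → UnitAddCircle} (h : ∀ x y, f x = f y) : inc f = 0 := by
  obtain ⟨a, ha⟩ := QuotientAddGroup.mk_surjective (f (pt true))
  rw [inc_eq (L := fun _ => a) continuous_const fun x => (ha.trans (h (pt true) x)), sub_self]

/-- A lift of `d` over the whole square computes all four increments, and its values at the vertices
cancel. -/
theorem squareSum_inc {d : Cube 2 → UnitAddCircle} (hd : Continuous d) :
    squareSum (fun i ε => inc fun x => d (face i ε x)) = 0 := by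
  obtain ⟨L, hL, h⟩ := exists_circle_lift_cube hd
  have h1 : ∀ i ε, inc (fun x => d (face i ε x)) =
      L (face i ε (pt true)) - L (face i ε (pt false)) := fun i ε =>
    inc_eq (L := fun x => L (face i ε x)) (hL.comp (face i ε).continuous) fun x => h _
  simp only [squareSum, h1, face_zero_pt, face_one_pt]
  ring

/-- Lift separately over the three sides in `openBox 1` and over the last side. Vanishing of the
winding number says that the two lifts differ by the same amount at both ends of the last side, as
`exists_circle_lift_bdry` requires. -/
theorem exists_lift_of_squareSum_inc {d : Cube 2 → UnitAddCircle} (hd : ContinuousOn d (bdry 2))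
    (h : squareSum (fun i ε => inc fun x => d (face i ε x)) = 0) :
    ∃ e : Cube 2 → ℝ, Continuous e ∧ ∀ x ∈ bdry 2, (e x : UnitAddCircle) = d x := by
  refine exists_circle_lift_bdry hd fun L₁ L₂ h₁ hL₁ h₂ hL₂ => ?_
  have hface : ∀ i ε, (∀ x, face i ε x ∈ openBox 1) → inc (fun x => d (face i ε x)) =
      L₁ (face i ε (pt true)) - L₁ (face i ε (pt false)) := fun i ε hm =>
    inc_eq (L := fun x => L₁ (face i ε x))
      (h₁.comp_continuous (face i ε).continuous hm) fun x => hL₁ _ (hm x)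
  have h0 : ∀ ε x, face (m := 1) 0 ε x ∈ openBox 1 := fun ε x => by
    rw [face_zero_apply]
    exact Or.inl ⟨0, ε, rfl⟩
  have h1 : ∀ x, face (m := 1) 1 false x ∈ openBox 1 := fun x => by
    rw [face_one_apply]
    exact Or.inr rfl
  have hlast : inc (fun x => d (face 1 true x)) = L₂ (pt true) - L₂ (pt false) :=
    inc_eq h₂ hL₂
  rw [squareSum, hface 0 true (h0 _), hface 0 false (h0 _), hface 1 false h1, hlast] at h
  simp only [face_zero_pt, face_one_pt] at h
  have key : ∀ ε, L₁ (face (Fin.last 1) true (pt ε)) - L₂ (pt ε) =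
      L₁ (vtx true true) - L₂ (pt true) := by
    intro ε
    have : face (Fin.last 1) true (pt ε) = vtx ε true := face_one_pt true ε
    rw [this]
    cases ε
    · linarith
    · rfl
  intro x hx y hy
  obtain ⟨ε, rfl⟩ := exists_eq_pt hx
  obtain ⟨ε', rfl⟩ := exists_eq_pt hy
  rw [key, key]

end

section

/-! ### The obstruction cocycle of a torsor over the 2-skeleton -/

section Obstruction

variable {n : ℕ} {B : Type u} [TopologicalSpace B] [ChartedSpace (Eucl n) B]
  [IsManifold 𝓘(ℝ, Eucl n) ∞ B] {k : ℕ} {P : Lattice n B k}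

/-- Along a constant cube, sections of `P` are constant, since the fibre is discrete. This lets the
zero function serve as a section of the torsor along constant paths. -/
theorem Lattice.ev_const (b : B) {m : ℕ} (x y : Cube m) (a : P.along (.const (Cube m) b)) :
    @Eq (Cot (n := n) b) (a.val x) (a.val y) := by
  refine P.eq_of_eq_at (f := fun _ : Cube m => b) (a := a.val)
    (b := fun _ => a.val y) isPreconnected_univ_cube
    (Lattice.along_continuous a).continuousOn continuousOn_const
    (fun s _ => sub_mem (Lattice.along_val_mem a s) (Lattice.along_val_mem a y)) (mem_univ y)
    (mem_univ x) rfl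

theorem Lattice.pull_const (g : ∀ b, CircleMod (P.fiber b)) (b : B) {m : ℕ} (x y : Cube m) :
    P.pull (.const (Cube m) b) g x = P.pull (.const (Cube m) b) g y := by
  have h : P.ev (.const (Cube m) b) x = P.ev (.const (Cube m) b) y :=
    AddEquiv.ext fun a => Subtype.ext (Lattice.ev_const b x y a)
  ext ξ
  rw [Lattice.pull_apply, Lattice.pull_apply, h]
  rfl

variable (P) in
/-- The restriction of integral duals along an isomorphism given by restriction. -/
def Lattice.dualRestrict {m l : ℕ} (σ : C(Cube m, B)) (f : C(Cube l, Cube m))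
    (ξ : P.along σ →+ ℤ) : P.along (σ.comp f) →+ ℤ :=
  ξ.comp (P.restrictEquiv σ f).symm.toAddMonoidHom

theorem Lattice.dualRestrict_add {m l : ℕ} (σ : C(Cube m, B)) (f : C(Cube l, Cube m))
    (ξ η : P.along σ →+ ℤ) :
    P.dualRestrict σ f (ξ + η) = P.dualRestrict σ f ξ + P.dualRestrict σ f η := rfl

theorem Lattice.dualRestrict_restrict {m l : ℕ} (σ : C(Cube m, B)) (f : C(Cube l, Cube m))
    (ξ : P.along σ →+ ℤ) (a : P.along σ) : P.dualRestrict σ f ξ (P.restrict f a) = ξ a := by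
  change ξ ((P.restrictEquiv σ f).symm (P.restrictEquiv σ f a)) = ξ a
  rw [AddEquiv.symm_apply_apply]

theorem Lattice.dualRestrict_comp_restrictEquiv {m l : ℕ} (σ : C(Cube m, B))
    (f : C(Cube l, Cube m)) (ξ : P.along σ →+ ℤ) :
    (P.dualRestrict σ f ξ).comp (P.restrictEquiv σ f).toAddMonoidHom = ξ :=
  AddMonoidHom.ext fun a => Lattice.dualRestrict_restrict σ f ξ a

theorem Lattice.dualRestrict_comp {m l r : ℕ} (σ : C(Cube m, B)) (f : C(Cube l, Cube m))
    (g : C(Cube r, Cube l)) (ξ : P.along σ →+ ℤ) :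
    P.dualRestrict σ (f.comp g) ξ = P.dualRestrict (σ.comp f) g (P.dualRestrict σ f ξ) := by
  ext p
  obtain ⟨a, rfl⟩ := (P.restrictEquiv σ (f.comp g)).surjective p
  rw [Lattice.restrictEquiv_apply, Lattice.dualRestrict_restrict]
  have : P.restrict (f.comp g) a = P.restrict (σ := σ.comp f) g (P.restrict f a) := rfl
  rw [this]
  exact ((Lattice.dualRestrict_restrict (σ.comp f) g _ _).trans
    (Lattice.dualRestrict_restrict σ f ξ a)).symm

variable [T2Space B] [CWComplex (univ : Set B)]

/-- `t` is a section of the circle torsor that is associated with `G` and `ξ`. -/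
def IsCircleSec (G : P.TwistData) {m : ℕ} (σ : C(Cube m, B)) (ξ : P.along σ →+ ℤ)
    (S : Set (Cube m)) (t : Cube m → UnitAddCircle) : Prop :=
  IsSecOn (fun i => σ ⁻¹' cellStar i) (fun i x => P.pull σ (G i) x ξ) S t

variable {G : P.TwistData}

theorem IsCircleSec.comp {m l : ℕ} {σ : C(Cube m, B)} {ξ : P.along σ →+ ℤ}
    {S : Set (Cube m)} {t : Cube m → UnitAddCircle} (h : IsCircleSec G σ ξ S t)
    (f : C(Cube l, Cube m)) {R : Set (Cube l)} (hR : MapsTo f R S) :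
    IsCircleSec G (σ.comp f) (P.dualRestrict σ f ξ) R fun x => t (f x) := by
  have h1 := IsSecOn.comp h f.continuous hR
  intro i
  refine (h1 i).congr fun x _ => ?_
  simp only [Lattice.pull_comp, Lattice.dualRestrict_comp_restrictEquiv]

theorem IsCircleSec.continuousOn_sub {m : ℕ} {σ : C(Cube m, B)} {ξ : P.along σ →+ ℤ}
    {S : Set (Cube m)} {t t' : Cube m → UnitAddCircle} (h : IsCircleSec G σ ξ S t)
    (h' : IsCircleSec G σ ξ S t') : ContinuousOn (fun x => t x - t' x) S :=
  IsSecOn.continuousOn_sub (isOpen_preimage_cellStar σ) (iUnion_preimage_cellStar σ S) h h'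

/-- A choice of sections of the torsor along all paths in the `2`-skeleton. -/
structure EdgeSections (G : P.TwistData) (s : ∀ l : C(Cube 1, B), Cube 1 → CircleMod (P.along l)) :
    Prop where
  isSec : ∀ l : C(Cube 1, B), range l ⊆ skel B 2 → IsSecAlong G l univ (s l)
  ends : ∀ l ε, s l (pt ε) = 0
  of_skel : ∀ l : C(Cube 1, B), range l ⊆ skel B 1 → ∀ x, s l x = 0
  of_const : ∀ l : C(Cube 1, B), (∀ x y, l x = l y) → ∀ x, s l x = 0

/-- Zero is a section along paths in the `1`-skeleton, where `G` vanishes, and along constant paths,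
where every function involved is constant. Along other paths any section can be modified by a real
function so that it vanishes at both ends. These normalizations make the windings integral and the
resulting cochain relative and normalized. -/
theorem ValidUpTo.exists_edgeSections (h : ValidUpTo G 2) (hG : ∀ b ∈ skel B 1, ∀ i, G i b = 0) :
    ∃ s, EdgeSections G s := by
  have key : ∀ l : C(Cube 1, B), ∃ s : Cube 1 → CircleMod (P.along l),
      (range l ⊆ skel B 2 → IsSecAlong G l univ s) ∧ (∀ ε, s (pt ε) = 0) ∧
        (range l ⊆ skel B 1 → ∀ x, s x = 0) ∧ ((∀ x y, l x = l y) → ∀ x, s x = 0) := by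
    intro l
    by_cases h1 : range l ⊆ skel B 1
    · refine ⟨fun _ => 0, fun _ ξ i => ?_, fun _ => rfl, fun _ _ => rfl, fun _ _ => rfl⟩
      refine (continuousOn_const (c := (0 : UnitAddCircle))).congr fun x _ => ?_
      simp only [Lattice.pull_apply, hG (l x) (h1 (mem_range_self x)) i]
      simp
    by_cases h2 : ∀ x y, l x = l y
    · refine ⟨fun _ => 0, fun _ ξ i => ?_, fun _ => rfl, fun _ _ => rfl, fun _ _ => rfl⟩
      obtain ⟨b, rfl⟩ : ∃ b, l = .const _ b := ⟨l (pt true), ContinuousMap.ext fun x => h2 _ _⟩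
      refine (continuousOn_const (c := 0 - P.pull _ (G i) (pt true) ξ)).congr fun x _ => ?_
      change 0 - P.pull _ (G i) x ξ = _
      rw [Lattice.pull_const (G i) b x (pt true)]
    by_cases h3 : range l ⊆ skel B 2
    · obtain ⟨t, ht⟩ := h.exists_section l h3
      choose r hr using fun ε j => QuotientAddGroup.mk_surjective
        (t (pt ε) (coordHom (P.basisAlong l) j))
      -- Affine interpolation between real representatives `r false j` and `r true j` of the
      -- coordinates of `t` at the ends; subtracting it makes the section zero there.
      set L : Fin k → Cube 1 → ℝ := fun j x =>
        (1 + (x 0 : ℝ)) / 2 * r true j + (1 - (x 0 : ℝ)) / 2 * r false j with hL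
      have hLc : ∀ j, Continuous (L j) := fun j => by simp only [hL]; fun_prop
      refine ⟨fun x => circleModMk (P.basisAlong l) fun j =>
        t x (coordHom (P.basisAlong l) j) + (-(L j x) : ℝ), fun _ => ?_, fun ε => ?_,
        fun h => (h1 h).elim, fun h => (h2 h).elim⟩
      · exact isSecAlong_circleModMk (P.basisAlong l) fun j =>
          (ht (coordHom (P.basisAlong l) j)).add_continuousOn
            (continuous_circle_coe (hLc j).neg).continuousOn
      · have hLe : ∀ j, L j (pt ε) = r ε j := fun j => by
          cases ε <;> simp [hL, pt]
        ext ξ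
        rw [circleModMk_apply]
        refine Finset.sum_eq_zero fun j _ => ?_
        rw [hLe, ← hr ε j]
        change ξ _ • ((r ε j : UnitAddCircle) + ((-r ε j : ℝ) : UnitAddCircle)) = 0
        rw [← AddCircle.coe_add, add_neg_cancel, AddCircle.coe_zero, smul_zero]
    · exact ⟨fun _ => 0, fun h => (h3 h).elim, fun _ => rfl, fun _ _ => rfl, fun _ _ => rfl⟩
  choose s a b c d using key
  exact ⟨s, a, b, c, d⟩

variable {s : ∀ l : C(Cube 1, B), Cube 1 → CircleMod (P.along l)}

/-- The winding along an edge of the chosen section relative to the section `t`. -/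
def edgeInc (s : ∀ l : C(Cube 1, B), Cube 1 → CircleMod (P.along l)) {m : ℕ} (σ : C(Cube m, B))
    (ξ : P.along σ →+ ℤ) (t : Cube m → UnitAddCircle) (f : C(Cube 1, Cube m)) : ℝ :=
  inc fun x => s (σ.comp f) x (P.dualRestrict σ f ξ) - t (f x)

/-- The winding along the boundary of a square of the chosen sections relative to the section
`t`. -/
def winding (s : ∀ l : C(Cube 1, B), Cube 1 → CircleMod (P.along l)) (σ : C(Cube 2, B))
    (ξ : P.along σ →+ ℤ) (t : Cube 2 → UnitAddCircle) : ℝ :=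
  squareSum fun i ε => edgeInc s σ ξ t (face i ε)

theorem EdgeSections.continuous_edge (hs : EdgeSections G s) {m : ℕ} {σ : C(Cube m, B)}
    {ξ : P.along σ →+ ℤ} {S : Set (Cube m)} {t : Cube m → UnitAddCircle}
    (ht : IsCircleSec G σ ξ S t) {f : C(Cube 1, Cube m)} (hf : ∀ x, f x ∈ S)
    (hσ : range (σ.comp f) ⊆ skel B 2) :
    Continuous fun x => s (σ.comp f) x (P.dualRestrict σ f ξ) - t (f x) := by
  rw [← continuousOn_univ]
  exact IsCircleSec.continuousOn_sub (hs.isSec _ hσ (P.dualRestrict σ f ξ))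
    (ht.comp f fun x _ => hf x)

theorem edgeInc_comp {m l : ℕ} (σ : C(Cube m, B)) (ξ : P.along σ →+ ℤ)
    (t : Cube m → UnitAddCircle) (g : C(Cube l, Cube m)) (f : C(Cube 1, Cube l)) :
    edgeInc s (σ.comp g) (P.dualRestrict σ g ξ) (fun x => t (g x)) f =
      edgeInc s σ ξ t (g.comp f) := by
  unfold edgeInc
  rw [Lattice.dualRestrict_comp]
  rfl

theorem range_comp_subset {m l : ℕ} {σ : C(Cube m, B)} {A : Set B} (h : range σ ⊆ A)
    (f : C(Cube l, Cube m)) : range (σ.comp f) ⊆ A := by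
  rintro _ ⟨x, rfl⟩
  exact h (mem_range_self _)

theorem EdgeSections.edgeInc_sub (hs : EdgeSections G s) {m : ℕ} {σ : C(Cube m, B)}
    {ξ : P.along σ →+ ℤ} {S S' : Set (Cube m)} {t t' : Cube m → UnitAddCircle}
    (ht : IsCircleSec G σ ξ S t) (ht' : IsCircleSec G σ ξ S' t') {f : C(Cube 1, Cube m)}
    (hf : ∀ x, f x ∈ S) (hf' : ∀ x, f x ∈ S') (hσ : range (σ.comp f) ⊆ skel B 2) :
    edgeInc s σ ξ t' f - edgeInc s σ ξ t f = inc fun x => t (f x) - t' (f x) := by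
  rw [edgeInc, edgeInc, ← inc_sub (hs.continuous_edge ht' hf' hσ) (hs.continuous_edge ht hf hσ)]
  congr 1
  ext x
  abel

/-- Two sections over the square differ by a function that is continuous on the whole square, and
such a function has winding number zero around the boundary. -/
theorem EdgeSections.winding_eq (hs : EdgeSections G s) {σ : C(Cube 2, B)}
    (hσ : range σ ⊆ skel B 2) {ξ : P.along σ →+ ℤ} {t t' : Cube 2 → UnitAddCircle}
    (ht : IsCircleSec G σ ξ univ t) (ht' : IsCircleSec G σ ξ univ t') :
    winding s σ ξ t' = winding s σ ξ t := by
  have h1 : ∀ i ε, edgeInc s σ ξ t' (face i ε) - edgeInc s σ ξ t (face i ε) =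
      inc fun x => t (face i ε x) - t' (face i ε x) := fun i ε =>
    hs.edgeInc_sub ht ht' (fun _ => mem_univ _) (fun _ => mem_univ _) (range_comp_subset hσ _)
  have h2 := squareSum_inc (d := fun x => t x - t' x)
    (continuousOn_univ.1 (ht.continuousOn_sub ht'))
  simp only [squareSum, ← h1] at h2
  simp only [winding, squareSum]
  linarith

/-- Modulo `ℤ` only the values at the vertices matter. The edge sections are zero there and the
values of `t` cancel around the square. -/
theorem EdgeSections.exists_winding_eq (hs : EdgeSections G s) {σ : C(Cube 2, B)}
    (hσ : range σ ⊆ skel B 2) {ξ : P.along σ →+ ℤ} {t : Cube 2 → UnitAddCircle}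
    (ht : IsCircleSec G σ ξ univ t) : ∃ z : ℤ, winding s σ ξ t = z := by
  have h1 : ∀ i ε, (edgeInc s σ ξ t (face i ε) : UnitAddCircle) =
      t (face i ε (pt false)) - t (face i ε (pt true)) := fun i ε => by
    rw [edgeInc, coe_inc (hs.continuous_edge ht (fun _ => mem_univ _) (range_comp_subset hσ _)),
      hs.ends, hs.ends, AddMonoidHom.zero_apply]
    abel
  have h2 : (winding s σ ξ t : UnitAddCircle) = ((0 : ℝ) : UnitAddCircle) := by
    simp only [winding, squareSum, AddCircle.coe_sub, h1, face_zero_pt, face_one_pt,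
      AddCircle.coe_zero]
    abel
  obtain ⟨z, hz⟩ := circle_coe_eq_coe_iff.1 h2
  exact ⟨z, by rw [← hz, sub_zero]⟩

theorem EdgeSections.winding_add (hs : EdgeSections G s) {σ : C(Cube 2, B)}
    (hσ : range σ ⊆ skel B 2) {ξ η : P.along σ →+ ℤ} {t t' : Cube 2 → UnitAddCircle}
    (ht : IsCircleSec G σ ξ univ t) (ht' : IsCircleSec G σ η univ t') :
    winding s σ (ξ + η) (fun x => t x + t' x) = winding s σ ξ t + winding s σ η t' := by
  have h1 : ∀ i ε, edgeInc s σ (ξ + η) (fun x => t x + t' x) (face i ε) =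
      edgeInc s σ ξ t (face i ε) + edgeInc s σ η t' (face i ε) := fun i ε => by
    rw [edgeInc, edgeInc, edgeInc, ← inc_add
      (hs.continuous_edge ht (fun _ => mem_univ _) (range_comp_subset hσ _))
      (hs.continuous_edge ht' (fun _ => mem_univ _) (range_comp_subset hσ _))]
    congr 1
    ext x
    rw [Lattice.dualRestrict_add, map_add]
    abel
  simp only [winding, squareSum, h1]
  ring

/-- `u` is the obstruction cochain for the extension of the torsor to the `3`-cells. -/
def IsWindingCochain (G : P.TwistData) (s : ∀ l : C(Cube 1, B), Cube 1 → CircleMod (P.along l))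
    (u : P.Cochain 2) : Prop :=
  ∀ σ : C(Cube 2, B), range σ ⊆ skel B 2 → ∀ (ξ : P.along σ →+ ℤ) (t : Cube 2 → UnitAddCircle),
    IsCircleSec G σ ξ univ t → (ξ (u σ) : ℝ) = winding s σ ξ t

/-- The winding number is an integer that depends additively on `ξ` and not on the section `t`, so
it is an element of the double dual of `P.along σ`, that is, of `P.along σ` itself. -/
theorem EdgeSections.exists_cochain (hs : EdgeSections G s) (hG : ValidUpTo G 2) :
    ∃ u : P.Cochain 2, IsWindingCochain G s u := by
  have key : ∀ σ : C(Cube 2, B), ∃ a : P.along σ, range σ ⊆ skel B 2 → ∀ ξ t,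
      IsCircleSec G σ ξ univ t → (ξ a : ℝ) = winding s σ ξ t := by
    intro σ
    by_cases hσ : range σ ⊆ skel B 2
    · obtain ⟨t, ht⟩ := hG.exists_section σ hσ
      choose z hz using fun ξ => hs.exists_winding_eq hσ (ht ξ)
      have hadd : ∀ ξ η, z (ξ + η) = z ξ + z η := fun ξ η => by
        have := hs.winding_add hσ (ht ξ) (ht η)
        have h2 : (fun x => t x ξ + t x η) = fun x => t x (ξ + η) := by
          ext x; rw [map_add]
        rw [h2, hz, hz, hz] at this
        exact_mod_cast this
      obtain ⟨a, ha⟩ := exists_forall_intDual_eq (P.basisAlong σ) (AddMonoidHom.mk' z hadd)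
      refine ⟨a, fun _ ξ t' ht' => ?_⟩
      rw [ha, hs.winding_eq hσ (ht ξ) ht', hz]
      rfl
    · exact ⟨0, fun h => (hσ h).elim⟩
  choose u hu using key
  exact ⟨u, hu⟩

theorem isCircleSec_zero (hG : ∀ b ∈ skel B 1, ∀ i, G i b = 0) {m : ℕ} {σ : C(Cube m, B)}
    (hσ : range σ ⊆ skel B 1) (ξ : P.along σ →+ ℤ) : IsCircleSec G σ ξ univ fun _ => 0 := by
  intro i
  refine (continuousOn_const (c := (0 : UnitAddCircle))).congr fun x _ => ?_
  simp only [Lattice.pull_apply, hG (σ x) (hσ (mem_range_self x)) i]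
  simp

/-- Omitting the coordinate `i`. -/
def dropCoord {m : ℕ} (i : Fin (m + 1)) : C(Cube (m + 1), Cube m) where
  toFun x j := x (i.succAbove j)
  continuous_toFun := by fun_prop

theorem dropCoord_face_self {m : ℕ} (i : Fin (m + 1)) (ε : Bool) (x : Cube m) :
    dropCoord i (face i ε x) = x := by
  funext j
  simp [dropCoord, face]

theorem exists_eq_comp_dropCoord {m : ℕ} {σ : C(Cube (m + 1), B)} (h : IsDegenerate σ) :
    ∃ i, ∃ l : C(Cube m, B), σ = l.comp (dropCoord i) := by
  obtain ⟨i, hi⟩ := h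
  refine ⟨i, σ.comp (face i true), ContinuousMap.ext fun x => hi _ _ fun j hj => ?_⟩
  obtain ⟨j, rfl⟩ := Fin.exists_succAbove_eq hj
  simp [dropCoord, face]

theorem eq_zero_of_forall_intDual {m : ℕ} {σ : C(Cube m, B)} {a : P.along σ}
    (h : ∀ ξ : P.along σ →+ ℤ, (ξ a : ℝ) = 0) : a = 0 :=
  eq_of_forall_intDual (P.basisAlong σ) fun ξ => by
    rw [map_zero]; exact_mod_cast h ξ

/-- The obstruction cochain is a relative cocycle. -/
theorem EdgeSections.mem_relCocycles (hs : EdgeSections G s) (hG : ValidUpTo G 2)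
    (hG₁ : ∀ b ∈ skel B 1, ∀ i, G i b = 0) {u : P.Cochain 2}
    (hu : IsWindingCochain G s u) : u ∈ P.relCocycles (skel B 2) (skel B 1) 2 := by
  refine ⟨fun σ hσ => eq_zero_of_forall_intDual fun ξ => ?_,
    fun σ hσ hd => eq_zero_of_forall_intDual fun ξ => ?_, fun τ hτ => ?_⟩
  · rw [hu σ (hσ.trans (skel_mono (by omega))) ξ _ (isCircleSec_zero hG₁ hσ ξ)]
    have h1 : ∀ i ε, edgeInc s σ ξ (fun _ => 0) (face i ε) = 0 := fun i ε =>
      inc_of_forall_eq fun x y => by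
        rw [hs.of_skel _ (range_comp_subset hσ _), hs.of_skel _ (range_comp_subset hσ _)]
    simp [winding, squareSum, h1]
  · obtain ⟨i, l, rfl⟩ := exists_eq_comp_dropCoord hd
    have hl : range l ⊆ skel B 2 := by
      rintro _ ⟨x, rfl⟩
      refine hσ ⟨face i true x, ?_⟩
      rw [ContinuousMap.comp_apply, dropCoord_face_self]
    -- For a degenerate square the winding may be measured against the chosen section along `l`,
    -- pulled back to the square. The two faces that project isomorphically to `l` then contribute
    -- zero, and the other two are constant paths.
    rw [hu _ hσ ξ _ (((hs.isSec l hl).restrictSec (dropCoord i) (mapsTo_univ _ _)) ξ)]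
    have h1 : ∀ ε, edgeInc s (l.comp (dropCoord i)) ξ
        (fun x => restrictSec l (dropCoord i) (s l) x ξ) (face i ε) = 0 := fun ε => by
      refine inc_of_forall_eq fun x y => ?_
      have h2 : ∀ x, s ((l.comp (dropCoord i)).comp (face i ε)) x
          (P.dualRestrict (l.comp (dropCoord i)) (face i ε) ξ) -
            restrictSec l (dropCoord i) (s l) (face i ε x) ξ = 0 := by
        intro x
        have h3 : (dropCoord i).comp (face i ε) = ContinuousMap.id _ :=
          ContinuousMap.ext fun x => dropCoord_face_self i ε x
        rw [restrictSec_apply, dropCoord_face_self, sub_eq_zero]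
        -- The type of `s (l.comp f)` depends on `f`, so the equation `f = id` is eliminated for a
        -- variable `f`.
        have h4 : ∀ (f : C(Cube 1, Cube 1)), f = ContinuousMap.id _ →
            ∀ η : P.along (l.comp f) →+ ℤ, s (l.comp f) x η = s l x
              (η.comp (P.restrictEquiv l f).toAddMonoidHom) := by
          rintro f rfl η
          rfl
        refine (h4 _ h3 (P.dualRestrict (l.comp (dropCoord i)) (face i ε) ξ)).trans ?_
        congr 1
        ext a
        exact Lattice.dualRestrict_restrict (l.comp (dropCoord i)) (face i ε) ξ
          (P.restrict (dropCoord i) a)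
      rw [h2, h2]
    have h2 : ∀ j, j ≠ i → ∀ ε, edgeInc s (l.comp (dropCoord i)) ξ
        (fun x => restrictSec l (dropCoord i) (s l) x ξ) (face j ε) = 0 := fun j hj ε => by
      have h3 : ∀ x y : Cube 1, dropCoord i (face j ε x) = dropCoord i (face j ε y) := by
        intro x y
        funext r
        rw [Subsingleton.elim r 0]
        have h4 : i.succAbove 0 = j := by
          fin_cases i <;> fin_cases j <;> first | rfl | exact (hj rfl).elim
        simp [dropCoord, face, h4]
      refine inc_of_forall_eq fun x y => ?_
      change s _ x _ - restrictSec _ _ (s l) (face j ε x) ξ =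
        s _ y _ - restrictSec _ _ (s l) (face j ε y) ξ
      have h5 := hs.of_const ((l.comp (dropCoord i)).comp (face j ε))
        fun x y => congrArg l (h3 x y)
      rw [restrictSec_apply, restrictSec_apply, h3 x y, h5 x, h5 y]
    have h3 : ∀ j ε, edgeInc s (l.comp (dropCoord i)) ξ
        (fun x => restrictSec l (dropCoord i) (s l) x ξ) (face j ε) = 0 := fun j ε => by
      rcases eq_or_ne j i with rfl | hj
      exacts [h1 ε, h2 j hj ε]
    simp [winding, squareSum, h3]
  · refine ⟨fun i ε => (P.restrictEquiv τ (face i ε)).symm (u (τ.comp (face i ε))),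
      fun i ε => (P.restrictEquiv τ (face i ε)).apply_symm_apply _, ?_⟩
    refine (eq_zero_of_forall_intDual fun ξ => ?_).symm
    -- One section over the whole `3`-cube computes the windings of all six faces, so the coboundary
    -- vanishes by cancellation along the edges.
    obtain ⟨t, ht⟩ := hG.exists_section τ hτ
    have h1 : ∀ i ε, (ξ ((P.restrictEquiv τ (face i ε)).symm (u (τ.comp (face i ε)))) : ℝ) =
        squareSum fun j ε' => edgeInc s τ ξ (fun x => t x ξ) ((face i ε).comp (face j ε')) := by
      intro i ε
      refine (hu (τ.comp (face i ε)) (range_comp_subset hτ _) (P.dualRestrict τ (face i ε) ξ) _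
        (IsCircleSec.comp (ht ξ) (face i ε) (mapsTo_univ _ _))).trans ?_
      exact congrArg squareSum (funext fun j => funext fun ε' =>
        edgeInc_comp τ ξ (fun x => t x ξ) (face i ε) (face j ε'))
    have h2 := squareSum_faces fun f => edgeInc s τ ξ (fun x => t x ξ) f
    simp only [← h1] at h2
    refine (congrArg (fun a => (ξ a : ℝ)) (Fin.sum_univ_three _)).trans ?_
    simp only [map_add, map_sub, map_zsmul, smul_eq_mul]
    simp
    linarith

/-- If the obstruction cochain is a cocycle, then the torsor extends to the `3`-skeleton. -/
theorem EdgeSections.exists_section_bdry (hs : EdgeSections G s) (hG : ValidUpTo G 2)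
    {u : P.Cochain 2}
    (hu : IsWindingCochain G s u) (e : Cell B 3)
    (he : Lattice.IsCoboundaryOn u (charMap e) 0) :
    ∃ t, IsSecAlong G (charMap e) (bdry 3) t := by
  obtain ⟨p, hp, hsum⟩ := he
  have key : ∀ ξ : P.along (charMap e) →+ ℤ, ∃ t, IsCircleSec G (charMap e) ξ (bdry 3) t := by
    intro ξ
    have hface : ∀ i ε, range ((charMap e).comp (face i ε)) ⊆ skel B 2 := by
      rintro i ε _ ⟨x, rfl⟩
      exact charMap_mem_skel_of_mem_bdry e (face_mem_bdry i ε x)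
    refine (hG.isTwist (charMap e)
      (fun x hx => charMap_mem_skel_of_mem_bdry e hx) ξ).exists_section_bdry fun t s' ht hs' => ?_
    have hs'' : IsCircleSec G ((charMap e).comp (face 2 true))
        (P.dualRestrict (charMap e) (face 2 true) ξ) univ s' := by
      intro i
      refine (hs' i).congr fun x _ => ?_
      simp only [Lattice.pull_comp, Lattice.dualRestrict_comp_restrictEquiv]
      rfl
    have ht' : IsCircleSec G ((charMap e).comp (face 2 true))
        (P.dualRestrict (charMap e) (face 2 true) ξ) (bdry 2) fun x => t (face 2 true x) :=
      IsCircleSec.comp (G := G) (σ := charMap e) (ξ := ξ) ht (face 2 true)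
        fun x hx => face_last_mem_openBox hx true
    refine exists_lift_of_squareSum_inc
      (ht'.continuousOn_sub (IsSecOn.mono hs'' (subset_univ _))) ?_
    have h1 : ∀ j ε, inc (fun x => t (face 2 true (face j ε x)) - s' (face j ε x)) =
        edgeInc s ((charMap e).comp (face 2 true))
          (P.dualRestrict (charMap e) (face 2 true) ξ) s' (face j ε) -
        edgeInc s (charMap e) ξ t ((face 2 true).comp (face j ε)) := fun j ε => by
      rw [← edgeInc_comp]
      exact (hs.edgeInc_sub ht' hs'' (fun x => face_mem_bdry j ε x) (fun _ => mem_univ _)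
        (range_comp_subset (hface 2 true) _)).symm
    have h2 := hu _ (hface 2 true) _ _ hs''
    have hval : ∀ i ε, P.dualRestrict (charMap e) (face i ε) ξ
        (u ((charMap e).comp (face i ε))) = ξ (p i ε) := fun i ε => by
      rw [← hp, Lattice.dualRestrict_restrict]
    have h3 : ∀ i ε, (∀ x, face i ε x ∈ openBox 2) → (ξ (p i ε) : ℝ) =
        squareSum fun j ε' => edgeInc s (charMap e) ξ t ((face i ε).comp (face j ε')) := by
      intro i ε hx
      rw [← hval, hu _ (hface i ε) _ _
        (IsCircleSec.comp (G := G) (σ := charMap e) (ξ := ξ) ht (face i ε) fun x _ => hx x)]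
      simp only [winding, edgeInc_comp]
    -- Only the edges of the last face, not the face itself, lie in the domain of `t`. The identity
    -- for the cube together with `δu = 0` shows that the winding around these edges relative to `t`
    -- equals the value of `u` on the last face, which is also the winding relative to `s'`. Hence
    -- the difference of `t` and `s'` has winding number zero.
    have h4 := squareSum_faces fun f => edgeInc s (charMap e) ξ t f
    have hm0 : ∀ ε x, face (m := 2) 0 ε x ∈ openBox 2 := fun ε x => Or.inl ⟨0, ε, rfl⟩
    have hm1 : ∀ ε x, face (m := 2) 1 ε x ∈ openBox 2 := fun ε x => Or.inl ⟨1, ε, rfl⟩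
    have hm2 : ∀ x, face (m := 2) 2 false x ∈ openBox 2 := fun x => Or.inr rfl
    rw [← h3 0 _ (hm0 _), ← h3 0 _ (hm0 _), ← h3 1 _ (hm1 _), ← h3 1 _ (hm1 _),
      ← h3 2 _ hm2] at h4
    have h5 := congrArg (fun a => (ξ a : ℝ)) (hsum.trans (Fin.sum_univ_three _))
    simp only [map_add, map_sub, map_zsmul, smul_eq_mul, map_zero] at h5
    simp at h5
    rw [hval] at h2
    have h6 : squareSum (fun j ε => inc fun x => t (face 2 true (face j ε x)) - s' (face j ε x)) =
        winding s ((charMap e).comp (face 2 true))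
          (P.dualRestrict (charMap e) (face 2 true) ξ) s' -
        squareSum fun j ε => edgeInc s (charMap e) ξ t ((face 2 true).comp (face j ε)) := by
      simp only [h1, winding, squareSum]
      ring
    refine h6.trans ?_
    rw [← h2]
    linarith
  choose t ht using key
  exact ⟨_, isSecAlong_circleModMk (P.basisAlong (charMap e))
    fun j => ht (coordHom (P.basisAlong (charMap e)) j)⟩

end Obstruction

end

section

/-! ### The torsor given by a cellular cocycle -/

open Classical in
/-- The angle of a point of the boundary of the square, as a multiple of the full turn. -/
def angle (t : Cube 2) : ℝ :=
  if t 1 = endpoint false ∨ t 0 = endpoint true then ((t 0 : ℝ) + t 1 + 2) / 8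
  else (6 - (t 0 : ℝ) - t 1) / 8

theorem angle_of_or {t : Cube 2} (h : t 1 = endpoint false ∨ t 0 = endpoint true) :
    angle t = ((t 0 : ℝ) + t 1 + 2) / 8 := if_pos h

theorem endpoint_ne : endpoint true ≠ endpoint false := fun h => by
  have := congrArg Subtype.val h
  norm_num [endpoint] at this

/-- The two formulas for the angle agree at the corner `(1, 1)` and differ by a full turn at `(-1,
-1)`, so modulo `ℤ` each is valid on its closed half of the boundary. -/
theorem coe_angle_of_or {t : Cube 2} (h : t 1 = endpoint true ∨ t 0 = endpoint false) :
    (angle t : UnitAddCircle) = ((6 - (t 0 : ℝ) - t 1) / 8 : ℝ) := by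
  by_cases h' : t 1 = endpoint false ∨ t 0 = endpoint true
  · rw [angle_of_or h', circle_coe_eq_coe_iff]
    rcases h with h | h
    · have h0 : t 0 = endpoint true := h'.resolve_left fun h2 => endpoint_ne (h.symm.trans h2)
      refine ⟨0, ?_⟩
      rw [h, h0, coe_endpoint_true]
      norm_num
    · have h1 : t 1 = endpoint false := h'.resolve_right fun h2 => endpoint_ne (h2.symm.trans h)
      refine ⟨-1, ?_⟩
      rw [h, h1, coe_endpoint_false]
      norm_num
  · rw [angle, if_neg h']

theorem continuousOn_angle : ContinuousOn (fun t => (angle t : UnitAddCircle)) (bdry 2) := by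
  have hE : ∀ (i : Fin 2) ε, IsClosed {t : Cube 2 | t i = endpoint ε} := fun i ε =>
    isClosed_singleton.preimage (continuous_apply i)
  have h1 : IsClosed {t : Cube 2 | t 1 = endpoint false ∨ t 0 = endpoint true} :=
    (hE 1 false).union (hE 0 true)
  have h2 : IsClosed {t : Cube 2 | t 1 = endpoint true ∨ t 0 = endpoint false} :=
    (hE 1 true).union (hE 0 false)
  have h3 : bdry 2 ⊆ {t : Cube 2 | t 1 = endpoint false ∨ t 0 = endpoint true} ∪
      {t : Cube 2 | t 1 = endpoint true ∨ t 0 = endpoint false} := by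
    rintro t ⟨i, ε, h⟩
    fin_cases i <;> cases ε
    exacts [Or.inr (Or.inr h), Or.inl (Or.inr h), Or.inl (Or.inl h), Or.inr (Or.inl h)]
  refine ContinuousOn.mono (ContinuousOn.union_of_isClosed ?_ ?_ h1 h2) h3
  · refine ContinuousOn.congr (f := fun t => (((((t 0 : ℝ) + t 1 + 2) / 8 : ℝ)) : UnitAddCircle))
      (continuous_circle_coe (by fun_prop)).continuousOn fun t ht => ?_
    simp only [angle_of_or ht]
  · refine ContinuousOn.congr (f := fun t => ((((6 - (t 0 : ℝ) - t 1) / 8 : ℝ)) : UnitAddCircle))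
      (continuous_circle_coe (by fun_prop)).continuousOn fun t ht => coe_angle_of_or ht

/-- The equality holds only in the circle: at `θ = 8` the loop has returned to the corner where the
angle is `0`. -/
theorem coe_angle_boundaryLoop {θ : ℝ} (hθ : θ ∈ Icc (0 : ℝ) 8) :
    (angle (boundaryLoop θ) : UnitAddCircle) = (θ / 8 : ℝ) := by
  have hx : ∀ a : ℝ, ((Set.projIcc (-1 : ℝ) 1 (by norm_num) a : Icc (-1 : ℝ) 1) : ℝ) =
      max (-1) (min 1 a) := fun a => rfl
  have h0 : ((boundaryLoop θ 0 : Icc (-1 : ℝ) 1) : ℝ) = max (-1) (min 1 (2 - |θ - 3|)) := rfl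
  have h1 : ((boundaryLoop θ 1 : Icc (-1 : ℝ) 1) : ℝ) = max (-1) (min 1 (2 - |θ - 5|)) := rfl
  rcases le_total θ 4 with h4 | h4
  · have key : (boundaryLoop θ 1 = endpoint false ∨ boundaryLoop θ 0 = endpoint true) ∧
        ((boundaryLoop θ 0 : ℝ) + (boundaryLoop θ 1 : ℝ) + 2 = θ) := by
      rcases le_total θ 2 with h2 | h2
      · have e1 : ((boundaryLoop θ 1 : Icc (-1 : ℝ) 1) : ℝ) = -1 := by
          rw [h1, abs_of_nonpos (by linarith), min_eq_right (by linarith),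
            max_eq_left (by linarith)]
        have e0 : ((boundaryLoop θ 0 : Icc (-1 : ℝ) 1) : ℝ) = θ - 1 := by
          rw [h0, abs_of_nonpos (by linarith), min_eq_right (by linarith),
            max_eq_right (by linarith [hθ.1])]
          ring
        exact ⟨Or.inl (Subtype.ext e1), by rw [e0, e1]; ring⟩
      · have e0 : ((boundaryLoop θ 0 : Icc (-1 : ℝ) 1) : ℝ) = 1 := by
          rw [h0, min_eq_left, max_eq_right (by norm_num)]
          have : |θ - 3| ≤ 1 := abs_le.2 ⟨by linarith, by linarith⟩
          linarith
        have e1 : ((boundaryLoop θ 1 : Icc (-1 : ℝ) 1) : ℝ) = θ - 3 := by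
          rw [h1, abs_of_nonpos (by linarith), min_eq_right (by linarith),
            max_eq_right (by linarith)]
          ring
        exact ⟨Or.inr (Subtype.ext e0), by rw [e0, e1]; ring⟩
    rw [angle_of_or key.1, key.2]
  · have key : (boundaryLoop θ 1 = endpoint true ∨ boundaryLoop θ 0 = endpoint false) ∧
        (6 - (boundaryLoop θ 0 : ℝ) - (boundaryLoop θ 1 : ℝ) = θ) := by
      rcases le_total θ 6 with h2 | h2
      · have e1 : ((boundaryLoop θ 1 : Icc (-1 : ℝ) 1) : ℝ) = 1 := by
          rw [h1, min_eq_left, max_eq_right (by norm_num)]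
          have : |θ - 5| ≤ 1 := abs_le.2 ⟨by linarith, by linarith⟩
          linarith
        have e0 : ((boundaryLoop θ 0 : Icc (-1 : ℝ) 1) : ℝ) = 5 - θ := by
          rw [h0, abs_of_nonneg (by linarith), min_eq_right (by linarith),
            max_eq_right (by linarith)]
          ring
        exact ⟨Or.inl (Subtype.ext e1), by rw [e0, e1]; ring⟩
      · have e0 : ((boundaryLoop θ 0 : Icc (-1 : ℝ) 1) : ℝ) = -1 := by
          rw [h0, abs_of_nonneg (by linarith), min_eq_right (by linarith),
            max_eq_left (by linarith)]
        have e1 : ((boundaryLoop θ 1 : Icc (-1 : ℝ) 1) : ℝ) = 7 - θ := by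
          rw [h1, abs_of_nonneg (by linarith), min_eq_right (by linarith),
            max_eq_right (by linarith [hθ.2])]
          ring
        exact ⟨Or.inr (Subtype.ext e0), by rw [e0, e1]; ring⟩
    rw [coe_angle_of_or key.1, key.2]

section

variable {Γ : Type*} [AddCommGroup Γ]

/-- The loop `-a ⊗ θ` in `Γ ⊗ ℝ/ℤ`. -/
def angleSec (a : Γ) (t : Cube 2) : CircleMod Γ where
  toFun ξ := -(ξ a • (angle t : UnitAddCircle))
  map_zero' := by simp
  map_add' ξ η := by simp [add_smul, add_comm]

theorem angleSec_apply (a : Γ) (t : Cube 2) (ξ : Γ →+ ℤ) :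
    angleSec a t ξ = -(ξ a • (angle t : UnitAddCircle)) := rfl

/-- Each side, traversed counterclockwise, contributes a quarter turn. -/
theorem squareSum_inc_angle (z : ℤ) :
    squareSum (fun i ε => inc fun x => z • (angle (face i ε x) : UnitAddCircle)) = z := by
  have hx : ∀ (x : Cube 1) ε, (face 0 ε x) 0 = endpoint ε ∧ (face 0 ε x) 1 = x 0 ∧
      (face 1 ε x) 0 = x 0 ∧ (face 1 ε x) 1 = endpoint ε := fun x ε => by
    rw [face_zero_apply, face_one_apply]
    exact ⟨rfl, rfl, rfl, rfl⟩
  have key : ∀ (f : Cube 1 → Cube 2) (L : Cube 1 → ℝ), Continuous L →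
      (∀ x, (angle (f x) : UnitAddCircle) = L x) →
      inc (fun x => z • (angle (f x) : UnitAddCircle)) = z * (L (pt true) - L (pt false)) := by
    intro f L hL h
    rw [inc_eq (L := fun x => z * L x) (by fun_prop) fun x => ?_]
    · ring
    · rw [h, ← AddCircle.coe_zsmul, zsmul_eq_mul]
  have h1 := key (face 0 true) (fun x => (1 + (x 0 : ℝ) + 2) / 8) (by fun_prop) fun x => by
    rw [angle_of_or (Or.inr (hx x true).1), (hx x true).1, (hx x true).2.1]; rfl
  have h2 := key (face 0 false) (fun x => (6 - (-1) - (x 0 : ℝ)) / 8) (by fun_prop) fun x => by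
    rw [coe_angle_of_or (Or.inr (hx x false).1), (hx x false).1, (hx x false).2.1]; rfl
  have h3 := key (face 1 true) (fun x => (6 - (x 0 : ℝ) - 1) / 8) (by fun_prop) fun x => by
    rw [coe_angle_of_or (Or.inl (hx x true).2.2.2), (hx x true).2.2.1, (hx x true).2.2.2]; rfl
  have h4 := key (face 1 false) (fun x => ((x 0 : ℝ) + (-1) + 2) / 8) (by fun_prop) fun x => by
    rw [angle_of_or (Or.inl (hx x false).2.2.2), (hx x false).2.2.1, (hx x false).2.2.2]; rfl
  rw [squareSum, h1, h2, h3, h4]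
  simp only [pt, coe_endpoint_true, coe_endpoint_false]
  ring

end

variable {n : ℕ} {B : Type u} [TopologicalSpace B] [ChartedSpace (Eucl n) B]
  [IsManifold 𝓘(ℝ, Eucl n) ∞ B] {k : ℕ} {P : Lattice n B k}
  [T2Space B] [CWComplex (univ : Set B)]

open Classical in
/-- A cellular `2`-cocycle `c` is the obstruction cochain of a torsor. -/
theorem exists_twistData {c : P.CellCochain 2} (hc : Lattice.IsCellCocycle c) :
    ∃ G : P.TwistData, (∀ N, ValidUpTo G N) ∧ (∀ b ∈ skel B 1, ∀ i, G i b = 0) ∧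
      ∀ e : Cell B 2, IsSecAlong G (charMap e) univ
        fun y => if y ∈ bdry 2 then angleSec (c e) y else 0 := by
  have hpull0 : ∀ {m : ℕ} (σ : C(Cube m, B)) (y : Cube m) (ξ : P.along σ →+ ℤ),
      P.pull σ (fun _ => 0) y ξ = 0 := fun σ y ξ => rfl
  -- The trivial torsor over the `1`-skeleton. The cocycle enters only through the way in which the
  -- `2`-cells are attached to it.
  have hv : ValidUpTo (P := P) (fun _ _ => 0) 1 := fun m _ e =>
    ⟨fun _ => 0, fun ξ i => by simp only [hpull0]; exact continuousOn_const⟩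
  have h1 : ∀ e : Cell B 2, IsSecAlong (P := P) (fun _ _ => 0) (charMap e) (bdry 2)
      (angleSec (c e)) := by
    intro e ξ i
    simp only [hpull0, sub_zero, angleSec_apply]
    exact ((continuous_neg.comp (continuous_zsmul (ξ (c e)))).comp_continuousOn
      continuousOn_angle).mono inter_subset_left
  obtain ⟨G, hG, hG₁, hsec⟩ := hv.extend h1
  obtain ⟨s, hs⟩ := hG.exists_edgeSections hG₁
  obtain ⟨u, hu⟩ := hs.exists_cochain hG
  -- The hypothesis on `c` concerns every relative cocycle that represents it; applied to the
  -- winding cochain `u`, it removes the obstruction on the `3`-cells.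
  have hrep : Lattice.Represents u c := by
    refine ⟨hs.mem_relCocycles hG hG₁ hu, fun e => ?_⟩
    have hr : range (charMap e) ⊆ skel B 2 := by
      rintro _ ⟨x, rfl⟩
      exact charMap_mem_skel e x
    refine eq_of_forall_intDual (P.basisAlong (charMap e)) fun ξ => ?_
    have h2 := hu (charMap e) hr ξ _ (hsec e ξ)
    -- On the boundary of the cell the edge sections are zero and the section over the cell is `-c e
    -- ⊗ angle`. Their difference winds `ξ (c e)` times.
    have h3 : ∀ i ε, edgeInc s (charMap e) ξ
        (fun y => (if y ∈ bdry 2 then angleSec (c e) y else 0) ξ) (face i ε) =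
        inc fun x => ξ (c e) • (angle (face i ε x) : UnitAddCircle) := by
      intro i ε
      unfold edgeInc
      congr 1
      ext x
      rw [hs.of_skel]
      · change 0 - (if face i ε x ∈ bdry 2 then angleSec (c e) (face i ε x) else 0) ξ = _
        rw [if_pos (face_mem_bdry i ε x), angleSec_apply, sub_neg_eq_add, zero_add]
      · rintro _ ⟨y, rfl⟩
        exact charMap_mem_skel_of_mem_bdry e (face_mem_bdry i ε y)
    simp only [winding, h3, squareSum_inc_angle] at h2
    exact_mod_cast h2
  have h4 : ∀ e : Cell B 3, ∃ t, IsSecAlong G (charMap e) (bdry 3) t := fun e =>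
    hs.exists_section_bdry hG hu e (hc u hrep e)
  choose t ht using h4
  obtain ⟨G', hG', hagree, -⟩ := hG.extend ht
  obtain ⟨G'', hG'', hagree'⟩ := hG'.exists_extension
  have h5 : ∀ b ∈ skel B 2, ∀ i, G'' i b = G i b := fun b hb i =>
    (hagree' b (skel_mono (by omega) hb) i).trans (hagree b hb i)
  refine ⟨G'', hG'', fun b hb i => ?_, fun e => (hsec e).congr_data fun y _ => h5 _ ?_⟩
  · rw [h5 b (skel_mono (by omega) hb), hG₁ b hb]
  · exact charMap_mem_skel e y

end

section

variable {n : ℕ} {B : Type u} [TopologicalSpace B] [ChartedSpace (Eucl n) B]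
  [IsManifold 𝓘(ℝ, Eucl n) ∞ B] {k : ℕ} {P : Lattice n B k}

/-! ### From `P ⊗ ℝ/ℤ` to `T*B / P` -/

/-- The homomorphism `r ↦ [r p]` from `ℝ/ℤ` to `T*_x B / P_x` for `p ∈ P_x`. -/
def smulQuot {x : B} (p : P.fiber x) : UnitAddCircle →+ P.QuotFiber x :=
  QuotientAddGroup.lift _
    (AddMonoidHom.mk' (fun r : ℝ => ((r • (p : Cot (n := n) x) : Cot (n := n) x) : P.QuotFiber x))
      fun r s => by rw [add_smul]; rfl) <| by
    rw [AddSubgroup.zmultiples_le]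
    rw [AddMonoidHom.mem_ker]
    refine (QuotientAddGroup.eq_zero_iff _).2 ?_
    rw [one_smul]
    exact p.2

theorem smulQuot_coe {x : B} (p : P.fiber x) (r : ℝ) :
    smulQuot p (r : UnitAddCircle) = ((r • (p : Cot (n := n) x) : Cot (n := n) x) :
      P.QuotFiber x) := rfl

theorem smulQuot_add {x : B} (p q : P.fiber x) (s : UnitAddCircle) :
    smulQuot (p + q) s = smulQuot p s + smulQuot q s := by
  obtain ⟨r, rfl⟩ := QuotientAddGroup.mk_surjective s
  change ((r • ((p : Cot (n := n) x) + q) : Cot (n := n) x) : P.QuotFiber x) = _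
  rw [smul_add]
  rfl

/-- `smulQuot` as a homomorphism in the first argument. -/
def smulQuotHom {x : B} (s : UnitAddCircle) : P.fiber x →+ P.QuotFiber x :=
  AddMonoidHom.mk' (fun p => smulQuot p s) fun p q => smulQuot_add p q s

/-- The homomorphism from `P_x ⊗ ℝ/ℤ` to `T*_x B / P_x`. -/
def circleToQuot {x : B} (a : CircleMod (P.fiber x)) : P.QuotFiber x :=
  ∑ i, smulQuot ((P.nonempty_basis_fiber x).some i)
    (a (coordHom (P.nonempty_basis_fiber x).some i))

/-- The map is induced by the bilinear map `(p, r) ↦ [r p]` on `P_x ⊗ ℝ/ℤ`, so the basis used to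
write it down is irrelevant. -/
theorem circleToQuot_eq {x : B} (b : Module.Basis (Fin k) ℤ (P.fiber x))
    (a : CircleMod (P.fiber x)) : circleToQuot a = ∑ i, smulQuot (b i) (a (coordHom b i)) := by
  unfold circleToQuot
  set b' := (P.nonempty_basis_fiber x).some
  have h1 : ∀ i, smulQuot (b' i) (a (coordHom b' i)) =
      ∑ j, coordHom b' i (b j) • smulQuot (b' i) (a (coordHom b j)) := fun i => by
    rw [circleMod_apply_eq_sum b a (coordHom b' i), map_sum]
    simp only [map_zsmul]
  simp only [h1]
  rw [Finset.sum_comm]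
  refine Finset.sum_congr rfl fun j _ => ?_
  have h2 : smulQuotHom (a (coordHom b j)) (b j) =
      ∑ i, coordHom b' i (b j) • smulQuotHom (a (coordHom b j)) (b' i) := by
    conv_lhs => rw [eq_sum_coordHom b' (b j)]
    simp only [map_sum, map_zsmul]
  exact h2.symm

theorem circleToQuot_add {x : B} (a a' : CircleMod (P.fiber x)) :
    circleToQuot (a + a') = circleToQuot a + circleToQuot a' := by
  simp only [circleToQuot, AddMonoidHom.add_apply, map_add, Finset.sum_add_distrib]

theorem circleToQuot_zero {x : B} : circleToQuot (0 : CircleMod (P.fiber x)) = 0 := by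
  simp [circleToQuot]

theorem circleToQuot_sub {x : B} (a a' : CircleMod (P.fiber x)) :
    circleToQuot (a - a') = circleToQuot a - circleToQuot a' := by
  rw [eq_sub_iff_add_eq, ← circleToQuot_add, sub_add_cancel]

theorem mk_sum_smul {x : B} (b : Module.Basis (Fin k) ℤ (P.fiber x))
    (a : CircleMod (P.fiber x)) {L : Fin k → ℝ} (hL : ∀ i, (L i : UnitAddCircle) = a (coordHom b i)) :
    ((∑ i, L i • (b i : Cot (n := n) x) : Cot (n := n) x) : P.QuotFiber x) = circleToQuot a := by
  rw [circleToQuot_eq b]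
  refine (map_sum (QuotientAddGroup.mk' (P.fiber x)) _ _).trans
    (Finset.sum_congr rfl fun i _ => ?_)
  rw [← hL i, smulQuot_coe]
  rfl

/-! ### Lifting functions to the circle -/

/-- Continuous functions to the circle on `V` lift to `ℝ`. -/
def LiftsCircle (V : Set B) : Prop :=
  ∀ f : B → UnitAddCircle, ContinuousOn f V →
    ∃ L : B → ℝ, ContinuousOn L V ∧ ∀ b ∈ V, (L b : UnitAddCircle) = f b

/-- A small ball in a chart is homeomorphic to the model vector space, where lifts to `ℝ` exist. -/
theorem exists_liftsCircle (n : ℕ) {B : Type u} [TopologicalSpace B] [ChartedSpace (Eucl n) B]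
    {x : B} {W : Set B} (hW : W ∈ 𝓝 x) :
    ∃ V ⊆ W, IsOpen V ∧ x ∈ V ∧ LiftsCircle V := by
  set φ := chartAt (Eucl n) x
  have h1 : φ.symm ⁻¹' (W ∩ φ.source) ∈ 𝓝 (φ x) := by
    refine (φ.symm.continuousAt (φ.map_source (mem_chart_source _ x))).preimage_mem_nhds ?_
    rw [φ.left_inv (mem_chart_source _ x)]
    exact Filter.inter_mem hW (chart_source_mem_nhds _ x)
  obtain ⟨r, hr, hball⟩ := Metric.mem_nhds_iff.1
    (Filter.inter_mem h1 (chart_target_mem_nhds (Eucl n) x))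
  set e := OpenPartialHomeomorph.univBall (φ x) r
  have he : e.target = Metric.ball (φ x) r := OpenPartialHomeomorph.univBall_target _ hr
  have hes : e.source = univ := OpenPartialHomeomorph.univBall_source _ _
  refine ⟨φ.source ∩ φ ⁻¹' Metric.ball (φ x) r, ?_, ?_,
    ⟨mem_chart_source _ x, Metric.mem_ball_self hr⟩, ?_⟩
  · rintro b ⟨hb, hb'⟩
    have := (hball hb').1.1
    rwa [φ.left_inv hb] at this
  · exact φ.isOpen_inter_preimage Metric.isOpen_ball
  · intro f hf
    have hmap : ∀ y, e y ∈ Metric.ball (φ x) r := fun y => he ▸ e.map_source (hes ▸ mem_univ y)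
    have hc : Continuous fun y => f (φ.symm (e y)) := by
      rw [← continuousOn_univ]
      refine hf.comp ((φ.symm.continuousOn).comp (hes ▸ e.continuousOn)
        fun y _ => (hball (hmap y)).2) fun y _ => ?_
      refine ⟨(hball (hmap y)).1.2, ?_⟩
      rw [mem_preimage, φ.right_inv (hball (hmap y)).2]
      exact hmap y
    obtain ⟨L, hL, hLf⟩ := exists_circle_lift hc
    refine ⟨fun b => L (e.symm (φ b)), ?_, fun b hb => ?_⟩
    · refine hL.comp_continuousOn (e.symm.continuousOn.comp
        (φ.continuousOn.mono inter_subset_left) fun b hb => ?_)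
      change φ b ∈ e.target
      rw [he]
      exact hb.2
    · rw [hLf, e.right_inv (he ▸ hb.2), φ.left_inv hb.1]

theorem LiftsCircle.exists_lift (F : P.Frame) {V : Set B} (hV : LiftsCircle V) (hF : V ⊆ F.dom)
    {f : ∀ b, CircleMod (P.fiber b)} (hf : Lattice.ContCircle f V) :
    ∃ α : ∀ b, Cot (n := n) b, ContinuousOn (fun b => cotMk b (α b)) V ∧
      ∀ b ∈ V, (α b : P.QuotFiber b) = circleToQuot (f b) := by
  have h1 := fun j => hV _ ((hf F j).mono fun b hb => ⟨hF hb, hb⟩)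
  choose L hL hLf using h1
  refine ⟨fun b => ∑ i, L i b • F.vec i b, fun b hb => ?_, fun b hb => ?_⟩
  · exact continuousWithinAt_cot_sum _ continuousWithinAt_id fun i _ =>
      continuousWithinAt_cot_smul (f := fun b : B => b) (hL i b hb)
        (F.continuousWithinAt_vec (f := fun b : B => b) (hF hb) continuousWithinAt_id i)
  · rw [← mk_sum_smul (F.basis (hF hb)) (f b) (L := fun i => L i b)]
    · simp
    · intro i
      rw [hLf i b hb, F.zcoord_of_mem (hF hb)]

/-! ### Smoothing -/

variable (P) in
/-- Local sections `g i` of `T*B / P` over the members of an open cover, whose differences lift to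
smooth sections of `T*B`. -/
structure SmoothTwist where
  /-- the indices -/
  ι : Type u
  /-- the open cover -/
  V : ι → Set B
  isOpen : ∀ i, IsOpen (V i)
  exists_mem : ∀ b : B, ∃ i, b ∈ V i
  /-- the local sections -/
  g : ι → ∀ b : B, P.QuotFiber b
  /-- the lifts of the differences -/
  diff : ι → ι → ∀ b : B, Cot (n := n) b
  smooth : ∀ i j, SmoothFormOn (diff i j) (V i ∩ V j)
  coe_diff : ∀ i j, ∀ b ∈ V i ∩ V j, (diff i j b : P.QuotFiber b) = g j b - g i b

/-- Continuous sections of `P` are smooth. -/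
theorem contMDiffAt_of_mem_fiber {α : ∀ b, Cot (n := n) b} {b₀ : B}
    (hα : ContinuousAt (fun b => cotMk b (α b)) b₀) (h : ∀ᶠ b in 𝓝 b₀, α b ∈ P.fiber b) :
    ContMDiffAt 𝓘(ℝ, Eucl n) (𝓘(ℝ, Eucl n).prod 𝓘(ℝ, EuclDual n)) ∞
      (fun b => cotMk b (α b)) b₀ := by
  obtain ⟨F, hF⟩ := P.exists_frame_at b₀
  obtain ⟨c, hc⟩ := F.eventually_eq_sum (f := fun b : B => b) (S := univ) (y₀ := b₀) hF
    (mem_univ _) hα.continuousWithinAt (by rwa [nhdsWithin_univ])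
  rw [nhdsWithin_univ] at hc
  have h1 : ContMDiffAt 𝓘(ℝ, Eucl n) (𝓘(ℝ, Eucl n).prod 𝓘(ℝ, EuclDual n)) ∞
      (fun b => cotMk b (∑ i, (c i : ℝ) • F.vec i b)) b₀ := by
    refine ContMDiffAt.sum_section fun i _ => ?_
    exact ContMDiffAt.const_smul_section ((F.smooth i).contMDiffAt (F.isOpen_dom.mem_nhds hF))
  refine h1.congr_of_eventuallyEq ?_
  filter_upwards [hc] with b hb
  rw [hb.2]
  congr 1
  exact Finset.sum_congr rfl fun i _ => (Int.cast_smul_eq_zsmul ℝ _ _).symm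

section Smoothing

variable [T2Space B] [SecondCountableTopology B]

/-- A torsor given by continuous transition functions is isomorphic to one with smooth transition
functions. -/
theorem exists_smooth_transition {ι : Type u} {V : ι → Set B} (hV : ∀ i, IsOpen (V i))
    (hcov : ∀ b, ∃ i, b ∈ V i) (g : ι → ∀ b, P.QuotFiber b) (a : ι → ι → ∀ b, Cot (n := n) b)
    (ha : ∀ i j, ContinuousOn (fun b => cotMk b (a i j b)) (V i ∩ V j))
    (hag : ∀ i j, ∀ b ∈ V i ∩ V j, (a i j b : P.QuotFiber b) = g j b - g i b) :
    ∃ (h : ι → ∀ b, Cot (n := n) b) (T : SmoothTwist P) (e : T.ι ≃ ι),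
      (∀ i, ContinuousOn (fun b => cotMk b (h i b)) (V i)) ∧ (∀ i, T.V i = V (e i)) ∧
      ∀ i b, T.g i b = g (e i) b + (h (e i) b : P.QuotFiber b) := by
  have : LocallyCompactSpace B := ChartedSpace.locallyCompactSpace (Eucl n) B
  obtain ⟨ρ, hρ⟩ := SmoothPartitionOfUnity.exists_isSubordinate 𝓘(ℝ, Eucl n) isClosed_univ V hV
    fun b _ => mem_iUnion.2 (hcov b)
  have hfin : ∀ b₀, ∃ s : Finset ι, ∀ᶠ b in 𝓝 b₀, ∀ z, z ∉ s → ρ z b = 0 := by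
    intro b₀
    obtain ⟨U, hU, hf⟩ := ρ.locallyFinite b₀
    refine ⟨hf.toFinset, Filter.mem_of_superset hU fun b hb z hz => ?_⟩
    by_contra h
    exact hz (hf.mem_toFinset.2 ⟨b, h, hb⟩)
  have hoff : ∀ z b₀, b₀ ∉ V z → ∀ᶠ b in 𝓝 b₀, ρ z b = 0 := fun z b₀ hb => by
    have := notMem_tsupport_iff_eventuallyEq.1 fun h => hb (hρ z h)
    exact this
  have hsum : ∀ (s : Finset ι) (b : B), (∀ z, z ∉ s → ρ z b = 0) → ∀ v : ι → Cot (n := n) b,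
      ∑ᶠ z, ρ z b • v z = ∑ z ∈ s, ρ z b • v z := fun s b hs v =>
    finsum_eq_sum_of_support_subset _ fun z hz => by
      by_contra hzs
      exact hz (by simp [hs z hzs])
  have hone : ∀ (s : Finset ι) (b : B), (∀ z, z ∉ s → ρ z b = 0) → ∑ z ∈ s, ρ z b = 1 :=
    fun s b hs => by
      rw [← ρ.sum_eq_one (mem_univ b)]
      refine (finsum_eq_sum_of_support_subset _ fun z hz => ?_).symm
      by_contra hzs
      exact hz (hs z hzs)
  -- With `h i = ∑ ρ z • a i z`, the new difference `a i j + h j - h i` equals `∑ ρ z • (a i j + a j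
  -- z - a i z)` because `∑ ρ z = 1`. The lifts `a` satisfy the cocycle identity only modulo `P`, so
  -- each bracket is a continuous section of `P`, hence smooth.
  refine ⟨fun i b => ∑ᶠ z, ρ z b • a i z b, ⟨ι, V, hV, hcov,
    fun i b => g i b + ((∑ᶠ z, ρ z b • a i z b : Cot (n := n) b) : P.QuotFiber b),
    fun i j b => ∑ᶠ z, ρ z b • (a i j b + a j z b - a i z b), fun i j b₀ hb₀ => ?_,
    fun i j b hb => ?_⟩, Equiv.refl ι, fun i b₀ hb₀ => ?_, fun i => rfl, fun i b => rfl⟩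
  · refine ContMDiffAt.contMDiffWithinAt ?_
    obtain ⟨s, hs⟩ := hfin b₀
    have h1 : ContMDiffAt 𝓘(ℝ, Eucl n) (𝓘(ℝ, Eucl n).prod 𝓘(ℝ, EuclDual n)) ∞
        (fun b => cotMk b (∑ z ∈ s, ρ z b • (a i j b + a j z b - a i z b))) b₀ := by
      refine ContMDiffAt.sum_section fun z _ => ?_
      by_cases hz : b₀ ∈ V z
      · refine ContMDiffAt.smul_section ((ρ z).contMDiff.contMDiffAt) ?_
        have hmem : ∀ᶠ b in 𝓝 b₀, b ∈ V i ∧ b ∈ V j ∧ b ∈ V z :=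
          Filter.inter_mem ((hV i).mem_nhds hb₀.1)
            (Filter.inter_mem ((hV j).mem_nhds hb₀.2) ((hV z).mem_nhds hz))
        have hca : ∀ i j, b₀ ∈ V i → b₀ ∈ V j →
            ContinuousWithinAt (fun b => cotMk b (a i j b)) univ b₀ := fun i j hi hj =>
          ((ha i j).continuousAt (((hV i).inter (hV j)).mem_nhds ⟨hi, hj⟩)).continuousWithinAt
        refine contMDiffAt_of_mem_fiber (P := P) ?_ ?_
        · rw [← continuousWithinAt_univ]
          exact continuousWithinAt_cot_sub (f := fun b : B => b)
            (continuousWithinAt_cot_add (f := fun b : B => b) (hca i j hb₀.1 hb₀.2)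
              (hca j z hb₀.2 hz)) (hca i z hb₀.1 hz)
        · filter_upwards [hmem] with b ⟨hi, hj, hz⟩
          rw [← QuotientAddGroup.eq_zero_iff, QuotientAddGroup.mk_sub, QuotientAddGroup.mk_add,
            hag i j b ⟨hi, hj⟩, hag j z b ⟨hj, hz⟩, hag i z b ⟨hi, hz⟩]
          abel
      · refine (contMDiffAt_of_mem_fiber (P := P) (α := fun b => 0) ?_ ?_).congr_of_eventuallyEq
          ?_
        · exact (continuous_zero_cot (σ := fun b : B => b) continuous_id).continuousAt
        · exact Filter.Eventually.of_forall fun b => zero_mem _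
        · filter_upwards [hoff z b₀ hz] with b hb
          rw [hb, zero_smul]
    refine h1.congr_of_eventuallyEq ?_
    filter_upwards [hs] with b hb
    rw [hsum s b hb]
  · obtain ⟨s, hs⟩ := hfin b
    have hs := hs.self_of_nhds
    rw [hsum s b hs, hsum s b hs, hsum s b hs]
    have h1 : ∑ z ∈ s, ρ z b • (a i j b + a j z b - a i z b) =
        a i j b + ∑ z ∈ s, ρ z b • a j z b - ∑ z ∈ s, ρ z b • a i z b := by
      simp only [smul_sub, smul_add, Finset.sum_sub_distrib, Finset.sum_add_distrib,
        ← Finset.sum_smul, hone s b hs, one_smul]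
    rw [h1, QuotientAddGroup.mk_sub, QuotientAddGroup.mk_add, hag i j b hb]
    abel
  · refine ContinuousAt.continuousWithinAt ?_
    obtain ⟨s, hs⟩ := hfin b₀
    have h1 : ContinuousWithinAt (fun b => cotMk b (∑ z ∈ s, ρ z b • a i z b)) univ b₀ := by
      refine continuousWithinAt_cot_sum (f := fun b : B => b) s continuousWithinAt_id fun z _ => ?_
      by_cases hz : b₀ ∈ V z
      · exact continuousWithinAt_cot_smul (f := fun b : B => b)
          (ρ z).contMDiff.continuous.continuousWithinAt
          ((ha i z).continuousAt (((hV i).inter (hV z)).mem_nhds ⟨hb₀, hz⟩)).continuousWithinAt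
      · refine ContinuousAt.continuousWithinAt (ContinuousAt.congr
          (continuous_zero_cot (σ := fun b : B => b) continuous_id).continuousAt ?_)
        filter_upwards [hoff z b₀ hz] with b hb
        rw [hb, zero_smul]
    rw [continuousWithinAt_univ] at h1
    refine h1.congr ?_
    filter_upwards [hs] with b hb
    rw [hsum s b hb]

end Smoothing

end

/-! ### From torsors over the cell complex to smooth transition functions on the manifold. -/

section

variable {n : ℕ} {B : Type u} [TopologicalSpace B] [ChartedSpace (Eucl n) B]
  [IsManifold 𝓘(ℝ, Eucl n) ∞ B] {k : ℕ} {P : Lattice n B k} [T2Space B]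

/-- By the weak topology, continuity over an open set may be tested on the cells, and each cell lies
in a skeleton over which the data are valid. -/
theorem contCircle_of_validUpTo [CWComplex (univ : Set B)] {G : P.TwistData}
    (h : ∀ N, ValidUpTo G N) (i j : CellIdx B) :
    Lattice.ContCircle (fun b => G i b - G j b) (cellStar i ∩ cellStar j) := by
  intro F l
  refine continuousOn_of_forall_charMap
    (F.isOpen_dom.inter ((isOpen_cellStar i).inter (isOpen_cellStar j))) fun m e => ?_
  exact ((h m).contCircle i j F l).comp (charMap e).continuous.continuousOn
    fun y hy => ⟨hy.1, hy.2, charMap_mem_skel e y⟩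

variable [SecondCountableTopology B]

/-- A refinement `V` of an open cover `O` such that either of two members of `V` that meet lies
in the members of `O` given for both. -/
theorem exists_refinement (n : ℕ) {B : Type u} [TopologicalSpace B] [ChartedSpace (Eucl n) B]
    [T2Space B] [SecondCountableTopology B] {ι : Type*} {O : ι → Set B} (hO : ∀ i, IsOpen (O i))
    (hcov : ∀ b, ∃ i, b ∈ O i) {D : B → Set B} (hD : ∀ b, D b ∈ 𝓝 b) :
    ∃ (V : B → Set B) (c : B → ι), (∀ x, IsOpen (V x) ∧ x ∈ V x ∧ LiftsCircle (V x) ∧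
      V x ⊆ D x ∧ V x ⊆ O (c x)) ∧
      ∀ x y, (V x ∩ V y).Nonempty → V y ⊆ O (c x) ∨ V x ⊆ O (c y) := by
  have : LocallyCompactSpace B := ChartedSpace.locallyCompactSpace (Eucl n) B
  let : MetricSpace B := TopologicalSpace.metrizableSpaceMetric B
  choose c hc using hcov
  -- `V x` will lie in the ball of radius `δ x`. If `V x` meets `V y` and `δ y ≤ δ x`, every point
  -- of `V y` is within `δ x + 2 δ y ≤ 3 δ x` of `x`.
  have h1 : ∀ x, ∃ δ > 0, Metric.ball x (3 * δ) ⊆ O (c x) := fun x => by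
    obtain ⟨ε, hε, h⟩ := Metric.isOpen_iff.1 (hO (c x)) x (hc x)
    exact ⟨ε / 3, by positivity, by rwa [mul_div_cancel₀ _ (by norm_num)]⟩
  choose δ hδ hball using h1
  choose V hVsub hV hxV hlift using fun x =>
    exists_liftsCircle n (Filter.inter_mem (Metric.ball_mem_nhds x (hδ x)) (hD x))
  have key : ∀ x y, (V x ∩ V y).Nonempty → δ y ≤ δ x → V y ⊆ O (c x) := by
    rintro x y ⟨z, hzx, hzy⟩ hle w hw
    refine hball x ?_
    have h1 := Metric.mem_ball.1 (hVsub x hzx).1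
    have h2 := Metric.mem_ball'.1 (hVsub y hzy).1
    have h3 := Metric.mem_ball.1 (hVsub y hw).1
    rw [Metric.mem_ball]
    calc dist w x ≤ dist w y + dist y z + dist z x := dist_triangle4 _ _ _ _
      _ < 3 * δ x := by linarith
  refine ⟨V, c, fun x => ⟨hV x, hxV x, hlift x, fun w hw => (hVsub x hw).2, fun w hw => ?_⟩,
    fun x y hxy => ?_⟩
  · exact hball x (Metric.ball_subset_ball (by linarith [hδ x]) (hVsub x hw).1)
  · rcases le_total (δ y) (δ x) with h | h
    · exact Or.inl (key x y hxy h)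
    · exact Or.inr (key y x (by rwa [inter_comm]) h)

/-- A torsor under `P ⊗ ℝ/ℤ` over a manifold gives a torsor under `T*B / P` with smooth transition
functions. -/
theorem exists_smoothTwist [CWComplex (univ : Set B)] {G : P.TwistData}
    (hG : ∀ N, ValidUpTo G N) :
    ∃ (T : SmoothTwist P) (c : T.ι → CellIdx B) (h : T.ι → ∀ b, Cot (n := n) b),
      (∀ i, T.V i ⊆ cellStar (c i)) ∧
      (∀ i, ContinuousOn (fun b => cotMk b (h i b)) (T.V i)) ∧
      ∀ i b, T.g i b = circleToQuot (G (c i) b) + (h i b : P.QuotFiber b) := by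
  choose F hF using P.exists_frame_at
  obtain ⟨V, c, hV, hmeet⟩ := exists_refinement n (O := fun i : CellIdx B => cellStar i)
    isOpen_cellStar (fun b => mem_iUnion.1 (iUnion_cellStar (B := B) ▸ mem_univ b))
    (D := fun b => (F b).dom) fun b => (F b).isOpen_dom.mem_nhds (hF b)
  -- The intersection `V x ∩ V y` need not be simply connected, so the transition function is lifted
  -- over all of `V x` or all of `V y`. The refinement ensures that it is defined on one of the two.
  have h1 : ∀ x y, ∃ α : ∀ b, Cot (n := n) b,
      ContinuousOn (fun b => cotMk b (α b)) (V x ∩ V y) ∧ ∀ b ∈ V x ∩ V y,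
        (α b : P.QuotFiber b) = circleToQuot (G (c y) b) - circleToQuot (G (c x) b) := by
    intro x y
    by_cases hne : (V x ∩ V y).Nonempty
    · simp only [← circleToQuot_sub]
      rcases hmeet x y hne with h | h
      · obtain ⟨α, h1, h2⟩ := (hV y).2.2.1.exists_lift (F y) (hV y).2.2.2.1
          (f := fun b => G (c y) b - G (c x) b)
          ((contCircle_of_validUpTo hG (c y) (c x)).mono fun b hb => ⟨(hV y).2.2.2.2 hb, h hb⟩)
        exact ⟨α, h1.mono inter_subset_right, fun b hb => h2 b hb.2⟩
      · obtain ⟨α, h1, h2⟩ := (hV x).2.2.1.exists_lift (F x) (hV x).2.2.2.1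
          (f := fun b => G (c y) b - G (c x) b)
          ((contCircle_of_validUpTo hG (c y) (c x)).mono fun b hb => ⟨h hb, (hV x).2.2.2.2 hb⟩)
        exact ⟨α, h1.mono inter_subset_left, fun b hb => h2 b hb.1⟩
    · rw [not_nonempty_iff_eq_empty] at hne
      rw [hne]
      exact ⟨fun b => 0, continuousOn_empty _, fun b hb => hb.elim⟩
  choose a ha hag using h1
  obtain ⟨h, T, e, hh, hTV, hTg⟩ := exists_smooth_transition (fun x => (hV x).1)
    (fun b => ⟨b, (hV b).2.1⟩) (fun x b => circleToQuot (G (c x) b)) a ha hag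
  refine ⟨T, fun i => c (e i), fun i => h (e i), fun i => ?_, fun i => ?_, hTg⟩
  · rw [hTV]
    exact (hV _).2.2.2.2
  · rw [hTV]
    exact hh _

end

section

/-! ### Manifolds modelled on manifolds -/

section Comp

variable {E : Type*} [NormedAddCommGroup E] [NormedSpace ℝ E] {H : Type*} [TopologicalSpace H]
  (I : ModelWithCorners ℝ E H) (M' : Type*) [TopologicalSpace M'] [ChartedSpace H M']
  [IsManifold I ∞ M'] (M : Type*) [TopologicalSpace M] [ChartedSpace M' M]

/-- An atlas with values in a manifold `M'` and smooth transition maps, composed with the charts of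
`M'`, gives a smooth atlas. Below, `M'` is the cotangent bundle, and the charts are local inverses
of the quotient maps. -/
theorem isManifold_comp (h : ∀ φ ∈ atlas M' M, ∀ φ' ∈ atlas M' M,
    ContMDiffOn I I ∞ (φ.symm.trans φ') (φ.symm.trans φ').source) :
    letI := ChartedSpace.comp H M' M; IsManifold I ∞ M := by
  let _ := ChartedSpace.comp H M' M
  refine isManifold_of_contDiffOn I ∞ M ?_
  rintro _ _ ⟨φ, hφ, c, hc, rfl⟩ ⟨φ', hφ', c', hc', rfl⟩
  have h1 : ContMDiffOn I I ∞ (c' ∘ (φ.symm.trans φ') ∘ c.symm)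
      ((φ.trans c).symm.trans (φ'.trans c')).source := by
    refine (contMDiffOn_of_mem_maximalAtlas (IsManifold.subset_maximalAtlas hc')).comp
      ((h φ hφ φ' hφ').comp ((contMDiffOn_symm_of_mem_maximalAtlas
        (IsManifold.subset_maximalAtlas hc)).mono ?_) ?_) ?_
    all_goals
      intro y hy
      simp only [mfld_simps] at hy ⊢
      tauto
  rw [← contMDiffOn_iff_contDiffOn]
  refine (I.contMDiff).comp_contMDiffOn (h1.comp
    ((I.contMDiffOn_symm).mono inter_subset_right) fun y hy => hy.1)

variable {M' M}

theorem contMDiffOn_of_mem_atlas_comp (hM : letI := ChartedSpace.comp H M' M; IsManifold I ∞ M)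
    {φ : OpenPartialHomeomorph M M'} (hφ : φ ∈ atlas M' M) :
    letI := ChartedSpace.comp H M' M; ContMDiffOn I I ∞ φ φ.source := by
  let _ := ChartedSpace.comp H M' M
  have : IsManifold I ∞ M := hM
  intro z hz
  set c := chartAt H (φ z)
  have h1 : ContMDiffOn I I ∞ (φ.trans c) (φ.trans c).source :=
    contMDiffOn_of_mem_maximalAtlas (IsManifold.subset_maximalAtlas
      ⟨φ, hφ, c, chart_mem_atlas _ _, rfl⟩)
  have h2 : ContMDiffOn I I ∞ c.symm c.target :=
    contMDiffOn_symm_of_mem_maximalAtlas (IsManifold.subset_maximalAtlas (chart_mem_atlas _ _))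
  have h3 : z ∈ (φ.trans c).source := by
    rw [OpenPartialHomeomorph.trans_source]
    exact ⟨hz, mem_chart_source _ _⟩
  have h4 : ContMDiffOn I I ∞ (c.symm ∘ (φ.trans c)) (φ.trans c).source :=
    h2.comp h1 fun y hy => c.map_source ((φ.trans_source c ▸ hy).2)
  refine ((h4.contMDiffAt ((φ.trans c).open_source.mem_nhds h3)).congr_of_eventuallyEq
    ?_).contMDiffWithinAt
  filter_upwards [(φ.trans c).open_source.mem_nhds h3] with y hy
  exact (c.left_inv ((φ.trans_source c ▸ hy).2)).symm

theorem contMDiffOn_symm_of_mem_atlas_comp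
    (hM : letI := ChartedSpace.comp H M' M; IsManifold I ∞ M)
    {φ : OpenPartialHomeomorph M M'} (hφ : φ ∈ atlas M' M) :
    letI := ChartedSpace.comp H M' M; ContMDiffOn I I ∞ φ.symm φ.target := by
  let _ := ChartedSpace.comp H M' M
  have : IsManifold I ∞ M := hM
  intro a ha
  set c := chartAt H a
  have h1 : ContMDiffOn I I ∞ (φ.trans c).symm (φ.trans c).target :=
    contMDiffOn_symm_of_mem_maximalAtlas (IsManifold.subset_maximalAtlas
      ⟨φ, hφ, c, chart_mem_atlas _ _, rfl⟩)
  have h2 : ContMDiffOn I I ∞ c c.source :=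
    contMDiffOn_of_mem_maximalAtlas (IsManifold.subset_maximalAtlas (chart_mem_atlas _ _))
  have h4 : ContMDiffOn I I ∞ ((φ.trans c).symm ∘ c) (c.source ∩ φ.target) :=
    h1.comp (h2.mono inter_subset_left) fun y hy => by
      simp only [mfld_simps]
      simp [hy.1, hy.2]
  refine ((h4.contMDiffAt ((c.open_source.inter φ.open_target).mem_nhds
    ⟨mem_chart_source _ _, ha⟩)).congr_of_eventuallyEq ?_).contMDiffWithinAt
  filter_upwards [c.open_source.mem_nhds (mem_chart_source H a)] with y hy
  simp [c.left_inv hy]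

end Comp

end

section

variable {n : ℕ} {B : Type u} [TopologicalSpace B] [ChartedSpace (Eucl n) B]
  [IsManifold 𝓘(ℝ, Eucl n) ∞ B] {k : ℕ} {P : Lattice n B k}

/-! ### Translations of the cotangent bundle -/

/-- The translation of `T*B` by a `1`-form. -/
def shift (α : ∀ b : B, Cot (n := n) b) (a : CotBundle n B) : CotBundle n B :=
  cotMk a.1 (a.2 + α a.1)

/-- In a local trivialization of the vector bundle, addition in the fibres is addition in the model
fibre. -/
theorem contMDiffAt_shift {α : ∀ b : B, Cot (n := n) b} {a₀ : CotBundle n B}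
    (hα : ContMDiffAt 𝓘(ℝ, Eucl n) (𝓘(ℝ, Eucl n).prod 𝓘(ℝ, EuclDual n)) ∞
      (fun b => cotMk b (α b)) a₀.1) :
    ContMDiffAt (𝓘(ℝ, Eucl n).prod 𝓘(ℝ, EuclDual n)) (𝓘(ℝ, Eucl n).prod 𝓘(ℝ, EuclDual n)) ∞
      (shift α) a₀ := by
  have hπ : ContMDiff (𝓘(ℝ, Eucl n).prod 𝓘(ℝ, EuclDual n)) 𝓘(ℝ, Eucl n) ∞
      (fun a : CotBundle n B => a.1) := contMDiff_proj _
  have h1 := contMDiffAt_totalSpace.1 (contMDiffAt_id (I := 𝓘(ℝ, Eucl n).prod 𝓘(ℝ, EuclDual n))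
    (n := ∞) (x := a₀))
  have h2 := contMDiffAt_totalSpace.1 (ContMDiffAt.comp a₀ hα hπ.contMDiffAt)
  refine contMDiffAt_totalSpace.2 ⟨hπ.contMDiffAt, (h1.2.add h2.2).congr_of_eventuallyEq ?_⟩
  have hU := hπ.continuous.continuousAt.preimage_mem_nhds
    ((cotTriv (n := n) a₀.1).open_baseSet.mem_nhds (mem_baseSet_trivializationAt _ _ a₀.1))
  filter_upwards [hU] with a ha
  exact ((cotTriv (n := n) a₀.1).linear ℝ ha).map_add a.2 (α a.1)

/-- The lattice is closed in the cotangent bundle. -/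
theorem Lattice.isClosed_setOf_mem {Y : Type*} [TopologicalSpace Y] {f : Y → B}
    {β : ∀ y, Cot (n := n) (f y)} (hβ : Continuous fun y => cotMk (f y) (β y)) :
    IsClosed {y | β y ∈ P.fiber (f y)} := by
  rw [isClosed_iff_clusterPt]
  intro y₀ hy₀
  obtain ⟨F, hF⟩ := P.exists_frame_at (f y₀)
  have hf : Continuous f := (FiberBundle.continuous_proj _ _).comp hβ
  have hβ₀ : ContinuousWithinAt (fun y => cotMk (f y) (β y)) univ y₀ := hβ.continuousWithinAt
  have hcoord := F.continuousWithinAt_coord hF hβ₀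
  rw [continuousWithinAt_univ] at hcoord
  have hdom := hf.continuousAt.preimage_mem_nhds (F.isOpen_dom.mem_nhds hF)
  -- the integral vectors form a closed set
  have hint : F.coord (f y₀) (β y₀) ∈ range (fun c : Fin k → ℤ => fun i => (c i : ℝ)) := by
    have hcl : IsClosed (range (fun c : Fin k → ℤ => fun i => (c i : ℝ))) := by
      have h1 : range (fun c : Fin k → ℤ => fun i => (c i : ℝ)) =
          Set.pi univ fun _ => range ((↑) : ℤ → ℝ) := by
        ext v
        simp only [mem_range, mem_pi, mem_univ, true_implies]
        constructor
        · rintro ⟨c, rfl⟩ i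
          exact ⟨c i, rfl⟩
        · intro h
          choose c hc using h
          exact ⟨c, funext hc⟩
      rw [h1]
      exact isClosed_set_pi fun i _ => Int.isClosedEmbedding_coe_real.isClosed_range
    refine hcl.mem_of_frequently_of_tendsto (b := 𝓝 y₀) ?_ hcoord
    refine (Filter.Frequently.and_eventually (mem_closure_iff_frequently.1
      (mem_closure_iff_clusterPt.2 hy₀)) hdom).mono fun y hy => ?_
    obtain ⟨c, hc⟩ := (F.mem_iff _ hy.2 _).1 hy.1
    exact ⟨c, by rw [hc, F.coord_zsum hy.2]⟩
  obtain ⟨c, hc⟩ := hint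
  -- the difference to the combination of the frame with these coefficients
  have hγ : ContinuousWithinAt (fun y => cotMk (f y) (β y - ∑ i, F.coord (f y) (β y) i •
      F.vec i (f y))) univ y₀ := by
    refine continuousWithinAt_cot_sub hβ₀ (continuousWithinAt_cot_sum _ hf.continuousWithinAt
      fun i _ => continuousWithinAt_cot_smul ?_
        (F.continuousWithinAt_vec hF hf.continuousWithinAt i))
    exact ((continuous_apply i).continuousAt.comp hcoord).continuousWithinAt
  have h0 := mem_baseSet_trivializationAt (EuclDual n) (fun x : B => Cot (n := n) x) (f y₀)
  have hγ' := (continuousWithinAt_cot_iff.1 hγ).2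
  rw [continuousWithinAt_univ] at hγ'
  have hbase := hf.continuousAt.preimage_mem_nhds
    ((cotTriv (n := n) (f y₀)).open_baseSet.mem_nhds h0)
  have hzero : (cotTriv (f y₀) (cotMk (f y₀) (β y₀ - ∑ i, F.coord (f y₀) (β y₀) i •
      F.vec i (f y₀)))).2 ∈ ({0} : Set (EuclDual n)) := by
    refine isClosed_singleton.mem_of_frequently_of_tendsto (b := 𝓝 y₀) ?_ hγ'
    refine (Filter.Frequently.and_eventually (mem_closure_iff_frequently.1
      (mem_closure_iff_clusterPt.2 hy₀)) (Filter.inter_mem hdom hbase)).mono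
        fun y ⟨hy, hyd, hyb⟩ => ?_
    obtain ⟨c, hc⟩ := (F.mem_iff _ hyd _).1 hy
    have h1 : β y - ∑ i, F.coord (f y) (β y) i • F.vec i (f y) = 0 := by
      rw [hc, F.coord_zsum hyd, sub_eq_zero]
      exact Finset.sum_congr rfl fun i _ => (Int.cast_smul_eq_zsmul ℝ _ _).symm
    rw [h1]
    exact ((cotTriv (n := n) (f y₀)).linear ℝ hyb).map_zero
  have h2 : β y₀ - ∑ i, F.coord (f y₀) (β y₀) i • F.vec i (f y₀) = 0 := by
    have h3 : ((cotTriv (n := n) (f y₀)).continuousLinearEquivAt ℝ (f y₀) h0)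
        (β y₀ - ∑ i, F.coord (f y₀) (β y₀) i • F.vec i (f y₀)) = 0 := hzero
    exact (map_eq_zero_iff _ (ContinuousLinearEquiv.injective _)).1 h3
  refine (F.mem_iff _ hF _).2 ⟨c, ?_⟩
  rw [← hc, sub_eq_zero] at h2
  refine h2.trans (Finset.sum_congr rfl fun i _ => ?_)
  exact Int.cast_smul_eq_zsmul ℝ (c i) (F.vec i (f y₀))

end

section

variable {n : ℕ} {B : Type u} [TopologicalSpace B] [ChartedSpace (Eucl n) B]
  [IsManifold 𝓘(ℝ, Eucl n) ∞ B] {k : ℕ} {P : Lattice n B k}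

/-! ### The affine fibration given by smooth transition functions -/

namespace SmoothTwist

/-- The total space: as a set it is `T*B / P`. -/
def Total (_T : SmoothTwist P) : Type u := Σ x : B, P.QuotFiber x

variable (T : SmoothTwist P)

/-- The map `(x, α) ↦ [α] + g i x` from `T*B` to the total space. -/
def quot (i : T.ι) (a : CotBundle n B) : T.Total :=
  ⟨a.1, (a.2 : P.QuotFiber a.1) + T.g i a.1⟩

/-- The part of `T*B` over `V i`. -/
def region (i : T.ι) : Set (CotBundle n B) := {a | a.1 ∈ T.V i}

theorem isOpen_region (i : T.ι) : IsOpen (T.region i) :=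
  (T.isOpen i).preimage (FiberBundle.continuous_proj _ _)

/-- The finest topology for which each `T.quot i` is continuous over `T.V i`. The functions `g i`,
which need not be continuous for the quotient topology of `T*B / P`, become continuous sections. -/
instance : TopologicalSpace T.Total where
  IsOpen U := ∀ i, IsOpen (T.quot i ⁻¹' U ∩ T.region i)
  isOpen_univ i := by simpa using T.isOpen_region i
  isOpen_inter U U' h h' i := by
    rw [preimage_inter, inter_inter_distrib_right]
    exact (h i).inter (h' i)
  isOpen_sUnion S h i := by
    rw [preimage_sUnion, iUnion₂_inter]
    exact isOpen_biUnion fun U hU => h U hU i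

variable {T}

theorem continuousOn_quot (i : T.ι) : ContinuousOn (T.quot i) (T.region i) :=
  continuousOn_iff'.2 fun U hU => ⟨_, hU i, by rw [inter_assoc, inter_self]⟩

theorem quot_eq_quot_iff {i j : T.ι} {a a' : CotBundle n B} : T.quot i a = T.quot j a' ↔
    ∃ h : a'.1 = a.1, (a.2 : P.QuotFiber a.1) + T.g i a.1 =
      ((h ▸ a'.2 : Cot (n := n) a.1) : P.QuotFiber a.1) + T.g j a.1 := by
  obtain ⟨x, α⟩ := a
  obtain ⟨x', α'⟩ := a'
  constructor
  · intro h
    obtain ⟨h1, h2⟩ := Sigma.mk.inj_iff.1 h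
    change x = x' at h1
    subst h1
    exact ⟨rfl, eq_of_heq h2⟩
  · rintro ⟨h, h'⟩
    change x' = x at h
    subst h
    exact Sigma.ext rfl (heq_of_eq h')

theorem exists_quot_eq (z : T.Total) {i : T.ι} : ∃ a, T.quot i a = z := by
  obtain ⟨x, q⟩ := z
  obtain ⟨α, hα⟩ := QuotientAddGroup.mk_surjective (q - T.g i x)
  refine ⟨cotMk x α, Sigma.ext rfl (heq_of_eq ?_)⟩
  change (α : P.QuotFiber x) + T.g i x = q
  rw [hα, sub_add_cancel]

/-- Transition functions are locally translations by smooth forms. -/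
theorem exists_shift {i j : T.ι} {a₀ a₁ : CotBundle n B} (hi : a₀ ∈ T.region i)
    (hj : a₀ ∈ T.region j) (h : T.quot i a₀ = T.quot j a₁) :
    ∃ Φ : CotBundle n B → CotBundle n B, Φ a₀ = a₁ ∧
      ContMDiffAt (𝓘(ℝ, Eucl n).prod 𝓘(ℝ, EuclDual n))
        (𝓘(ℝ, Eucl n).prod 𝓘(ℝ, EuclDual n)) ∞ Φ a₀ ∧
      ∀ᶠ a in 𝓝 a₀, T.quot j (Φ a) = T.quot i a := by
  obtain ⟨x, α₀⟩ := a₀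
  obtain ⟨x', α₁⟩ := a₁
  obtain ⟨hx, h⟩ := quot_eq_quot_iff.1 h
  change x' = x at hx
  subst hx
  have hd := T.coe_diff i j x' ⟨hi, hj⟩
  -- Up to the form `T.diff i j`, the two representatives differ by a vector of the lattice.
  -- Continuing this vector with constant integral coordinates in a frame gives the translation near
  -- `x'`.
  have hp : α₁ - α₀ + T.diff i j x' ∈ P.fiber x' := by
    rw [← QuotientAddGroup.eq_zero_iff, QuotientAddGroup.mk_add, QuotientAddGroup.mk_sub, hd]
    have h' : (α₀ : P.QuotFiber x') + T.g i x' = (α₁ : P.QuotFiber x') + T.g j x' := h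
    have h'' : (α₁ : P.QuotFiber x') = (α₀ : P.QuotFiber x') + T.g i x' - T.g j x' :=
      eq_sub_of_add_eq h'.symm
    rw [h'']
    abel
  obtain ⟨F, hF⟩ := P.exists_frame_at x'
  obtain ⟨c, hc⟩ := (F.mem_iff _ hF _).1 hp
  have hs1 : ContMDiffAt 𝓘(ℝ, Eucl n) (𝓘(ℝ, Eucl n).prod 𝓘(ℝ, EuclDual n)) ∞
      (fun b => cotMk b (T.diff i j b)) x' :=
    (T.smooth i j).contMDiffAt (((T.isOpen i).inter (T.isOpen j)).mem_nhds ⟨hi, hj⟩)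
  have hs2 : ContMDiffAt 𝓘(ℝ, Eucl n) (𝓘(ℝ, Eucl n).prod 𝓘(ℝ, EuclDual n)) ∞
      (fun b => cotMk b (∑ l, (c l : ℝ) • F.vec l b)) x' :=
    ContMDiffAt.sum_section fun l _ => ContMDiffAt.const_smul_section
      ((F.smooth l).contMDiffAt (F.isOpen_dom.mem_nhds hF))
  refine ⟨shift fun b => (∑ l, (c l : ℝ) • F.vec l b) - T.diff i j b, ?_,
    contMDiffAt_shift (hs2.sub_section hs1), ?_⟩
  · have h1 : ∑ l, (c l : ℝ) • F.vec l x' = α₁ - α₀ + T.diff i j x' :=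
      (Finset.sum_congr rfl fun l _ => Int.cast_smul_eq_zsmul ℝ (c l) (F.vec l x')).trans hc.symm
    change cotMk x' (α₀ + ((∑ l, (c l : ℝ) • F.vec l x') - T.diff i j x')) = cotMk x' α₁
    rw [h1]
    congr 1
    abel
  · have hπ : Continuous (fun a : CotBundle n B => a.1) := FiberBundle.continuous_proj _ _
    filter_upwards [hπ.continuousAt.preimage_mem_nhds (Filter.inter_mem
      (F.isOpen_dom.mem_nhds hF) (((T.isOpen i).inter (T.isOpen j)).mem_nhds ⟨hi, hj⟩))]
      with ⟨y, α⟩ ⟨hy, hyij⟩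
    refine Sigma.ext rfl (heq_of_eq ?_)
    change ((α + ((∑ l, (c l : ℝ) • F.vec l y) - T.diff i j y) : Cot (n := n) y) :
      P.QuotFiber y) + T.g j y = (α : P.QuotFiber y) + T.g i y
    have h1 : ((∑ l, (c l : ℝ) • F.vec l y : Cot (n := n) y) : P.QuotFiber y) = 0 := by
      rw [QuotientAddGroup.eq_zero_iff]
      exact (F.mem_iff y hy _).2 ⟨c, Finset.sum_congr rfl fun l _ =>
        Int.cast_smul_eq_zsmul ℝ (c l) (F.vec l y)⟩
    rw [QuotientAddGroup.mk_add, QuotientAddGroup.mk_sub, h1, T.coe_diff i j y hyij]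
    abel

/-- Openness is tested through `T.quot j` for every `j`; near a given point `T.quot j` is `T.quot i`
composed with a continuous translation. -/
theorem isOpen_image_quot {i : T.ι} {O : Set (CotBundle n B)} (hO : IsOpen O)
    (hi : O ⊆ T.region i) : IsOpen (T.quot i '' O) := by
  intro j
  rw [isOpen_iff_mem_nhds]
  rintro a₀ ⟨⟨a₁, ha₁, h⟩, hj⟩
  have h1 : a₀ ∈ T.region i := by
    obtain ⟨hx, -⟩ := quot_eq_quot_iff.1 h
    have := hi ha₁
    change a₀.1 ∈ T.V i
    rwa [hx]
  obtain ⟨Φ, hΦ, hs, he⟩ := exists_shift hj h1 h.symm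
  have h2 : ∀ᶠ a in 𝓝 a₀, Φ a ∈ O :=
    hs.continuousAt.preimage_mem_nhds (hΦ ▸ hO.mem_nhds ha₁)
  filter_upwards [he, h2, (T.isOpen_region j).mem_nhds hj] with a h3 h4 h5
  exact ⟨⟨Φ a, h4, h3⟩, h5⟩

/-- Two covectors at one point with the same class differ by an integral combination of the frame.
If their coordinates lie in a common ball of radius `1 / 2`, the coefficients have absolute value
less than `1` and so vanish. -/
theorem exists_injOn_quot {i : T.ι} {a₀ : CotBundle n B} (h : a₀ ∈ T.region i) :
    ∃ O ⊆ T.region i, IsOpen O ∧ a₀ ∈ O ∧ InjOn (T.quot i) O := by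
  obtain ⟨F, hF⟩ := P.exists_frame_at a₀.1
  have hdom : IsOpen {a : CotBundle n B | a.1 ∈ F.dom} :=
    F.isOpen_dom.preimage (FiberBundle.continuous_proj _ _)
  refine ⟨T.region i ∩ ({a : CotBundle n B | a.1 ∈ F.dom} ∩
    (fun a : CotBundle n B => F.coord a.1 a.2) ⁻¹' Metric.ball (F.coord a₀.1 a₀.2) (1 / 2)),
    inter_subset_left, (T.isOpen_region i).inter
      (F.continuousOn_coord.isOpen_inter_preimage hdom Metric.isOpen_ball),
    ⟨h, hF, Metric.mem_ball_self (by norm_num)⟩, ?_⟩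
  rintro ⟨x, α⟩ ⟨-, hx, hα⟩ ⟨x', α'⟩ ⟨-, hx', hα'⟩ heq
  obtain ⟨hxx, heq⟩ := quot_eq_quot_iff.1 heq
  change x' = x at hxx
  subst hxx
  have h1 : (α : P.QuotFiber x') = (α' : P.QuotFiber x') := add_right_cancel heq
  have hp : α - α' ∈ P.fiber x' := by
    rw [← QuotientAddGroup.eq_zero_iff, QuotientAddGroup.mk_sub, h1, sub_self]
  obtain ⟨c, hc⟩ := (F.mem_iff _ hx _).1 hp
  have hd : dist (F.coord x' α) (F.coord x' α') < 1 :=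
    (dist_triangle_right _ _ (F.coord a₀.1 a₀.2)).trans_lt (by
      have := Metric.mem_ball.1 hα
      have := Metric.mem_ball.1 hα'
      simp only at *
      linarith)
  rw [dist_eq_norm, ← map_sub, hc, F.coord_zsum hx, pi_norm_lt_iff one_pos] at hd
  have hc0 : ∀ l, c l = 0 := fun l => by
    have := hd l
    rw [Real.norm_eq_abs] at this
    exact Int.abs_lt_one_iff.1 (by exact_mod_cast this)
  have : α = α' := by
    rw [← sub_eq_zero, hc]
    simp [hc0]
  rw [this]

/-- The local inverses of the maps `quot i`. -/
def IsLocalInv (φ : OpenPartialHomeomorph T.Total (CotBundle n B)) : Prop :=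
  ∃ i, φ.target ⊆ T.region i ∧ ∀ a, φ.symm a = T.quot i a

theorem exists_isLocalInv {i : T.ι} {a₀ : CotBundle n B} (h : a₀ ∈ T.region i) :
    ∃ φ : OpenPartialHomeomorph T.Total (CotBundle n B), IsLocalInv φ ∧
      a₀ ∈ φ.target ∧ (∀ a, φ.symm a = T.quot i a) := by
  obtain ⟨O, hOi, hO, haO, hinj⟩ := exists_injOn_quot h
  have : Nonempty (CotBundle n B) := ⟨a₀⟩
  have hopen : IsOpenMap (O.domRestrict (T.quot i)) := by
    intro S hS
    obtain ⟨S', hS', rfl⟩ := isOpen_induced_iff.1 hS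
    have : O.domRestrict (T.quot i) '' (Subtype.val ⁻¹' S') = T.quot i '' (O ∩ S') := by
      ext z
      constructor
      · rintro ⟨⟨a, ha⟩, ha', rfl⟩
        exact ⟨a, ⟨ha, ha'⟩, rfl⟩
      · rintro ⟨a, ⟨ha, ha'⟩, rfl⟩
        exact ⟨⟨a, ha⟩, ha', rfl⟩
    rw [this]
    exact isOpen_image_quot (hO.inter hS') (inter_subset_left.trans hOi)
  refine ⟨(OpenPartialHomeomorph.ofContinuousOpenRestrict (hinj.toPartialEquiv (T.quot i) O)
    ((continuousOn_quot i).mono hOi) hopen hO).symm, ⟨i, hOi, fun a => rfl⟩, haO, fun a => rfl⟩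

theorem exists_isLocalInv_at (z : T.Total) :
    ∃ φ : OpenPartialHomeomorph T.Total (CotBundle n B), IsLocalInv φ ∧ z ∈ φ.source := by
  obtain ⟨i, hi⟩ := T.exists_mem z.1
  obtain ⟨a, rfl⟩ := exists_quot_eq z (i := i)
  obtain ⟨φ, hφ, ha, h⟩ := exists_isLocalInv (T := T) (i := i) (a₀ := a) hi
  exact ⟨φ, hφ, h a ▸ φ.map_target ha⟩

instance instChartedSpaceCot : ChartedSpace (CotBundle n B) T.Total where
  atlas := {φ | IsLocalInv φ}
  chartAt z := (exists_isLocalInv_at z).choose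
  mem_chart_source z := (exists_isLocalInv_at z).choose_spec.2
  chart_mem_atlas z := (exists_isLocalInv_at z).choose_spec.1

theorem contMDiffOn_transition {φ φ' : OpenPartialHomeomorph T.Total (CotBundle n B)}
    (hφ : IsLocalInv φ) (hφ' : IsLocalInv φ') :
    ContMDiffOn (𝓘(ℝ, Eucl n).prod 𝓘(ℝ, EuclDual n)) (𝓘(ℝ, Eucl n).prod 𝓘(ℝ, EuclDual n)) ∞
      (φ.symm.trans φ') (φ.symm.trans φ').source := by
  obtain ⟨i, hi, hφi⟩ := hφ
  obtain ⟨j, hj, hφj⟩ := hφ'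
  intro a₀ ha₀
  rw [OpenPartialHomeomorph.trans_source] at ha₀
  obtain ⟨h1, h2⟩ := ha₀
  have h1 : a₀ ∈ φ.target := h1
  have h2 : φ.symm a₀ ∈ φ'.source := h2
  have h3 : T.quot i a₀ = T.quot j (φ' (φ.symm a₀)) := by
    rw [← hφj, φ'.left_inv h2, hφi]
  have h4 : a₀ ∈ T.region j := by
    have := hj (φ'.map_source h2)
    obtain ⟨hx, -⟩ := quot_eq_quot_iff.1 h3
    change a₀.1 ∈ T.V j
    rw [← hx]
    exact this
  obtain ⟨Φ, hΦ, hs, he⟩ := exists_shift (hi h1) h4 h3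
  refine (hs.congr_of_eventuallyEq ?_).contMDiffWithinAt
  have h5 : ∀ᶠ a in 𝓝 a₀, Φ a ∈ φ'.target :=
    hs.continuousAt.preimage_mem_nhds (hΦ ▸ φ'.open_target.mem_nhds (φ'.map_source h2))
  filter_upwards [he, h5] with a h6 h7
  change φ' (φ.symm a) = Φ a
  rw [hφi, ← h6, ← hφj, φ'.right_inv h7]

instance : ChartedSpace (ModelProd (Eucl n) (EuclDual n)) T.Total :=
  ChartedSpace.comp _ (CotBundle n B) _

instance : IsManifold (𝓘(ℝ, Eucl n).prod 𝓘(ℝ, EuclDual n)) ∞ T.Total :=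
  isManifold_comp (𝓘(ℝ, Eucl n).prod 𝓘(ℝ, EuclDual n)) (CotBundle n B) T.Total
    fun _ hφ _ hφ' => contMDiffOn_transition hφ hφ'

theorem contMDiffOn_isLocalInv {φ : OpenPartialHomeomorph T.Total (CotBundle n B)}
    (hφ : IsLocalInv φ) :
    ContMDiffOn (𝓘(ℝ, Eucl n).prod 𝓘(ℝ, EuclDual n)) (𝓘(ℝ, Eucl n).prod 𝓘(ℝ, EuclDual n)) ∞
      φ φ.source :=
  contMDiffOn_of_mem_atlas_comp _ inferInstance hφ

theorem contMDiffOn_isLocalInv_symm {φ : OpenPartialHomeomorph T.Total (CotBundle n B)}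
    (hφ : IsLocalInv φ) :
    ContMDiffOn (𝓘(ℝ, Eucl n).prod 𝓘(ℝ, EuclDual n)) (𝓘(ℝ, Eucl n).prod 𝓘(ℝ, EuclDual n)) ∞
      φ.symm φ.target :=
  contMDiffOn_symm_of_mem_atlas_comp _ inferInstance hφ

theorem isLocalDiffeomorphOn_quot (i : T.ι) :
    IsLocalDiffeomorphOn (𝓘(ℝ, Eucl n).prod 𝓘(ℝ, EuclDual n))
      (𝓘(ℝ, Eucl n).prod 𝓘(ℝ, EuclDual n)) ∞ (T.quot i) (T.region i) := by
  rintro ⟨a₀, h₀⟩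
  obtain ⟨φ, hφ, ha, h⟩ := exists_isLocalInv h₀
  exact ⟨⟨φ.symm.toPartialEquiv, φ.open_target, φ.open_source, contMDiffOn_isLocalInv_symm hφ,
    contMDiffOn_isLocalInv hφ⟩, ha, fun a _ => (h a).symm⟩

theorem contMDiff_fst : ContMDiff (𝓘(ℝ, Eucl n).prod 𝓘(ℝ, EuclDual n)) 𝓘(ℝ, Eucl n) ∞
    (fun z : T.Total => z.1) := by
  intro z
  obtain ⟨φ, hφ, hz⟩ := exists_isLocalInv_at z
  have hπ : ContMDiff (𝓘(ℝ, Eucl n).prod 𝓘(ℝ, EuclDual n)) 𝓘(ℝ, Eucl n) ∞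
      (fun a : CotBundle n B => a.1) := contMDiff_proj _
  refine (hπ.comp_contMDiffOn (contMDiffOn_isLocalInv hφ)).contMDiffAt
    (φ.open_source.mem_nhds hz) |>.congr_of_eventuallyEq ?_
  filter_upwards [φ.open_source.mem_nhds hz] with w hw
  obtain ⟨i, -, hi⟩ := hφ
  have := hi (φ w)
  rw [φ.left_inv hw] at this
  exact congrArg (fun z : T.Total => z.1) this

end SmoothTwist

end

/-! ### Separation and countability of the total space, and the fibrewise action. -/

section

variable {n : ℕ} {B : Type u} [TopologicalSpace B] [ChartedSpace (Eucl n) B]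
  [IsManifold 𝓘(ℝ, Eucl n) ∞ B] {k : ℕ} {P : Lattice n B k}

theorem secondCountableTopology_cotBundle [SecondCountableTopology B] :
    SecondCountableTopology (CotBundle n B) := by
  obtain ⟨s, hs, hcov⟩ := countable_cover_nhds fun x : B =>
    Filter.inter_mem (chart_source_mem_nhds (Eucl n) x)
      ((cotTriv (n := n) x).open_baseSet.mem_nhds (mem_baseSet_trivializationAt _ _ x))
  have : SecondCountableTopology (ModelProd (Eucl n) (EuclDual n)) :=
    inferInstanceAs (SecondCountableTopology (Eucl n × EuclDual n))
  refine ChartedSpace.secondCountable_of_countable_cover (ModelProd (Eucl n) (EuclDual n))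
    (s := (fun x => cotMk x 0) '' s) ?_ (hs.image _)
  refine eq_univ_of_forall fun a => ?_
  have ha : a.1 ∈ ⋃ x ∈ s, ((chartAt (Eucl n) x).source ∩ (cotTriv (n := n) x).baseSet) :=
    hcov ▸ mem_univ a.1
  simp only [mem_iUnion] at ha
  obtain ⟨x, hx, hax⟩ := ha
  simp only [mem_iUnion]
  refine ⟨_, mem_image_of_mem _ hx, ?_⟩
  rw [FiberBundle.chartedSpace_chartAt]
  rw [OpenPartialHomeomorph.trans_source]
  refine ⟨(Trivialization.mem_source _).2 hax.2, ?_⟩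
  rw [mem_preimage, OpenPartialHomeomorph.prod_source]
  refine ⟨?_, mem_univ _⟩
  rw [Trivialization.coe_coe, Trivialization.coe_fst' _ hax.2]
  exact hax.1

namespace SmoothTwist

variable {T : SmoothTwist P}

theorem continuous_base : Continuous fun z : T.Total => z.1 := contMDiff_fst.continuous

/-- Points over different base points are separated in `B`. For two points of one fibre, the pairs
of covectors over a common base point that differ by an element of `P` form a closed set in the
fibre product. A product neighbourhood that avoids this set has disjoint images under the open map
`T.quot i`. -/
instance [T2Space B] : T2Space T.Total := by
  refine ⟨fun z z' hne => ?_⟩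
  by_cases hx : z.1 = z'.1
  · obtain ⟨i, hi⟩ := T.exists_mem z.1
    obtain ⟨a, rfl⟩ := exists_quot_eq z (i := i)
    obtain ⟨a', rfl⟩ := exists_quot_eq z' (i := i)
    obtain ⟨x, α⟩ := a
    obtain ⟨x', α'⟩ := a'
    change x = x' at hx
    subst hx
    have hi : x ∈ T.V i := hi
    set Y := {p : CotBundle n B × CotBundle n B // p.1.1 = p.2.1}
    have hc1 : Continuous fun p : Y => cotMk p.1.1.1 p.1.1.2 :=
      continuous_fst.comp continuous_subtype_val
    have hc2 : Continuous fun p : Y => cotMk p.1.1.1 (p.2 ▸ p.1.2.2 : Cot (n := n) p.1.1.1) := by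
      have h1 : Continuous fun p : Y => p.1.2 := continuous_snd.comp continuous_subtype_val
      refine h1.congr ?_
      rintro ⟨⟨⟨y, β⟩, ⟨y', β'⟩⟩, h⟩
      change y = y' at h
      subst h
      rfl
    have hcl := Lattice.isClosed_setOf_mem (P := P) (f := fun p : Y => p.1.1.1)
      (continuous_add_cot hc1 (continuous_neg_cot hc2))
    have hnot : (⟨(⟨x, α⟩, ⟨x, α'⟩), rfl⟩ : Y) ∈ {p : Y | p.1.1.2 +
        -(p.2 ▸ p.1.2.2 : Cot (n := n) p.1.1.1) ∈ P.fiber p.1.1.1}ᶜ := by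
      intro h
      have h : α + -α' ∈ P.fiber x := h
      refine hne (Sigma.ext rfl (heq_of_eq ?_))
      change (α : P.QuotFiber x) + T.g i x = (α' : P.QuotFiber x) + T.g i x
      rw [← QuotientAddGroup.eq_zero_iff, QuotientAddGroup.mk_add, QuotientAddGroup.mk_neg,
        ← sub_eq_add_neg, sub_eq_zero] at h
      rw [h]
    obtain ⟨W, hW, hWeq⟩ := isOpen_induced_iff.1 hcl.isOpen_compl
    have hmem : ((⟨x, α⟩, ⟨x, α'⟩) : CotBundle n B × CotBundle n B) ∈ W := by
      rw [← hWeq] at hnot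
      exact hnot
    obtain ⟨O, O', hO, hO', hα, hα', hsub⟩ := isOpen_prod_iff.1 hW _ _ hmem
    refine ⟨T.quot i '' (O ∩ T.region i), T.quot i '' (O' ∩ T.region i),
      isOpen_image_quot (hO.inter (T.isOpen_region i)) inter_subset_right,
      isOpen_image_quot (hO'.inter (T.isOpen_region i)) inter_subset_right,
      ⟨_, ⟨hα, hi⟩, rfl⟩, ⟨_, ⟨hα', hi⟩, rfl⟩, ?_⟩
    rw [Set.disjoint_left]
    rintro _ ⟨⟨y, β⟩, ⟨hβ, -⟩, rfl⟩ ⟨⟨y', β'⟩, ⟨hβ', -⟩, heq⟩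
    obtain ⟨hyy, heq⟩ := quot_eq_quot_iff.1 heq
    change y = y' at hyy
    subst hyy
    have h1 : (⟨(⟨y, β⟩, ⟨y, β'⟩), rfl⟩ : Y) ∈ (Subtype.val ⁻¹' W : Set Y) := hsub ⟨hβ, hβ'⟩
    rw [hWeq] at h1
    refine h1 ?_
    change β + -β' ∈ P.fiber y
    have h2 : (β' : P.QuotFiber y) = (β : P.QuotFiber y) := add_right_cancel heq
    rw [← QuotientAddGroup.eq_zero_iff, QuotientAddGroup.mk_add, QuotientAddGroup.mk_neg, h2,
      add_neg_cancel]
  · obtain ⟨u, v, hu, hv, hzu, hzv, huv⟩ := t2_separation hx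
    exact ⟨_, _, hu.preimage continuous_base, hv.preimage continuous_base, hzu, hzv,
      huv.preimage _⟩

theorem isOpen_over (i : T.ι) : IsOpen {z : T.Total | z.1 ∈ T.V i} :=
  (T.isOpen i).preimage continuous_base

/-- Over each `T.V i` the total space is an open quotient of an open part of `T*B`, and countably
many of these sets cover. -/
instance [SecondCountableTopology B] : SecondCountableTopology T.Total := by
  have := secondCountableTopology_cotBundle (n := n) (B := B)
  choose idx hidx using T.exists_mem
  obtain ⟨s, hs, hcov⟩ := countable_cover_nhds fun x : B => (T.isOpen (idx x)).mem_nhds (hidx x)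
  have := hs.to_subtype
  have h1 : ∀ x : s, SecondCountableTopology {z : T.Total | z.1 ∈ T.V (idx x)} := by
    intro x
    set i := idx x
    let q : T.region i → {z : T.Total | z.1 ∈ T.V i} := fun a => ⟨T.quot i a.1, a.2⟩
    have hc : Continuous q := Continuous.subtype_mk
      (continuousOn_iff_continuous_domRestrict.1 (continuousOn_quot i)) _
    have ho : IsOpenMap q := by
      intro S hS
      obtain ⟨S', hS', rfl⟩ := isOpen_induced_iff.1 hS
      refine isOpen_induced_iff.2 ⟨T.quot i '' (S' ∩ T.region i),
        isOpen_image_quot (hS'.inter (T.isOpen_region i)) inter_subset_right, ?_⟩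
      ext ⟨z, hz⟩
      constructor
      · rintro ⟨a, ⟨ha, hai⟩, haz⟩
        exact ⟨⟨a, hai⟩, ha, Subtype.ext haz⟩
      · rintro ⟨⟨a, hai⟩, ha, haz⟩
        exact ⟨a, ⟨ha, hai⟩, congrArg Subtype.val haz⟩
    have hsurj : Function.Surjective q := by
      rintro ⟨z, hz⟩
      obtain ⟨a, rfl⟩ := exists_quot_eq z (i := i)
      exact ⟨⟨a, hz⟩, rfl⟩
    exact (ho.isQuotientMap hc hsurj).secondCountableTopology ho
  refine TopologicalSpace.secondCountableTopology_of_countable_cover (U := fun x : s =>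
    {z : T.Total | z.1 ∈ T.V (idx x)}) (fun x => isOpen_over _) (eq_univ_of_forall fun z => ?_)
  have hz : z.1 ∈ ⋃ x ∈ s, T.V (idx x) := hcov ▸ mem_univ z.1
  simp only [mem_iUnion] at hz
  obtain ⟨x, hx, hz⟩ := hz
  exact mem_iUnion.2 ⟨⟨x, hx⟩, hz⟩

/-- The fibres of the total space. -/
def fiberEquiv (x : B) : {z : T.Total // z.1 = x} ≃ P.QuotFiber x where
  toFun z := z.2 ▸ z.1.2
  invFun q := ⟨⟨x, q⟩, rfl⟩
  left_inv := by
    rintro ⟨⟨y, q⟩, h⟩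
    change y = x at h
    subst h
    rfl
  right_inv _ := rfl

instance (x : B) : AddAction (P.QuotFiber x) {z : T.Total // z.1 = x} where
  vadd v z := (fiberEquiv x).symm (v + fiberEquiv x z)
  zero_vadd z := by
    change (fiberEquiv x).symm (0 + fiberEquiv x z) = z
    rw [zero_add, Equiv.symm_apply_apply]
  add_vadd v w z := by
    change (fiberEquiv x).symm (v + w + fiberEquiv x z) =
      (fiberEquiv x).symm (v + fiberEquiv x ((fiberEquiv x).symm (w + fiberEquiv x z)))
    rw [Equiv.apply_symm_apply, add_assoc]

theorem vadd_def (x : B) (v : P.QuotFiber x) (z : {z : T.Total // z.1 = x}) :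
    v +ᵥ z = (fiberEquiv x).symm (v + fiberEquiv x z) := rfl

variable (T)

/-- The affine fibration given by smooth transition functions. -/
def affineFibration [T2Space B] [SecondCountableTopology B] : AffineFibration P where
  Total := T.Total
  proj z := z.1
  contMDiff_proj := contMDiff_fst
  regular x z w := by
    refine ⟨fiberEquiv x w - fiberEquiv x z, ?_, fun v hv => ?_⟩
    · simp only [vadd_def, sub_add_cancel, Equiv.symm_apply_apply]
    · simp only [vadd_def] at hv
      rw [← hv, Equiv.apply_symm_apply, add_sub_cancel_right]
  locally_trivial x := by
    obtain ⟨i, hi⟩ := T.exists_mem x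
    exact ⟨T.V i, T.isOpen i, hi, fun y => (fiberEquiv y).symm (T.g i y),
      isLocalDiffeomorphOn_quot i⟩

end SmoothTwist

end

section

variable {n : ℕ} {B : Type u} [TopologicalSpace B] [ChartedSpace (Eucl n) B]
  [IsManifold 𝓘(ℝ, Eucl n) ∞ B] {k : ℕ} {P : Lattice n B k}

/-! ### Sections of the affine fibration and their obstruction cochains -/

theorem exists_circle_lift_at {Y : Type*} [TopologicalSpace Y] {f : Y → UnitAddCircle} {y₀ : Y}
    (hf : ContinuousAt f y₀) :
    ∃ L : Y → ℝ, ContinuousAt L y₀ ∧ ∀ᶠ y in 𝓝 y₀, (L y : UnitAddCircle) = f y := by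
  obtain ⟨r, hr⟩ := QuotientAddGroup.mk_surjective (f y₀)
  set e := AddCircle.openPartialHomeomorphCoe (1 : ℝ) (r - 1 / 2)
  have h1 : f y₀ ∈ e.target := by
    rw [← hr]
    exact e.map_source (x := r) ⟨by linarith, by linarith⟩
  refine ⟨fun y => e.symm (f y), (e.symm.continuousAt h1).comp hf, ?_⟩
  filter_upwards [hf.preimage_mem_nhds (e.open_target.mem_nhds h1)] with y hy
  exact e.right_inv hy

namespace Lattice

theorem push_add {m : ℕ} (σ : C(Cube m, B)) (t : Cube m) (a a' : CircleMod (P.along σ)) :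
    P.push σ t (a + a') = P.push σ t a + P.push σ t a' := rfl

theorem push_pull {m : ℕ} (σ : C(Cube m, B)) (g : ∀ b, CircleMod (P.fiber b)) (t : Cube m) :
    P.push σ t (P.pull σ g t) = g (σ t) := by
  ext ξ
  rw [push_apply, pull_apply]
  congr 1
  ext x
  simp

theorem mk_sum_smul_val {m : ℕ} (σ : C(Cube m, B)) (t : Cube m) (a : CircleMod (P.along σ))
    {L : Fin k → ℝ}
    (hL : ∀ j, (L j : UnitAddCircle) = a (coordHom (P.basisAlong σ) j)) :
    ((∑ j, L j • (P.basisAlong σ j).val t : Cot (n := n) (σ t)) : P.QuotFiber (σ t)) =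
      circleToQuot (P.push σ t a) := by
  refine mk_sum_smul ((P.basisAlong σ).map (P.ev σ t).toIntLinearEquiv) _ fun j => ?_
  rw [hL, push_apply]
  congr 1
  refine intDual_ext (P.basisAlong σ) fun i => ?_
  rw [coordHom_apply_basis]
  exact (coordHom_apply_basis ((P.basisAlong σ).map (P.ev σ t).toIntLinearEquiv) i j).symm

theorem exists_lift_along {m : ℕ} (σ : C(Cube m, B)) {f : Cube m → CircleMod (P.along σ)}
    {t₀ : Cube m} (hf : ∀ ξ, ContinuousAt (fun t => f t ξ) t₀) :
    ∃ α : ∀ t, Cot (n := n) (σ t), ContinuousAt (fun t => cotMk (σ t) (α t)) t₀ ∧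
      ∀ᶠ t in 𝓝 t₀, (α t : P.QuotFiber (σ t)) = circleToQuot (P.push σ t (f t)) := by
  choose L hL hLf using fun j => exists_circle_lift_at (hf (coordHom (P.basisAlong σ) j))
  refine ⟨fun t => ∑ j, L j t • (P.basisAlong σ j).val t, ?_, ?_⟩
  · rw [← continuousWithinAt_univ]
    exact continuousWithinAt_cot_sum _ σ.continuous.continuousWithinAt fun j _ =>
      continuousWithinAt_cot_smul (hL j).continuousWithinAt
        (along_continuous _).continuousWithinAt
  · filter_upwards [Filter.eventually_all.2 hLf] with t ht
    exact mk_sum_smul_val σ t (f t) ht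

/-- The minus sign is that of `angleSec`. It is what makes the zero section, compared with the
section over a `2`-cell, wind positively. -/
theorem circleToQuot_push_angleSec (σ : C(Cube 2, B)) (p : P.along σ) {t : Cube 2} {r : ℝ}
    (h : (angle t : UnitAddCircle) = r) : circleToQuot (P.push σ t (angleSec p t)) =
      -((r • p.val t : Cot (n := n) (σ t)) : P.QuotFiber (σ t)) := by
  rw [← mk_sum_smul_val σ t _ (L := fun j => -(coordHom (P.basisAlong σ) j p * r)) fun j => by
    rw [angleSec_apply, h, AddCircle.coe_neg, ← zsmul_eq_mul, AddCircle.coe_zsmul],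
    ← QuotientAddGroup.mk_neg]
  congr 1
  have h1 : p.val t = ∑ j, (coordHom (P.basisAlong σ) j p : ℝ) • (P.basisAlong σ j).val t := by
    have h2 : (P.ev σ t p : Cot (n := n) (σ t)) = _ :=
      congrArg (fun q => (P.ev σ t q : Cot (n := n) (σ t))) (eq_sum_coordHom (P.basisAlong σ) p)
    rw [coe_ev] at h2
    rw [h2, map_sum]
    simp only [AddSubgroup.val_finsetSum, map_zsmul, AddSubgroup.coe_zsmul, coe_ev]
    exact Finset.sum_congr rfl fun j _ => (Int.cast_smul_eq_zsmul ℝ _ _).symm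
  rw [h1, Finset.smul_sum, ← Finset.sum_neg_distrib]
  refine Finset.sum_congr rfl fun j _ => ?_
  rw [smul_smul, mul_comm]
  exact neg_smul (r * (coordHom (P.basisAlong σ) j p : ℝ)) ((P.basisAlong σ j).val t)

end Lattice

theorem continuous_boundaryLoop : Continuous boundaryLoop := by
  unfold boundaryLoop
  refine continuous_pi fun i => ?_
  fin_cases i
  · exact (continuous_projIcc (h := by norm_num)).comp
      (by fun_prop : Continuous fun θ : ℝ => 2 - |θ - 3|)
  · exact (continuous_projIcc (h := by norm_num)).comp
      (by fun_prop : Continuous fun θ : ℝ => 2 - |θ - 5|)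

theorem boundaryLoop_eight : boundaryLoop 8 = boundaryLoop 0 := by
  unfold boundaryLoop
  norm_num [Set.projIcc]

theorem boundaryLoop_mem_bdry (θ : ℝ) : boundaryLoop θ ∈ bdry 2 := by
  have h : ∀ a : ℝ, 1 ≤ a → Set.projIcc (-1 : ℝ) 1 (by norm_num) a = endpoint true := fun a ha =>
    Set.projIcc_of_right_le _ ha
  have h' : ∀ a : ℝ, a ≤ -1 → Set.projIcc (-1 : ℝ) 1 (by norm_num) a = endpoint false :=
    fun a ha => Set.projIcc_of_le_left _ ha
  rcases le_total θ 2 with h2 | h2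
  · exact ⟨1, false, h' _ (by rw [abs_of_nonpos (by linarith)]; linarith)⟩
  rcases le_total θ 4 with h4 | h4
  · refine ⟨0, true, h _ ?_⟩
    have : |θ - 3| ≤ 1 := abs_le.2 ⟨by linarith, by linarith⟩
    linarith
  rcases le_total θ 6 with h6 | h6
  · refine ⟨1, true, h _ ?_⟩
    have : |θ - 5| ≤ 1 := abs_le.2 ⟨by linarith, by linarith⟩
    linarith
  · exact ⟨0, false, h' _ (by rw [abs_of_nonneg (by linarith)]; linarith)⟩

namespace SmoothTwist

variable {T : SmoothTwist P}

variable (T) in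
/-- The point of the total space over `x` that is given by `q`. -/
def point (x : B) (q : P.QuotFiber x) : T.Total := ⟨x, q⟩

/-- The topology of the total space is visible only relative to the functions `T.g i`: a section is
continuous if its difference to `T.g i` lifts to a continuous family of covectors, because it is
then the composite of this family with `T.quot i`. -/
theorem continuousWithinAt_section {Y : Type*} [TopologicalSpace Y] {f : Y → B} {S : Set Y}
    {y₀ : Y} (hy₀ : y₀ ∈ S) {i : T.ι} (hi : f y₀ ∈ T.V i) {α : ∀ y, Cot (n := n) (f y)}
    (hα : ContinuousWithinAt (fun y => cotMk (f y) (α y)) S y₀) {τ : ∀ y, P.QuotFiber (f y)}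
    (hτ : ∀ᶠ y in 𝓝[S] y₀, τ y = (α y : P.QuotFiber (f y)) + T.g i (f y)) :
    ContinuousWithinAt (fun y => T.point (f y) (τ y)) S y₀ := by
  have h1 : ContinuousAt (T.quot i) (cotMk (f y₀) (α y₀)) :=
    (continuousOn_quot i).continuousAt ((T.isOpen_region i).mem_nhds hi)
  refine (h1.comp_continuousWithinAt (f := fun y => cotMk (f y) (α y)) hα).congr_of_eventuallyEq
    ?_ ?_
  · filter_upwards [hτ] with y hy
    exact Sigma.ext rfl (heq_of_eq hy)
  · exact Sigma.ext rfl (heq_of_eq (hτ.self_of_nhdsWithin hy₀))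

variable [T2Space B] [SecondCountableTopology B] [CWComplex (univ : Set B)] {G : P.TwistData}
  {c : T.ι → CellIdx B} {h : T.ι → ∀ b : B, Cot (n := n) b}

/-- Over the `1`-skeleton the data `G` vanish, so `T.g i` is the class of the continuous form `h i`
there, and `0` is represented by `-h i`. -/
theorem isSectionOverOneSkeleton_zero
    (hh : ∀ i, ContinuousOn (fun b => cotMk b (h i b)) (T.V i))
    (hg : ∀ i b, T.g i b = circleToQuot (G (c i) b) + (h i b : P.QuotFiber b))
    (hG : ∀ b ∈ skel B 1, ∀ i, G i b = 0) :
    T.affineFibration.IsSectionOverOneSkeleton fun b => T.point b 0 := by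
  refine ⟨fun b₀ hb₀ => ?_, fun b _ => rfl⟩
  obtain ⟨i, hi⟩ := T.exists_mem b₀
  refine continuousWithinAt_section (T := T) (f := fun b => b) (α := fun b => -h i b)
    (τ := fun b => 0) hb₀ hi
    (continuousWithinAt_cot_neg (f := fun b : B => b) ((hh i).continuousAt
      ((T.isOpen i).mem_nhds hi)).continuousWithinAt) ?_
  filter_upwards [self_mem_nhdsWithin] with b hb
  rw [hg, hG b hb, circleToQuot_zero, QuotientAddGroup.mk_neg]
  abel

/-- The difference `s - G (c i)` is continuous and lifts locally to covectors `α`. Then `α - h i`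
represents the image of `s` relative to `T.g i`. -/
theorem continuous_section (hc : ∀ i, T.V i ⊆ cellStar (c i))
    (hh : ∀ i, ContinuousOn (fun b => cotMk b (h i b)) (T.V i))
    (hg : ∀ i b, T.g i b = circleToQuot (G (c i) b) + (h i b : P.QuotFiber b)) {m : ℕ}
    {σ : C(Cube m, B)} {s : Cube m → CircleMod (P.along σ)} (hs : IsSecAlong G σ univ s) :
    Continuous fun t => T.point (σ t) (circleToQuot (P.push σ t (s t))) := by
  rw [← continuousOn_univ]
  intro t₀ _
  obtain ⟨i, hi⟩ := T.exists_mem (σ t₀)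
  have h1 : ∀ ξ, ContinuousAt (fun t => (s t - P.pull σ (G (c i)) t) ξ) t₀ := fun ξ =>
    (hs ξ (c i)).continuousAt (by
      rw [univ_inter]
      exact (isOpen_preimage_cellStar σ (c i)).mem_nhds (hc i hi))
  obtain ⟨α, hα, hαs⟩ := Lattice.exists_lift_along σ h1
  have hhσ : ContinuousAt (fun t => cotMk (σ t) (h i (σ t))) t₀ :=
    ContinuousAt.comp (f := σ) (g := fun b => cotMk b (h i b))
      ((hh i).continuousAt ((T.isOpen i).mem_nhds hi)) σ.continuous.continuousAt
  refine continuousWithinAt_section (T := T) (mem_univ _) hi (α := fun t => α t - h i (σ t))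
    (continuousWithinAt_cot_sub hα.continuousWithinAt hhσ.continuousWithinAt) ?_
  rw [nhdsWithin_univ]
  filter_upwards [hαs] with t ht
  have h2 : P.push σ t (s t) = P.push σ t (s t - P.pull σ (G (c i)) t) + G (c i) (σ t) := by
    rw [← Lattice.push_pull σ (G (c i)) t, ← Lattice.push_add, sub_add_cancel]
  rw [h2, circleToQuot_add, ← ht, hg, QuotientAddGroup.mk_sub]
  abel

open Classical in
-- On the boundary of the cell the section over it is `-(θ / 8) z e`, so the zero section is its
-- translate by `a(θ) = (θ / 8) z e`, and `a(8) - a(0) = z e`.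
theorem isObstructionCochain_zero (hc : ∀ i, T.V i ⊆ cellStar (c i))
    (hh : ∀ i, ContinuousOn (fun b => cotMk b (h i b)) (T.V i))
    (hg : ∀ i b, T.g i b = circleToQuot (G (c i) b) + (h i b : P.QuotFiber b))
    {z : P.CellCochain 2} (hG : ∀ e : Cell B 2, IsSecAlong G (charMap e) univ
      fun y => if y ∈ bdry 2 then angleSec (z e) y else 0) :
    T.affineFibration.IsObstructionCochain (fun b => T.point b 0) z := by
  intro e
  set s : Cube 2 → CircleMod (P.along (charMap e)) :=
    fun y => if y ∈ bdry 2 then angleSec (z e) y else 0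
  refine ⟨fun x => ⟨T.point (charMap e x) (circleToQuot (P.push (charMap e) x (s x))), rfl⟩,
    continuous_section hc hh hg (hG e), fun θ => (θ / 8) • (z e).val (boundaryLoop θ), ?_, ?_, ?_⟩
  · intro θ _
    refine continuousWithinAt_cot_smul (f := fun θ => charMap e (boundaryLoop θ))
      (by fun_prop) ?_
    exact ((Lattice.along_continuous (z e)).comp continuous_boundaryLoop).continuousWithinAt
  · intro θ hθ
    refine Sigma.ext rfl (heq_of_eq ?_)
    change 0 = (((θ / 8) • (z e).val (boundaryLoop θ) : Cot (n := n) _) :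
      P.QuotFiber (charMap e (boundaryLoop θ))) +
        circleToQuot (P.push (charMap e) (boundaryLoop θ) (s (boundaryLoop θ)))
    have h1 : s (boundaryLoop θ) = angleSec (z e) (boundaryLoop θ) :=
      if_pos (boundaryLoop_mem_bdry θ)
    rw [h1, Lattice.circleToQuot_push_angleSec _ _ (coe_angle_boundaryLoop hθ), add_neg_cancel]
  · have h1 : ∀ y y', y = y' → cotMk (charMap e y) ((8 / 8 : ℝ) • (z e).val y) =
        cotMk (charMap e y') ((0 / 8 : ℝ) • (z e).val y' + (z e).val y') := by
      rintro y _ rfl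
      norm_num
    exact h1 _ _ boundaryLoop_eight

end SmoothTwist

end

section

variable {n : ℕ} {B : Type u} [TopologicalSpace B] [ChartedSpace (Eucl n) B]
  [IsManifold 𝓘(ℝ, Eucl n) ∞ B] {k : ℕ} {P : Lattice n B k}

/-! ### Differences of sections of an affine fibration -/

namespace AffineFibration

variable (E : AffineFibration P)

/-- The points `z` and `w` of the fibre over `x` differ by the class of the covector `α`. -/
def IsDiff (x : B) (α : Cot (n := n) x) (z w : E.Total) : Prop :=
  ∃ (hz : E.proj z = x) (hw : E.proj w = x),
    (α : P.QuotFiber x) +ᵥ (⟨z, hz⟩ : E.Fiber x) = ⟨w, hw⟩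

variable {E} {x : B} {α β : Cot (n := n) x} {z w u : E.Total}

theorem IsDiff.add (h : E.IsDiff x α z w) (h' : E.IsDiff x β w u) : E.IsDiff x (β + α) z u := by
  obtain ⟨hz, hw, h⟩ := h
  obtain ⟨_, hu, h'⟩ := h'
  refine ⟨hz, hu, ?_⟩
  rw [QuotientAddGroup.mk_add, add_vadd, h, h']

theorem IsDiff.sub (h : E.IsDiff x α z w) (h' : E.IsDiff x β z u) : E.IsDiff x (β - α) w u := by
  obtain ⟨hz, hw, h⟩ := h
  obtain ⟨_, hu, h'⟩ := h'
  refine ⟨hw, hu, ?_⟩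
  rw [← h, QuotientAddGroup.mk_sub, ← add_vadd, sub_add_cancel, h']

variable (E) in
theorem exists_isDiff (hz : E.proj z = x) (hw : E.proj w = x) : ∃ α, E.IsDiff x α z w := by
  obtain ⟨v, hv, -⟩ := E.regular x ⟨z, hz⟩ ⟨w, hw⟩
  obtain ⟨α, rfl⟩ := QuotientAddGroup.mk_surjective v
  exact ⟨α, hz, hw, hv⟩

theorem IsDiff.sub_mem_iff (h : E.IsDiff x α z w) : E.IsDiff x β z w ↔ β - α ∈ P.fiber x := by
  have h1 : β - α ∈ P.fiber x ↔ (β : P.QuotFiber x) = α := by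
    rw [← QuotientAddGroup.eq_zero_iff, QuotientAddGroup.mk_sub, sub_eq_zero]
  obtain ⟨hz, hw, h⟩ := h
  rw [h1]
  constructor
  · rintro ⟨_, _, h'⟩
    exact (E.regular x ⟨z, hz⟩ ⟨w, hw⟩).unique h' h
  · intro h'
    exact ⟨hz, hw, by rw [h', h]⟩

theorem IsDiff.sub_mem (h : E.IsDiff x α z w) (h' : E.IsDiff x β z w) : β - α ∈ P.fiber x :=
  h.sub_mem_iff.1 h'

/-- A section that is given by a local trivialization has local lifts to `T*B`. -/
theorem exists_isDiff_of_isLocalDiffeomorphOn {Y : Type*} [TopologicalSpace Y] {f : Y → B}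
    {s : Y → E.Total} (hs : Continuous s) (hf : ∀ y, E.proj (s y) = f y) {U : Set B}
    {r : ∀ b, E.Fiber b}
    (hr : IsLocalDiffeomorphOn (𝓘(ℝ, Eucl n).prod 𝓘(ℝ, EuclDual n))
        (𝓘(ℝ, Eucl n).prod 𝓘(ℝ, EuclDual n)) ∞
        (fun a : CotBundle n B => (((a.2 : P.QuotFiber a.1) +ᵥ r a.1 : E.Fiber a.1) : E.Total))
        {a : CotBundle n B | a.1 ∈ U}) {y₀ : Y} (hy₀ : f y₀ ∈ U) :
    ∃ O ∈ 𝓝 y₀, ∃ α : ∀ y, Cot (n := n) (f y), ContinuousOn (fun y => cotMk (f y) (α y)) O ∧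
      ∀ y ∈ O, E.IsDiff (f y) (α y) (r (f y)) (s y) := by
  obtain ⟨α₀, _, _, h₀⟩ := E.exists_isDiff (r (f y₀)).2 (hf y₀)
  obtain ⟨Φ, hΦ, hEq⟩ := hr ⟨cotMk (f y₀) α₀, hy₀⟩
  have h1 : Φ (cotMk (f y₀) α₀) = s y₀ :=
    (hEq hΦ).symm.trans (congrArg Subtype.val h₀)
  have hmem : s y₀ ∈ Φ.target := h1 ▸ Φ.map_source hΦ
  have hinv : ∀ y ∈ s ⁻¹' Φ.target,
      (((Φ.symm (s y)).2 : P.QuotFiber (Φ.symm (s y)).1) +ᵥ r (Φ.symm (s y)).1 :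
        E.Fiber (Φ.symm (s y)).1).1 = s y := fun y hy =>
    (hEq (Φ.map_target hy)).trans (Φ.right_inv hy)
  have key : ∀ y, ∃ α : Cot (n := n) (f y), y ∈ s ⁻¹' Φ.target →
      cotMk (f y) α = Φ.symm (s y) ∧ E.IsDiff (f y) α (r (f y)) (s y) := by
    intro y
    by_cases hy : y ∈ s ⁻¹' Φ.target
    · have h2 := hinv y hy
      generalize Φ.symm (s y) = A at h2
      obtain ⟨b, α⟩ := A
      obtain rfl : b = f y := by
        rw [← hf y, ← h2]
        exact ((((α : P.QuotFiber b) +ᵥ r b : E.Fiber b)).2).symm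
      exact ⟨α, fun _ => ⟨rfl, (r (f y)).2, hf y, Subtype.ext h2⟩⟩
    · exact ⟨0, fun h => (hy h).elim⟩
  choose α hα using key
  refine ⟨s ⁻¹' Φ.target, hs.continuousAt.preimage_mem_nhds (Φ.open_target.mem_nhds hmem), α, ?_,
    fun y hy => (hα y hy).2⟩
  exact (Φ.contMDiffOn_invFun.continuousOn.comp hs.continuousOn fun y hy => hy).congr
    fun y hy => (hα y hy).1

variable (E) in
/-- `q` is a lift to `T*B` of the difference of the sections `s` and `s'` along `σ`. -/
def IsDiffAlong {m : ℕ} (σ : C(Cube m, B)) (s s' : Cube m → E.Total)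
    (q : ∀ t, Cot (n := n) (σ t)) : Prop :=
  Continuous (fun t => cotMk (σ t) (q t)) ∧ ∀ t, E.IsDiff (σ t) (q t) (s t) (s' t)

/-- The covectors that represent the difference form a coset of `P` at each point, and local
trivializations provide local continuous representatives. Over a cube such a family of cosets has a
global continuous section. -/
theorem exists_isDiffAlong {m : ℕ} {σ : C(Cube m, B)} {s s' : Cube m → E.Total}
    (hs : Continuous s) (hs' : Continuous s') (h : ∀ t, E.proj (s t) = σ t)
    (h' : ∀ t, E.proj (s' t) = σ t) : ∃ q, E.IsDiffAlong σ s s' q := by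
  obtain ⟨p, hp⟩ := E.exists_isDiff (h fun _ => endpoint true) (h' _)
  have key : ∀ t₀, ∃ N ∈ 𝓝 t₀, ∃ a : ∀ t, Cot (n := n) (σ t),
      ContinuousOn (fun t => cotMk (σ t) (a t)) N ∧ ∀ t ∈ N, ∀ α,
        α ∈ {α | E.IsDiff (σ t) α (s t) (s' t)} ↔ α - a t ∈ P.fiber (σ t) := by
    intro t₀
    obtain ⟨U, -, hU, r, hr⟩ := E.locally_trivial (σ t₀)
    obtain ⟨O, hO, α, hα, hαs⟩ := exists_isDiff_of_isLocalDiffeomorphOn hs h hr hU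
    obtain ⟨O', hO', α', hα', hαs'⟩ := exists_isDiff_of_isLocalDiffeomorphOn hs' h' hr hU
    refine ⟨O ∩ O', Filter.inter_mem hO hO', fun t => α' t - α t, fun t ht => ?_,
      fun t ht β => ?_⟩
    · exact continuousWithinAt_cot_sub ((hα' t ht.2).mono inter_subset_right)
        ((hα t ht.1).mono inter_subset_left)
    · exact ((hαs t ht.1).sub (hαs' t ht.2)).sub_mem_iff
  obtain ⟨q, hq, hqs, -⟩ := P.exists_continuous_section_of_coset σ _ key (fun _ => endpoint true) hp
  exact ⟨q, hq, hqs⟩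

end AffineFibration

/-! ### The section of a lattice with a given value -/

open Classical in
/-- The section of `P` along `σ` with the value `β` at `x`. -/
def Lattice.germ (P : Lattice n B k) {m : ℕ} (σ : C(Cube m, B)) (x : Cube m)
    (β : Cot (n := n) (σ x)) : P.along σ :=
  if h : β ∈ P.fiber (σ x) then (P.ev σ x).symm ⟨β, h⟩ else 0

namespace Lattice

theorem eq_germ_iff {m : ℕ} {σ : C(Cube m, B)} {x : Cube m} {β : Cot (n := n) (σ x)}
    (h : β ∈ P.fiber (σ x)) {a : P.along σ} : a = P.germ σ x β ↔ a.val x = β := by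
  rw [germ, dif_pos h, AddEquiv.eq_symm_apply]
  exact Subtype.ext_iff

theorem germ_val {m : ℕ} {σ : C(Cube m, B)} {x : Cube m} {β : Cot (n := n) (σ x)}
    (h : β ∈ P.fiber (σ x)) : (P.germ σ x β).val x = β := (eq_germ_iff h).1 rfl

theorem restrict_germ {m l : ℕ} {σ : C(Cube m, B)} (f : C(Cube l, Cube m)) {x : Cube l}
    {β : Cot (n := n) (σ (f x))} (h : β ∈ P.fiber (σ (f x))) :
    P.restrict f (P.germ σ (f x) β) = P.germ (σ.comp f) x β :=
  (eq_germ_iff (σ := σ.comp f) h).2 (germ_val h)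

theorem germ_congr {m : ℕ} {σ : C(Cube m, B)} {x y : Cube m} {β : Cot (n := n) (σ x)}
    {γ : Cot (n := n) (σ y)} (hxy : x = y) (h : cotMk (σ x) β = cotMk (σ y) γ) :
    P.germ σ x β = P.germ σ y γ := by
  subst hxy
  rw [eq_of_heq (TotalSpace.mk.inj h).2]

theorem germ_add_val {m : ℕ} {σ : C(Cube m, B)} {x : Cube m} {β : Cot (n := n) (σ x)}
    (h : β ∈ P.fiber (σ x)) (a : P.along σ) :
    P.germ σ x (β + a.val x) = P.germ σ x β + a := by
  refine ((eq_germ_iff (add_mem h (along_val_mem a x))).2 ?_).symm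
  change (P.germ σ x β).val x + a.val x = _
  rw [germ_val h]

end Lattice

section Deviation

variable {E : AffineFibration P} {s s' : B → E.Total} {d : ∀ b : B, Cot (n := n) b} {m : ℕ}
  {σ : C(Cube m, B)} {q q' : ∀ t, Cot (n := n) (σ t)}

/-- The difference `d - q` at `x`, as a section of `P` along `σ`. -/
def deviation (P : Lattice n B k) (d : ∀ b : B, Cot (n := n) b) (σ : C(Cube m, B))
    (q : ∀ t, Cot (n := n) (σ t)) (x : Cube m) : P.along σ := P.germ σ x (d (σ x) - q x)

/-- Two continuous lifts of the same difference differ by a section of `P` along the whole cube,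
which drops out of the change from `x` to `y`. -/
theorem deviation_sub_deviation
    (hd : ∀ t, E.IsDiff (σ t) (d (σ t)) (s (σ t)) (s' (σ t)))
    (hq : E.IsDiffAlong σ (fun t => s (σ t)) (fun t => s' (σ t)) q)
    (hq' : E.IsDiffAlong σ (fun t => s (σ t)) (fun t => s' (σ t)) q') (x y : Cube m) :
    deviation P d σ q x - deviation P d σ q y = deviation P d σ q' x - deviation P d σ q' y := by
  obtain ⟨a, ha⟩ : ∃ a : P.along σ, ∀ t, a.val t = q' t - q t :=
    ⟨⟨fun t => q' t - q t, fun t => (hq.2 t).sub_mem (hq'.2 t), by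
      rw [← continuousOn_univ]
      exact fun t _ => continuousWithinAt_cot_sub hq'.1.continuousWithinAt
        hq.1.continuousWithinAt⟩, fun t => rfl⟩
  have h1 : ∀ t, deviation P d σ q t = deviation P d σ q' t + a := fun t => by
    rw [deviation, deviation, ← Lattice.germ_add_val ((hq'.2 t).sub_mem (hd t)), ha]
    congr 1
    abel
  rw [h1, h1, add_sub_add_right_eq_sub]

end Deviation

end

section

variable {n : ℕ} {B : Type u} [TopologicalSpace B] [ChartedSpace (Eucl n) B]
  [IsManifold 𝓘(ℝ, Eucl n) ∞ B] {k : ℕ} {P : Lattice n B k}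
  [T2Space B] [CWComplex (univ : Set B)]

/-! ### The obstruction class does not depend on the section -/

variable (B) in
-- Every subset of the `0`-skeleton is closed: a closed cell is covered by finitely many open cells,
-- each of which contains at most one point of the `0`-skeleton. Singular cubes in the `0`-skeleton
-- are therefore constant.
theorem isDiscrete_skel_zero : IsDiscrete (skel B 0) := by
  refine isDiscrete_iff_forall_mem_exists_isClosed.2 fun D hD =>
    ⟨D, isClosed_of_forall_charMap fun m e => Or.inr ?_, inter_eq_left.2 hD⟩
  have hopen : ∀ (m : ℕ) (e : Cell B m), (D ∩ RelCWComplex.openCell m e).Finite := by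
    intro m e
    refine Subsingleton.finite fun b hb b' hb' => ?_
    obtain rfl : m = 0 := Nat.le_zero.1
      ((mem_skel_iff_of_mem_openCell (i := ⟨m, e⟩) hb.2).1 (hD hb.1))
    rw [CWComplex.openCell_zero_eq_singleton] at hb hb'
    exact hb.2.trans hb'.2.symm
  obtain ⟨I, hI⟩ := CWComplex.cellFrontier_subset_finite_openCell (C := (univ : Set B)) m e
  have hfin : (D ∩ range (charMap e)).Finite := by
    rw [range_charMap, ← RelCWComplex.cellFrontier_union_openCell_eq_closedCell]
    refine Finite.subset (Finite.union (finite_iUnion fun l : Fin m => (I l).finite_toSet.biUnion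
      fun j _ => hopen l j) (hopen m e)) ?_
    rintro b ⟨hb, hb' | hb'⟩
    · have := hI hb'
      simp only [mem_iUnion] at this
      obtain ⟨l, hl, j, hj, hbj⟩ := this
      refine Or.inl (mem_iUnion.2 ⟨⟨l, hl⟩, mem_biUnion hj ⟨hb, hbj⟩⟩)
    · exact Or.inr ⟨hb, hb'⟩
  rw [← preimage_inter_range]
  exact hfin.isClosed.preimage (charMap e).continuous

theorem eq_of_range_subset_skel_zero {m : ℕ} {σ : C(Cube m, B)} (h : range σ ⊆ skel B 0)
    (x y : Cube m) : σ x = σ y :=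
  isPreconnected_univ_cube.constant_of_mapsTo (isDiscrete_skel_zero B) σ.continuous.continuousOn
    (fun x _ => h (mem_range_self x)) (mem_univ x) (mem_univ y)

/-! ### The difference cochain of two sections over the `1`-skeleton. -/

section

variable {E : AffineFibration P} {s s' : B → E.Total} {d : ∀ b : B, Cot (n := n) b}

/-- `u` is the cochain on the paths in the `1`-skeleton that measures the difference of the
sections `s` and `s'`, with respect to their differences `d` at the points. -/
def IsDifferenceCochain (E : AffineFibration P) (s s' : B → E.Total)
    (d : ∀ b : B, Cot (n := n) b) (u : P.Cochain 1) : Prop :=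
  ∀ l : C(Cube 1, B), range l ⊆ skel B 1 → ∀ q,
    E.IsDiffAlong l (fun t => s (l t)) (fun t => s' (l t)) q →
      u l = deviation P d l q (pt true) - deviation P d l q (pt false)

theorem AffineFibration.IsSectionOverOneSkeleton.exists_isDiffAlong
    (hs : E.IsSectionOverOneSkeleton s) (hs' : E.IsSectionOverOneSkeleton s') {m : ℕ}
    {σ : C(Cube m, B)} (hσ : range σ ⊆ skel B 1) :
    ∃ q, E.IsDiffAlong σ (fun t => s (σ t)) (fun t => s' (σ t)) q :=
  AffineFibration.exists_isDiffAlong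
    (hs.1.comp_continuous σ.continuous fun t => hσ (mem_range_self t))
    (hs'.1.comp_continuous σ.continuous fun t => hσ (mem_range_self t))
    (fun t => hs.2 _ (hσ (mem_range_self t))) fun t => hs'.2 _ (hσ (mem_range_self t))

theorem exists_isDifferenceCochain
    (hd : ∀ b ∈ skel B 1, E.IsDiff b (d b) (s b) (s' b)) :
    ∃ u, IsDifferenceCochain E s s' d u := by
  have key : ∀ l : C(Cube 1, B), ∃ a : P.along l, range l ⊆ skel B 1 → ∀ q,
      E.IsDiffAlong l (fun t => s (l t)) (fun t => s' (l t)) q →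
        a = deviation P d l q (pt true) - deviation P d l q (pt false) := by
    intro l
    by_cases h : ∃ q, E.IsDiffAlong l (fun t => s (l t)) (fun t => s' (l t)) q
    · obtain ⟨q, hq⟩ := h
      exact ⟨_, fun hl q' hq' => deviation_sub_deviation
        (fun t => hd _ (hl (mem_range_self t))) hq hq' _ _⟩
    · exact ⟨0, fun _ q hq => (h ⟨q, hq⟩).elim⟩
  choose u hu using key
  exact ⟨u, hu⟩

variable {u : P.Cochain 1}

theorem IsDifferenceCochain.eq_zero_of_const (hu : IsDifferenceCochain E s s' d u)
    (hd : ∀ b ∈ skel B 1, E.IsDiff b (d b) (s b) (s' b)) {l : C(Cube 1, B)}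
    (hl : range l ⊆ skel B 1) (hc : ∀ x y, l x = l y) : u l = 0 := by
  obtain ⟨b, rfl⟩ : ∃ b, l = .const _ b := ⟨l (pt true), ContinuousMap.ext fun x => hc _ _⟩
  have h0 := hd b (hl ⟨pt true, rfl⟩)
  rw [hu _ hl (fun _ => d b) ⟨continuous_const (y := cotMk b (d b)), fun _ => h0⟩]
  have h1 : ∀ x, deviation P d (.const (Cube 1) b) (fun _ => d b) x = 0 := fun x => by
    refine ((Lattice.eq_germ_iff ?_).2 ?_).symm
    · exact (sub_self (d b)).symm ▸ zero_mem _
    · exact (sub_self (d b)).symm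
  rw [h1, h1, sub_zero]

/-- The values of `u` on different edges lie in different groups. Writing each as the restriction of
a section along the larger cube lets them be added. -/
theorem IsDifferenceCochain.eq_restrict (hu : IsDifferenceCochain E s s' d u)
    (hd : ∀ b ∈ skel B 1, E.IsDiff b (d b) (s b) (s' b)) {m : ℕ} {σ : C(Cube m, B)}
    {f : C(Cube 1, Cube m)} (hf : range (σ.comp f) ⊆ skel B 1)
    {q : ∀ x, Cot (n := n) (σ (f x))}
    (hq : E.IsDiffAlong (σ.comp f) (fun x => s (σ (f x))) (fun x => s' (σ (f x))) q) :
    u (σ.comp f) = P.restrict f (P.germ σ (f (pt true)) (d (σ (f (pt true))) - q (pt true)) -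
      P.germ σ (f (pt false)) (d (σ (f (pt false))) - q (pt false))) := by
  have h1 : ∀ x, d (σ (f x)) - q x ∈ P.fiber (σ (f x)) := fun x =>
    (hq.2 x).sub_mem (hd _ (hf (mem_range_self x)))
  rw [hu _ hf q hq, map_sub, Lattice.restrict_germ f (h1 _), Lattice.restrict_germ f (h1 _)]
  rfl

theorem isCoboundaryOn_squareSum {σ : C(Cube 2, B)} {p : Fin 2 → Bool → P.along σ}
    (hp : ∀ i ε, P.restrict (face i ε) (p i ε) = u (σ.comp (face i ε))) :
    Lattice.IsCoboundaryOn u σ (squareSum p) := by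
  refine ⟨p, hp, ?_⟩
  refine Eq.trans ?_ (Fin.sum_univ_two _).symm
  simp only [squareSum, Fin.val_zero, Fin.val_one, pow_zero, pow_one, one_smul, neg_smul]
  exact sub_eq_add_neg _ _

theorem IsDifferenceCochain.mem_relCocycles (hu : IsDifferenceCochain E s s' d u)
    (hs : E.IsSectionOverOneSkeleton s) (hs' : E.IsSectionOverOneSkeleton s')
    (hd : ∀ b ∈ skel B 1, E.IsDiff b (d b) (s b) (s' b)) :
    u ∈ P.relCocycles (skel B 1) (skel B 0) 1 := by
  refine ⟨fun l hl => ?_, fun l hl h => ?_, fun τ hτ => ?_⟩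
  · exact hu.eq_zero_of_const hd (hl.trans (skel_mono (by omega)))
      (eq_of_range_subset_skel_zero hl)
  · obtain ⟨i, l, rfl⟩ := exists_eq_comp_dropCoord h
    exact hu.eq_zero_of_const hd hl fun x y => congrArg l (Subsingleton.elim _ _)
  -- Over a square in the `1`-skeleton one lift `q` serves for all four edges, and the deviations at
  -- the vertices cancel.
  · obtain ⟨q, hq⟩ := hs.exists_isDiffAlong hs' hτ
    have h1 := isCoboundaryOn_squareSum (u := u) (σ := τ) (p := fun i ε =>
      deviation P d τ q (face i ε (pt true)) - deviation P d τ q (face i ε (pt false)))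
      fun i ε => (hu.eq_restrict hd (range_comp_subset hτ _) (q := fun x => q (face i ε x))
        ⟨hq.1.comp (face i ε).continuous, fun x => hq.2 _⟩).symm
    convert h1 using 1
    simp only [squareSum, face_zero_pt, face_one_pt]
    abel

/-- Parametrizations of the sides of the square by parts of its boundary loop. -/
theorem boundaryLoop_side (x : Cube 1) :
    boundaryLoop (x 0 + 1) = face 1 false x ∧ boundaryLoop (x 0 + 3) = face 0 true x ∧
      boundaryLoop (5 - x 0) = face 1 true x ∧ boundaryLoop (7 - x 0) = face 0 false x := by
  have h := (x 0).2
  have h1 : ∀ a : ℝ, 1 ≤ a → Set.projIcc (-1 : ℝ) 1 (by norm_num) a = endpoint true := fun a ha =>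
    Set.projIcc_of_right_le _ ha
  have h2 : ∀ a : ℝ, a ≤ -1 → Set.projIcc (-1 : ℝ) 1 (by norm_num) a = endpoint false :=
    fun a ha => Set.projIcc_of_le_left _ ha
  have h3 : ∀ a : ℝ, a = x 0 → Set.projIcc (-1 : ℝ) 1 (by norm_num) a = x 0 :=
    fun a ha => ha ▸ Set.projIcc_val _ _
  rw [face_zero_apply, face_one_apply, face_zero_apply, face_one_apply]
  simp only [boundaryLoop]
  refine ⟨?_, ?_, ?_, ?_⟩
  · rw [abs_of_nonpos (by linarith [h.2]), abs_of_nonpos (by linarith [h.2]),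
      h3 _ (by ring), h2 _ (by linarith [h.2])]
  · rw [add_sub_cancel_right, abs_of_nonpos (a := (x 0 : ℝ) + 3 - 5) (by linarith [h.2]),
      h3 (2 - -((x 0 : ℝ) + 3 - 5)) (by ring), h1 _ (by linarith [abs_le.2 h])]
  · rw [show (5 : ℝ) - x 0 - 5 = -x 0 by ring, abs_neg, abs_of_nonneg (by linarith [h.2]),
      h3 _ (by ring), h1 _ (by linarith [abs_le.2 h])]
  · rw [abs_of_nonneg (by linarith [h.2]), abs_of_nonneg (by linarith [h.2]),
      h2 _ (by linarith [h.2]), h3 _ (by ring)]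

/-- The value of the difference cochain on a side of the square, in terms of a lift along the
boundary loop. -/
theorem IsDifferenceCochain.eq_restrict_boundaryLoop (hu : IsDifferenceCochain E s s' d u)
    (hd : ∀ b ∈ skel B 1, E.IsDiff b (d b) (s b) (s' b)) (e : Cell B 2)
    {q : ∀ θ, Cot (n := n) (charMap e (boundaryLoop θ))}
    (hqc : ContinuousOn (fun θ => cotMk (charMap e (boundaryLoop θ)) (q θ)) (Icc 0 8))
    (hq : ∀ θ ∈ Icc (0 : ℝ) 8, E.IsDiff _ (q θ) (s (charMap e (boundaryLoop θ)))
      (s' (charMap e (boundaryLoop θ))))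
    {f : C(Cube 1, Cube 2)} {g : Cube 1 → ℝ} (hg : Continuous g) (hgI : ∀ x, g x ∈ Icc (0 : ℝ) 8)
    (hgf : ∀ x, boundaryLoop (g x) = f x) {a b : ℝ} (ha : g (pt true) = a)
    (hb : g (pt false) = b) :
    P.restrict f (P.germ (charMap e) (boundaryLoop a) (d (charMap e (boundaryLoop a)) - q a) -
      P.germ (charMap e) (boundaryLoop b) (d (charMap e (boundaryLoop b)) - q b)) =
        u ((charMap e).comp f) := by
  subst ha hb
  obtain rfl : f = ⟨fun x => boundaryLoop (g x), continuous_boundaryLoop.comp hg⟩ :=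
    ContinuousMap.ext fun x => (hgf x).symm
  refine (hu.eq_restrict hd (σ := charMap e)
    (f := ⟨fun x => boundaryLoop (g x), continuous_boundaryLoop.comp hg⟩) ?_ (q := fun x => q (g x))
    ⟨hqc.comp_continuous hg hgI, fun x => hq _ (hgI x)⟩).symm
  rintro _ ⟨x, rfl⟩
  exact charMap_mem_skel_of_mem_bdry e (boundaryLoop_mem_bdry _)

/-- Sections `t`, `t'` over the cell, whose difference lifts to `r` on the square, turn the lifts
`a`, `a'` into a lift `q = a' + r - a` of the difference of `s` and `s'` along the boundary loop.
Around the loop `r` returns to its value, so `q` changes by `c' - c` and the deviation `d - q` by `c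
- c'`. -/
theorem IsDifferenceCochain.isCoboundaryOn (hu : IsDifferenceCochain E s s' d u)
    (hd : ∀ b ∈ skel B 1, E.IsDiff b (d b) (s b) (s' b)) {c c' : P.CellCochain 2}
    (hc : E.IsObstructionCochain s c) (hc' : E.IsObstructionCochain s' c') (e : Cell B 2) :
    Lattice.IsCoboundaryOn u (charMap e) (c e - c' e) := by
  obtain ⟨t, ht, a, hac, ha, ha8⟩ := hc e
  obtain ⟨t', ht', a', hac', ha', ha8'⟩ := hc' e
  obtain ⟨r, hr⟩ := AffineFibration.exists_isDiffAlong (σ := charMap e) ht ht'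
    (fun x => (t x).2) fun x => (t' x).2
  set q : ∀ θ, Cot (n := n) (charMap e (boundaryLoop θ)) := fun θ =>
    a' θ + r (boundaryLoop θ) - a θ with hqdef
  have hqc : ContinuousOn (fun θ => cotMk (charMap e (boundaryLoop θ)) (q θ)) (Icc 0 8) :=
    fun θ hθ => continuousWithinAt_cot_sub (continuousWithinAt_cot_add (hac' θ hθ)
      (hr.1.comp continuous_boundaryLoop).continuousWithinAt) (hac θ hθ)
  have hq : ∀ θ ∈ Icc (0 : ℝ) 8, E.IsDiff _ (q θ) (s (charMap e (boundaryLoop θ)))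
      (s' (charMap e (boundaryLoop θ))) := by
    intro θ hθ
    have hb := charMap_mem_skel_of_mem_bdry e (boundaryLoop_mem_bdry θ)
    have h1 : E.IsDiff _ (a θ) (t (boundaryLoop θ)).1 (s (charMap e (boundaryLoop θ))) :=
      ⟨(t _).2, (hd _ hb).1, Subtype.ext (ha θ hθ).symm⟩
    have h2 : E.IsDiff _ (a' θ) (t' (boundaryLoop θ)).1 (s' (charMap e (boundaryLoop θ))) :=
      ⟨(t' _).2, (hd _ hb).2.1, Subtype.ext (ha' θ hθ).symm⟩
    exact h1.sub ((hr.2 (boundaryLoop θ)).add h2)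
  set D : ℝ → P.along (charMap e) := fun θ =>
    P.germ (charMap e) (boundaryLoop θ) (d (charMap e (boundaryLoop θ)) - q θ) with hD
  have hD8 : D 8 = D 0 + (c e - c' e) := by
    have hb := charMap_mem_skel_of_mem_bdry e (boundaryLoop_mem_bdry 0)
    have h0 : d (charMap e (boundaryLoop 0)) - q 0 ∈ P.fiber (charMap e (boundaryLoop 0)) :=
      (hq 0 (by norm_num)).sub_mem (hd _ hb)
    -- The covectors at `θ = 8` and `θ = 0` lie over points of the square that are only
    -- propositionally equal, so the comparison is made for variable points.
    have key : ∀ (y y' : Cube 2) (_ : y = y') (α α' : Cot (n := n) (charMap e y))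
        (β β' : Cot (n := n) (charMap e y')),
        cotMk (charMap e y) α = cotMk (charMap e y') β →
        cotMk (charMap e y) α' = cotMk (charMap e y') β' →
        cotMk (charMap e y) (d (charMap e y) - (α' + r y - α)) =
          cotMk (charMap e y') (d (charMap e y') - (β' + r y' - β)) := by
      rintro y _ rfl α α' β β' h h'
      rw [eq_of_heq (TotalSpace.mk.inj h).2, eq_of_heq (TotalSpace.mk.inj h').2]
    refine (Lattice.germ_congr boundaryLoop_eight
      (key _ _ boundaryLoop_eight _ _ _ _ ha8 ha8')).trans ?_
    rw [hD, ← Lattice.germ_add_val h0]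
    congr 1
    have habel : ∀ {A : Type} [AddCommGroup A] (d a a' r z z' : A),
        d - (a' + z' + r - (a + z)) = d - (a' + r - a) + (z - z') := by
      intros
      abel
    exact habel _ _ _ _ ((c e).val _) ((c' e).val _)
  -- The corners are the parameters `0, 2, 4, 6, 8`, with `(-1, -1)` occurring both as `0` and as
  -- `8`. The left side and the top are traversed backwards, so their cube orientation runs from `8`
  -- to `6` and from `6` to `4`. In the signed sum everything cancels except `D 8 - D 0`.
  have hside : ∀ i ε, P.restrict (face i ε) ((![fun ε => cond ε (D 4 - D 2) (D 6 - D 8),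
      fun ε => cond ε (D 4 - D 6) (D 2 - D 0)] : Fin 2 → Bool → P.along (charMap e)) i ε) =
      u ((charMap e).comp (face i ε)) := by
    have hx : ∀ x : Cube 1, (x 0 : ℝ) ∈ Icc (-1 : ℝ) 1 := fun x => (x 0).2
    intro i ε
    fin_cases i <;> cases ε
    · exact hu.eq_restrict_boundaryLoop hd e hqc hq (g := fun x => 7 - x 0) (by fun_prop)
        (fun x => ⟨by linarith [(hx x).2], by linarith [(hx x).1]⟩)
        (fun x => (boundaryLoop_side x).2.2.2) (by norm_num [pt, endpoint])
        (by norm_num [pt, endpoint])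
    · exact hu.eq_restrict_boundaryLoop hd e hqc hq (g := fun x => x 0 + 3) (by fun_prop)
        (fun x => ⟨by linarith [(hx x).1], by linarith [(hx x).2]⟩)
        (fun x => (boundaryLoop_side x).2.1) (by norm_num [pt, endpoint])
        (by norm_num [pt, endpoint])
    · exact hu.eq_restrict_boundaryLoop hd e hqc hq (g := fun x => x 0 + 1) (by fun_prop)
        (fun x => ⟨by linarith [(hx x).1], by linarith [(hx x).2]⟩)
        (fun x => (boundaryLoop_side x).1) (by norm_num [pt, endpoint])
        (by norm_num [pt, endpoint])
    · exact hu.eq_restrict_boundaryLoop hd e hqc hq (g := fun x => 5 - x 0) (by fun_prop)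
        (fun x => ⟨by linarith [(hx x).2], by linarith [(hx x).1]⟩)
        (fun x => (boundaryLoop_side x).2.2.1) (by norm_num [pt, endpoint])
        (by norm_num [pt, endpoint])
  have h1 := isCoboundaryOn_squareSum hside
  convert h1 using 1
  simp only [squareSum, Matrix.cons_val_zero, Matrix.cons_val_one, cond_true, cond_false]
  rw [hD8]
  abel

theorem AffineFibration.IsObstructionCochain.sub_mem_cellCoboundaries
    (hs : E.IsSectionOverOneSkeleton s) (hs' : E.IsSectionOverOneSkeleton s')
    {c c' : P.CellCochain 2} (hc : E.IsObstructionCochain s c)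
    (hc' : E.IsObstructionCochain s' c') : c - c' ∈ P.cellCoboundaries := by
  have key : ∀ b : B, ∃ d : Cot (n := n) b, b ∈ skel B 1 → E.IsDiff b d (s b) (s' b) := by
    intro b
    by_cases hb : b ∈ skel B 1
    · obtain ⟨α, hα⟩ := E.exists_isDiff (hs.2 b hb) (hs'.2 b hb)
      exact ⟨α, fun _ => hα⟩
    · exact ⟨0, fun h => (hb h).elim⟩
  choose d hd using key
  obtain ⟨u, hu⟩ := exists_isDifferenceCochain hd
  exact ⟨fun e => u (charMap e), u, ⟨hu.mem_relCocycles hs hs' hd, fun e => rfl⟩,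
    hu.isCoboundaryOn hd hc hc'⟩

end

/-- Every cellular `2`-cocycle is an obstruction cochain. -/
theorem Lattice.IsCellCocycle.exists_affineFibration [SecondCountableTopology B]
    {c : P.CellCochain 2} (hc : Lattice.IsCellCocycle c) :
    ∃ (E : AffineFibration P) (s : B → E.Total),
      E.IsSectionOverOneSkeleton s ∧ E.IsObstructionCochain s c := by
  obtain ⟨G, hG, hG₁, hG₂⟩ := exists_twistData hc
  obtain ⟨T, i, h, hi, hh, hg⟩ := exists_smoothTwist hG
  exact ⟨T.affineFibration, fun b => T.point b 0, T.isSectionOverOneSkeleton_zero hh hg hG₁,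
    T.isObstructionCochain_zero hi hh hg hG₂⟩

end

end LatticeFibration

end

theorem theorem8 {n : ℕ} {B : Type*} [TopologicalSpace B]
    [ChartedSpace (LatticeFibration.Eucl n) B]
    [IsManifold 𝓘(ℝ, LatticeFibration.Eucl n) ∞ B] [T2Space B] [SecondCountableTopology B]
    [CWComplex (univ : Set B)] {k : ℕ} (P : LatticeFibration.Lattice n B k) (hP : P.Closed) :
    ∀ γ ∈ P.H2, ∃ E : LatticeFibration.AffineFibration P, E.IsPrimaryObstructionClass γ := by
  rintro γ ⟨c, hc, rfl⟩
  obtain ⟨E, s, hs, hsc⟩ := hc.exists_affineFibration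
  refine ⟨E, ⟨s, c, hs, hsc⟩, fun s' c' hs' hsc' => QuotientAddGroup.eq.2 ?_⟩
  rw [neg_add_eq_sub]
  exact LatticeFibration.AffineFibration.IsObstructionCochain.sub_mem_cellCoboundaries hs hs' hsc
    hsc'
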